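/- **Setting.** Let $U\subset\mathbb R^3$ be a bounded open set with a polyhedral mesh $\mathcal M_h=\mathcal T_h\cup\mathcal F_h\cup\mathcal E_h\cup\mathcal V_h$ (finitely many pairwise disjoint open polyhedral elements $T$, relatively open planar polygonal faces $F$, open segments $E$ and vertices $V$; elements and faces are simply connected with connected boundary and star-shaped with respect to a ball, resp. disc, centred at a chosen point $x_T\in T$, resp. $x_F\in F$; the boundary of an element (face) is made of faces (edges) of the mesh, and the element (face) lies on exactly one side of each of them). Faces carry unit normals $n_F$, edges unit tangents $t_E$, and $n_{FE}=n_F\times t_E$. Let $\omega_{TF}=1$ if $n_F$ points out of $T$, $-1$ otherwise; $\omega_{FE}=1$ if $n_{FE}$ points out of $F$, $-1$ otherwise; $\omega_{EV}=1$ if $t_E$ points towards $V$, $-1$ otherwise. $\mathcal F_T,\mathcal E_T,\mathcal E_F,\mathcal V_E$ denote the faces and edges of $T$, the edges of $F$ and the vertices of $E$, and $h_P$ the diameter of $P$. Fix $k\ge 0$ and, for each $P\in\mathcal T_h\cup\mathcal F_h$, a set of $\eta_P\ge2$ faces (edges) of $P$, not pairwise aligned, such that $P$ lies on one side of the plane (line)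 spanned by each of them; put $\ell_P=k+1-\eta_P$. $\mathcal P^\ell(P)$ is the space of restrictions to $P$ of polynomials of total degree $\le\ell$ ($\{0\}$ if $\ell<0$), $\boldsymbol{\mathcal P}^\ell(T)=\mathcal P^\ell(T)^3$, and $\boldsymbol{\mathcal P}^\ell(F)$ consists of the tangential fields in $\mathcal P^\ell(F)^3$. With $\mathbf{rot}_Fr=\nabla r\times n_F$, let $\mathcal R^\ell(F)=\mathbf{rot}_F\mathcal P^{\ell+1}(F)$, $\mathcal R^{c,\ell}(F)=(x-x_F)\mathcal P^{\ell-1}(F)$, $\mathcal R^\ell(T)=\mathrm{curl}\,\boldsymbol{\mathcal P}^{\ell+1}(T)$, $\mathcal R^{c,\ell}(T)=(x-x_T)\mathcal P^{\ell-1}(T)$, $\mathcal G^\ell(T)=\nabla\mathcal P^{\ell+1}(T)$, $\mathcal G^{c,\ell}(T)=(x-x_T)\times\boldsymbol{\mathcal P}^{\ell-1}(T)$. $\pi_{\mathcal X}$ denotes the $L^2$-orthogonal projector on $\mathcal X$. The spaces are $$X_{\rm grad}=\{((q_T),(q_F),(q_E),(q_V))\}=\prod_T\mathcal P^{\ell_T}(T)\times\prod_F\mathcal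 P^{\ell_F}(F)\times\prod_E\mathcal P^{k-1}(E)\times\mathbb R^{\mathcal V_h},$$ $$X_{\rm curl}=\{((v_T,v_T^c),(v_F,v^c_F),(v_E))\}=\prod_T\big(\mathcal R^{k-1}(T)\times\mathcal R^{c,\ell_T+1}(T)\big)\times\prod_F\big(\mathcal R^{k-1}(F)\times\mathcal R^{c,\ell_F+1}(F)\big)\times\prod_E\mathcal P^k(E),$$ $$X_{\rm div}=\{((w_T,w_T^c),(w_F))\}=\prod_T\big(\mathcal G^{k-1}(T)\times\mathcal G^{c,k}(T)\big)\times\prod_F\mathcal P^k(F).$$ Let $S_{G,P}$ and $S_{C,P}$ ($P\in\mathcal T_h\cup\mathcal F_h$) be any linear operators with values in $\boldsymbol{\mathcal P}^k(P)$, defined on the restrictions of $X_{\rm grad}$, resp. $X_{\rm curl}$, to $P$ and its boundary entities (serendipity operators). *Reconstructions.* The following polynomials are defined by the stated relations. - $G_Eq\in\mathcal P^k(E)$: $\int_EG_Eq\,r=-\int_Eq_Er'+\sum_{V\in\mathcal V_E}\omega_{EV}q_Vr(x_V)$ for all $r\in\mathcal P^k(E)$. $\gamma_Eq\in\mathcal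 P^{k+1}(E)$: $\gamma_Eq(x_V)=q_V$ for $V\in\mathcal V_E$ and $\pi_{\mathcal P^{k-1}(E)}\gamma_Eq=q_E$. - $G_Fq\in\boldsymbol{\mathcal P}^k(F)$: $\int_FG_Fq\cdot(w+\tau)=\sum_{E\in\mathcal E_F}\omega_{FE}\int_E\gamma_Eq\,w\cdot n_{FE}+\int_FS_{G,F}q\cdot\tau$ on $\mathcal R^k(F)\times\mathcal R^{c,k}(F)$. $\gamma_Fq\in\mathcal P^{k+1}(F)$: $\int_F\gamma_Fq\,\mathrm{div}_Fw=-\int_FG_Fq\cdot w+\sum_{E\in\mathcal E_F}\omega_{FE}\int_E\gamma_Eq\,w\cdot n_{FE}$ for $w\in\mathcal R^{c,k+2}(F)$. - $G_Tq\in\boldsymbol{\mathcal P}^k(T)$: $\int_TG_Tq\cdot(w+\tau)=\sum_{F\in\mathcal F_T}\omega_{TF}\int_F\gamma_Fq\,w\cdot n_F+\int_TS_{G,T}q\cdot\tau$ on $\mathcal R^k(T)\times\mathcal R^{c,k}(T)$. $P_{\rm grad}q|_T\in\mathcal P^{k+1}(T)$: $\int_TP_{\rm grad}q\,\mathrm{div}\,w=-\int_TG_Tq\cdot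 w+\sum_{F\in\mathcal F_T}\omega_{TF}\int_F\gamma_Fq\,w\cdot n_F$ for $w\in\mathcal R^{c,k+2}(T)$. - $C_Fv\in\mathcal P^k(F)$: $\int_FC_Fv\,r=\int_Fv_F\cdot\mathbf{rot}_Fr-\sum_{E\in\mathcal E_F}\omega_{FE}\int_Ev_Er$ for $r\in\mathcal P^k(F)$. $\gamma_{t,F}v\in\boldsymbol{\mathcal P}^k(F)$: $\int_F\gamma_{t,F}v\cdot(\mathbf{rot}_Fr+\tau)=\int_FC_Fv\,r+\sum_{E\in\mathcal E_F}\omega_{FE}\int_Ev_Er+\int_FS_{C,F}v\cdot\tau$ for $r\in\mathcal P^{k+1}(F)$ with $\int_Fr=0$ and $\tau\in\mathcal R^{c,k}(F)$. - $\mathbf C_Tv\in\boldsymbol{\mathcal P}^k(T)$: $\int_T\mathbf C_Tv\cdot w=\int_Tv_T\cdot\mathrm{curl}\,w+\sum_{F\in\mathcal F_T}\omega_{TF}\int_F\gamma_{t,F}v\cdot(w\times n_F)$ for $w\in\boldsymbol{\mathcal P}^k(T)$. $P_{\rm curl}v|_T\in\boldsymbol{\mathcal P}^k(T)$: $\int_TP_{\rm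 curl}v\cdot(\mathrm{curl}\,w+\tau)=\int_T\mathbf C_Tv\cdot w-\sum_{F\in\mathcal F_T}\omega_{TF}\int_F\gamma_{t,F}v\cdot(w\times n_F)+\int_TS_{C,T}v\cdot\tau$ on $\mathcal G^{c,k+1}(T)\times\mathcal R^{c,k}(T)$. - $D_Tw\in\mathcal P^k(T)$: $\int_TD_Tw\,q=-\int_Tw_T\cdot\nabla q+\sum_{F\in\mathcal F_T}\omega_{TF}\int_Fw_Fq$ for $q\in\mathcal P^k(T)$. $P_{\rm div}w|_T\in\boldsymbol{\mathcal P}^k(T)$: $\int_TP_{\rm div}w\cdot(\nabla r+\tau)=-\int_TD_Tw\,r+\sum_{F\in\mathcal F_T}\omega_{TF}\int_Fw_Fr+\int_Tw_T^c\cdot\tau$ for $r\in\mathcal P^{k+1}(T)$ with $\int_Tr=0$ and $\tau\in\mathcal G^{c,k}(T)$. *Discrete gradient and curl.* $G_hq\in X_{\rm curl}$ has components $\pi_{\mathcal R^{k-1}(T)}G_Tq$, $\pi_{\mathcal R^{c,\ell_T+1}(T)}G_Tq$, $\pi_{\mathcal R^{k-1}(F)}G_Fq$, $\pi_{\mathcal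 R^{c,\ell_F+1}(F)}G_Fq$, $G_Eq$; $C_hv\in X_{\rm div}$ has components $\pi_{\mathcal G^{k-1}(T)}\mathbf C_Tv$, $\pi_{\mathcal G^{c,k}(T)}\mathbf C_Tv$, $C_Fv$. Let $\mathbf C_hv$ be the piecewise polynomial field equal to $\mathbf C_Tv$ on $T$. *Discrete products.* For $\bullet\in\{\mathrm{curl},\mathrm{div}\}$, $(x,y)_\bullet=\sum_T\big[\int_TP_\bullet x\cdot P_\bullet y+s_{\bullet,T}(x,y)\big]$ with $$s_{{\rm curl},T}(w,v)=\sum_{F\in\mathcal F_T}h_F\int_F\big((P_{\rm curl}w)_{t,F}-\gamma_{t,F}w\big)\cdot\big((P_{\rm curl}v)_{t,F}-\gamma_{t,F}v\big)+\sum_{E\in\mathcal E_T}h_E^2\int_E(P_{\rm curl}w\cdot t_E-w_E)(P_{\rm curl}v\cdot t_E-v_E),$$ $$s_{{\rm div},T}(w,v)=\sum_{F\in\mathcal F_T}h_F\int_F(P_{\rm div}w\cdot n_F-w_F)(P_{\rm div}v\cdot n_F-v_F),\qquad s_{{\rm div},h}=\sum_Ts_{{\rm div},T},$$ where $P_\bullet$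 is taken from $T$ and $z_{t,F}=n_F\times(z\times n_F)$. *Lie algebra.* Let $\mathfrak g$ be a finite-dimensional real Lie algebra with basis $(e_I)$ and an ad-invariant inner product $\langle\cdot,\cdot\rangle$, i.e. $\langle[x,y],z\rangle=-\langle y,[x,z]\rangle$. All spaces are tensored with $\mathfrak g$, operators act componentwise on $v=v^I\otimes e_I$, and products (and $s_{{\rm div},h}$) are tensored with $\langle\cdot,\cdot\rangle$; $\|\cdot\|_\bullet^2=(\cdot,\cdot)_\bullet$. Put $[v,q]=v^Iq^J\otimes[e_I,e_J]$ and ${}^*[v,w]=(v^I\times w^J)\otimes[e_I,e_J]$ for vector fields $v,w$ and functions $q$. For $v,w\in X_{\rm curl}\otimes\mathfrak g$ let ${}^*[v,w]_h\in X_{\rm div}\otimes\mathfrak g$ have components $\pi_{\mathcal G^{k-1}(T)}{}^*[P_{\rm curl}v,P_{\rm curl}w]$, $\pi_{\mathcal G^{c,k}(T)}{}^*[P_{\rm curl}v,P_{\rm curl}w]$ and $\pi_{\mathcal P^k(F)}({}^*[\gamma_{t,F}v,\gamma_{t,F}w]\cdot n_F)$. *Scheme.* Let $0=t^0<\dots<t^N$,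 $\delta^{n+1}v=(v^{n+1}-v^n)/(t^{n+1}-t^n)$, $A^{n+1/2}=\frac12(A^n+A^{n+1})$, and let $A^n,E^n\in X_{\rm curl}\otimes\mathfrak g$, $\lambda^n\in X_{\rm grad}\otimes\mathfrak g$ satisfy, for $0\le n<N$ and all $v\in X_{\rm curl}\otimes\mathfrak g$, $q\in X_{\rm grad}\otimes\mathfrak g$: $\delta^{n+1}A=-E^{n+1}$, $$(\delta^{n+1}E,v)_{\rm curl}+(G_h\lambda^{n+1},v)_{\rm curl}+\int_U\langle[P_{\rm curl}A^{n+1},P_{\rm grad}\lambda^{n+1}],P_{\rm curl}v\rangle=(C_hA^{n+1},C_hv)_{\rm div}+\mathfrak N(A^n,A^{n+1};v),$$ $$(\delta^{n+1}E,G_hq)_{\rm curl}+\int_U\langle P_{\rm curl}\delta^{n+1}E,[P_{\rm curl}A^n,P_{\rm grad}q]\rangle=0,$$ where $\mathfrak N\in\{\mathfrak N_1,\mathfrak N_2\}$ is one of $$\mathfrak N_1=(C_hA^{n+1},{}^*[A^{n+1/2},v]_h)_{\rm div}+\big(\tfrac12{}^*[A^{n+1},A^{n+1}]_h,\;C_hv+{}^*[A^{n+1/2},v]_h\big)_{\rm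 div},$$ $$\mathfrak N_2=\int_U\langle\mathbf C_hA^{n+1},{}^*[P_{\rm curl}A^{n+1/2},P_{\rm curl}v]\rangle+\int_U\big\langle\tfrac12{}^*[P_{\rm curl}A^{n+1},P_{\rm curl}A^{n+1}],\;\mathbf C_hv+{}^*[P_{\rm curl}A^{n+1/2},P_{\rm curl}v]\big\rangle.$$ **Proposition (energy dissipation).** If the initial data satisfy $$\mathfrak C^0(q):=(E^0,G_hq)_{\rm curl}+\int_U\langle P_{\rm curl}E^0,[P_{\rm curl}A^0,P_{\rm grad}q]\rangle=0\qquad\text{for all }q\in X_{\rm grad}\otimes\mathfrak g,$$ then, for all $0\le n<N$, $$\tfrac12\|E^{n+1}\|_{\rm curl}^2+\mathfrak B^{n+1}\le\tfrac12\|E^n\|_{\rm curl}^2+\mathfrak B^n,$$ where $\mathfrak B^n=\frac12\|C_hA^n+\frac12{}^*[A^n,A^n]_h\|_{\rm div}^2$ if $\mathfrak N=\mathfrak N_1$, and $\mathfrak B^n=\frac12\|\mathbf C_hA^n+\frac12{}^*[P_{\rm curl}A^n,P_{\rm curl}A^n]\|_{L^2(U)\otimes\mathfrak g}^2+\frac12s_{{\rm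 div},h}(C_hA^n,C_hA^n)$ if $\mathfrak N=\mathfrak N_2$. -/

import Mathlib

open MeasureTheory MvPolynomial
open scoped Matrix

namespace YM

noncomputable section

/-! ## Ambient three-dimensional space and polynomial calculus -/

/-- Euclidean space of dimension three (points and vectors). -/
abbrev E3 : Type := EuclideanSpace ℝ (Fin 3)

/-- Three-variate real polynomials. -/
abbrev Poly3 : Type := MvPolynomial (Fin 3) ℝ

/-- Polynomial vector fields on three-dimensional space. -/
abbrev VPoly3 : Type := Fin 3 → Poly3

/-- Cross product of vectors. -/
def cross (a b : E3) : E3 := WithLp.toLp 2 (a.ofLp ⨯₃ b.ofLp)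

/-- Value of a polynomial at a point. -/
def evalS (p : Poly3) (x : E3) : ℝ := eval x.ofLp p

/-- Value of a polynomial vector field at a point. -/
def evalV (w : VPoly3) (x : E3) : E3 := WithLp.toLp 2 (fun i => eval x.ofLp (w i))

/-- Polynomials of total degree at most `l`; this is `{0}` if `l < 0`. -/
def Pol (l : ℤ) : Submodule ℝ Poly3 :=
  if 0 ≤ l then restrictTotalDegree (Fin 3) ℝ l.toNat else ⊥

/-- Vector fields with components in `Pol l`. -/
def VPol (l : ℤ) : Submodule ℝ VPoly3 := Submodule.pi Set.univ (fun _ => Pol l)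

/-- The constant polynomial field `a`. -/
def constV (a : E3) : VPoly3 := fun i => C (a i)

/-- The polynomial field `x ↦ x - c`. -/
def posV (c : E3) : VPoly3 := fun i => X i - C (c i)

/-- Derivative of a polynomial in the direction `a`. -/
def dirDeriv (a : E3) (p : Poly3) : Poly3 := ∑ i, C (a i) * pderiv i p

/-- Gradient. -/
def gradP : Poly3 →ₗ[ℝ] VPoly3 where
  toFun p := fun i => pderiv i p
  map_add' p q := by ext1 i; simp
  map_smul' c p := by ext1 i; simp

/-- Divergence. -/
def divP (w : VPoly3) : Poly3 := ∑ i, pderiv i (w i)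

/-- Curl. -/
def curlP : VPoly3 →ₗ[ℝ] VPoly3 where
  toFun w := ![pderiv 1 (w 2) - pderiv 2 (w 1), pderiv 2 (w 0) - pderiv 0 (w 2),
    pderiv 0 (w 1) - pderiv 1 (w 0)]
  map_add' v w := by ext1 i; fin_cases i <;> simp <;> ring
  map_smul' c w := by ext1 i; fin_cases i <;> simp [smul_sub]

/-- Multiplication of scalar polynomials by `x - c`. -/
def mulPos (c : E3) : Poly3 →ₗ[ℝ] VPoly3 where
  toFun p := fun i => p * posV c i
  map_add' p q := by ext1 i; simp [add_mul]
  map_smul' a p := by ext1 i; simp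

/-- The map `w ↦ (x - c) × w`. -/
def crossPos (c : E3) : VPoly3 →ₗ[ℝ] VPoly3 where
  toFun w := posV c ⨯₃ w
  map_add' v w := by simp
  map_smul' a w := by
    ext1 i; fin_cases i <;> simp [crossProduct]

/-- Two-dimensional vector curl of (the restriction of) a polynomial on a plane with unit normal
`n`: the tangential gradient rotated by `-π/2` in the plane oriented by `n`, that is `∇r × n`. -/
def rotP (n : E3) : Poly3 →ₗ[ℝ] VPoly3 where
  toFun r := gradP r ⨯₃ constV n
  map_add' p q := by simp
  map_smul' a p := by
    ext1 i; fin_cases i <;> simp [crossProduct]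

/-- Divergence on a plane with unit normal `n` of (the restriction of) a field that is tangential
on that plane: the trace of its derivative over the tangent directions. -/
def divF (n : E3) (w : VPoly3) : Poly3 := divP w - ∑ i, C (n i) * dirDeriv n (w i)

/-! ## Polynomial functions on sets

A polynomial function on a mesh entity `P` is a restriction to `P` of a three-variate polynomial.
It is stored as a function on the closure of `P` (so that it can be evaluated on the boundary),
extended by zero. -/

/-- Restriction of a polynomial to (the closure of) `P`. -/
def restrS (P : Set E3) : Poly3 →ₗ[ℝ] (E3 → ℝ) where
  toFun p := (closure P).indicator (evalS p)
  map_add' p q := by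
    ext x; by_cases h : x ∈ closure P <;> simp [h, evalS]
  map_smul' a p := by
    ext x; by_cases h : x ∈ closure P <;> simp [h, evalS]

/-- Restriction of a polynomial vector field to (the closure of) `P`. -/
def restrV (P : Set E3) : VPoly3 →ₗ[ℝ] (E3 → E3) where
  toFun w := (closure P).indicator (evalV w)
  map_add' v w := by
    ext x i; by_cases h : x ∈ closure P <;> simp [h, evalV]
  map_smul' a w := by
    ext x i; by_cases h : x ∈ closure P <;> simp [h, evalV]

/-- `P^l(P)`. -/
def PolS (P : Set E3) (l : ℤ) : Submodule ℝ (E3 → ℝ) := (Pol l).map (restrS P)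

/-- `P^l(P)³`. -/
def PolV (P : Set E3) (l : ℤ) : Submodule ℝ (E3 → E3) := (VPol l).map (restrV P)

/-- The fields of `P^l(P)³` that are orthogonal to `n`. -/
def PolTan (P : Set E3) (n : E3) (l : ℤ) : Submodule ℝ (E3 → E3) where
  carrier := {f | f ∈ PolV P l ∧ ∀ x, inner ℝ (f x) n = 0}
  add_mem' := by
    rintro f g ⟨hf, hf'⟩ ⟨hg, hg'⟩
    exact ⟨add_mem hf hg, fun x => by simp [inner_add_left, hf', hg']⟩
  zero_mem' := ⟨zero_mem _, fun x => by simp⟩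
  smul_mem' := by
    rintro a f ⟨hf, hf'⟩
    exact ⟨Submodule.smul_mem _ a hf, fun x => by simp [inner_smul_left, hf']⟩

/-- The unique object satisfying `Q` (the value `0` is used if there is no such unique object). -/
def theUnique {α : Type*} [Zero α] (Q : α → Prop) : α :=
  open Classical in if h : ∃! a, Q a then h.choose else 0

/-- `L²(m)`-orthogonal projection of `f` on the space `V` of functions. -/
def l2proj {G : Type*} [NormedAddCommGroup G] [InnerProductSpace ℝ G] (m : Measure E3)
    (V : Submodule ℝ (E3 → G)) (f : E3 → G) : V :=
  theUnique fun u : V => ∀ w : V,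
    ∫ x, inner ℝ ((u : E3 → G) x) ((w : E3 → G) x) ∂m = ∫ x, inner ℝ (f x) ((w : E3 → G) x) ∂m

/-! ## Polyhedral meshes -/

/-- The vector `n` points out of `S` at `x`: close to `x`, the ray in the direction `-n` is inside
`S` and the ray in the direction `n` is outside `S`. -/
def PointsOut (S : Set E3) (x n : E3) : Prop :=
  ∃ ε > 0, ∀ s ∈ Set.Ioo (0 : ℝ) ε, x - s • n ∈ S ∧ x + s • n ∉ S

/-- The plane through `c` with normal `n`. -/
def planeAt (c n : E3) : Set E3 := {x | inner ℝ (x - c) n = 0}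

/-- A polyhedral mesh of a bounded open domain: open polyhedral elements, relatively open planar
polygonal faces, open segments as edges, and vertices, all pairwise disjoint, with a unit normal to
each face, an orientation of each edge (from `src` to `tgt`), and a centre in each element and
face. -/
structure PolyMesh where
  /-- the meshed domain -/
  domain : Set E3
  domain_open : IsOpen domain
  domain_bounded : Bornology.IsBounded domain
  /-- number of elements -/
  nT : ℕ
  /-- number of faces -/
  nF : ℕ
  /-- number of edges -/
  nE : ℕ
  /-- number of vertices -/
  nV : ℕ
  cell : Fin nT → Set E3
  face : Fin nF → Set E3
  vert : Fin nV → E3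
  /-- first vertex of an edge -/
  src : Fin nE → Fin nV
  /-- last vertex of an edge -/
  tgt : Fin nE → Fin nV
  /-- unit normal orienting a face -/
  normal : Fin nF → E3
  /-- centre of an element -/
  cellPt : Fin nT → E3
  /-- centre of a face -/
  facePt : Fin nF → E3
  src_ne_tgt : ∀ E, src E ≠ tgt E
  normal_unit : ∀ F, ‖normal F‖ = 1
  -- elements
  cell_open : ∀ T, IsOpen (cell T)
  cell_bounded : ∀ T, Bornology.IsBounded (cell T)
  cell_simply_connected : ∀ T, SimplyConnectedSpace (cell T)
  cell_frontier_connected : ∀ T, IsConnected (frontier (cell T))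
  cellPt_mem : ∀ T, cellPt T ∈ cell T
  cell_star : ∀ T, ∃ r > 0, ∀ y ∈ Metric.ball (cellPt T) r, StarConvex ℝ y (cell T)
  -- faces
  facePt_mem : ∀ F, facePt F ∈ face F
  face_planar : ∀ F, ∃ U : Set E3, IsOpen U ∧ face F = U ∩ planeAt (facePt F) (normal F)
  face_bounded : ∀ F, Bornology.IsBounded (face F)
  face_simply_connected : ∀ F, SimplyConnectedSpace (face F)
  face_boundary_connected : ∀ F, IsConnected (closure (face F) \ face F)
  face_star : ∀ F, ∃ r > 0,
    ∀ y ∈ Metric.ball (facePt F) r ∩ planeAt (facePt F) (normal F), StarConvex ℝ y (face F)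
  -- the elements partition the domain, and the mesh entities are pairwise disjoint
  cell_subset : ∀ T, cell T ⊆ domain
  cover : closure domain = ⋃ T, closure (cell T)
  entities_disjoint : Pairwise (Function.onFun Disjoint
    (Sum.elim cell (Sum.elim face (Sum.elim
      (fun E => openSegment ℝ (vert (src E)) (vert (tgt E))) (fun V => ({vert V} : Set E3))))))
  -- boundaries of elements (faces) are made of faces (edges) of the mesh
  cell_boundary : ∀ T, frontier (cell T) =
    ⋃ F ∈ {F | face F ⊆ frontier (cell T)}, closure (face F)
  face_boundary : ∀ F, closure (face F) \ face F =
    ⋃ E ∈ {E | openSegment ℝ (vert (src E)) (vert (tgt E)) ⊆ closure (face F) \ face F},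
      closure (openSegment ℝ (vert (src E)) (vert (tgt E)))
  face_used : ∀ F, ∃ T, face F ⊆ frontier (cell T)
  edge_used : ∀ E, ∃ F, openSegment ℝ (vert (src E)) (vert (tgt E)) ⊆ closure (face F) \ face F
  vert_used : ∀ V, ∃ E, V = src E ∨ V = tgt E
  -- an element lies on exactly one side of each of its faces, a face on exactly one side of each
  -- of its edges
  cell_one_sided : ∀ T F, face F ⊆ frontier (cell T) →
    (∀ x ∈ face F, PointsOut (cell T) x (normal F)) ∨
    (∀ x ∈ face F, PointsOut (cell T) x (-normal F))
  face_one_sided : ∀ F E,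
    openSegment ℝ (vert (src E)) (vert (tgt E)) ⊆ closure (face F) \ face F →
    (∀ x ∈ openSegment ℝ (vert (src E)) (vert (tgt E)),
      PointsOut (face F) x (cross (normal F) (vert (tgt E) - vert (src E)))) ∨
    (∀ x ∈ openSegment ℝ (vert (src E)) (vert (tgt E)),
      PointsOut (face F) x (-cross (normal F) (vert (tgt E) - vert (src E))))

namespace PolyMesh

variable (M : PolyMesh)

/-- The open segment carrying an edge. -/
def edge (E : Fin M.nE) : Set E3 := openSegment ℝ (M.vert (M.src E)) (M.vert (M.tgt E))

/-- Unit tangent `t_E`. -/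
def tangent (E : Fin M.nE) : E3 :=
  ‖M.vert (M.tgt E) - M.vert (M.src E)‖⁻¹ • (M.vert (M.tgt E) - M.vert (M.src E))

/-- The unit vector `n_FE` such that `(t_E, n_FE, n_F)` is right-handed. -/
def normalFE (F : Fin M.nF) (E : Fin M.nE) : E3 := cross (M.normal F) (M.tangent E)

open Classical in
/-- Faces of an element. -/
def facesT (T : Fin M.nT) : Finset (Fin M.nF) := {F | M.face F ⊆ frontier (M.cell T)}

open Classical in
/-- Edges of a face. -/
def edgesF (F : Fin M.nF) : Finset (Fin M.nE) := {E | M.edge E ⊆ closure (M.face F) \ M.face F}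

open Classical in
/-- Edges of an element. -/
def edgesT (T : Fin M.nT) : Finset (Fin M.nE) := {E | ∃ F ∈ M.facesT T, E ∈ M.edgesF F}

/-- Vertices of an edge. -/
def vertsE (E : Fin M.nE) : Finset (Fin M.nV) := {M.src E, M.tgt E}

/-- Vertices of a face. -/
def vertsF (F : Fin M.nF) : Finset (Fin M.nV) := (M.edgesF F).biUnion M.vertsE

/-- Vertices of an element. -/
def vertsT (T : Fin M.nT) : Finset (Fin M.nV) := (M.edgesT T).biUnion M.vertsE

open Classical in
/-- `ω_TF = 1` if `n_F` points out of `T`, and `-1` otherwise. -/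
def oTF (T : Fin M.nT) (F : Fin M.nF) : ℝ :=
  if ∀ x ∈ M.face F, PointsOut (M.cell T) x (M.normal F) then 1 else -1

open Classical in
/-- `ω_FE = 1` if `n_FE` points out of `F`, and `-1` otherwise. -/
def oFE (F : Fin M.nF) (E : Fin M.nE) : ℝ :=
  if ∀ x ∈ M.edge E, PointsOut (M.face F) x (M.normalFE F E) then 1 else -1

/-- `ω_EV = 1` if `t_E` points towards `V`, and `-1` otherwise. -/
def oEV (E : Fin M.nE) (V : Fin M.nV) : ℝ := if V = M.tgt E then 1 else -1

/-- Lebesgue measure on an element. -/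
def mT (T : Fin M.nT) : Measure E3 := volume.restrict (M.cell T)

/-- Surface measure on a face. -/
def mF (F : Fin M.nF) : Measure E3 := (Measure.euclideanHausdorffMeasure 2).restrict (M.face F)

/-- Length measure on an edge. -/
def mE (E : Fin M.nE) : Measure E3 := (Measure.euclideanHausdorffMeasure 1).restrict (M.edge E)

/-- Diameter of a face. -/
def hF (F : Fin M.nF) : ℝ := Metric.diam (M.face F)

/-- Diameter (length) of an edge. -/
def hE (E : Fin M.nE) : ℝ := Metric.diam (M.edge E)

/-! ### Polynomial subspaces on elements and faces -/

/-- Tangential polynomial fields on a face. -/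
def vPolF (F : Fin M.nF) (l : ℤ) : Submodule ℝ (E3 → E3) := PolTan (M.face F) (M.normal F) l

/-- `R^l(F)`: vector curls on `F` of `P^{l+1}(F)`. -/
def RF (F : Fin M.nF) (l : ℤ) : Submodule ℝ (E3 → E3) :=
  (Pol (l + 1)).map (restrV (M.face F) ∘ₗ rotP (M.normal F))

/-- `R^{c,l}(F) = (x - x_F) P^{l-1}(F)`. -/
def RcF (F : Fin M.nF) (l : ℤ) : Submodule ℝ (E3 → E3) :=
  (Pol (l - 1)).map (restrV (M.face F) ∘ₗ mulPos (M.facePt F))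

/-- `R^l(T)`: curls of `P^{l+1}(T)³`. -/
def RT (T : Fin M.nT) (l : ℤ) : Submodule ℝ (E3 → E3) :=
  (VPol (l + 1)).map (restrV (M.cell T) ∘ₗ curlP)

/-- `R^{c,l}(T) = (x - x_T) P^{l-1}(T)`. -/
def RcT (T : Fin M.nT) (l : ℤ) : Submodule ℝ (E3 → E3) :=
  (Pol (l - 1)).map (restrV (M.cell T) ∘ₗ mulPos (M.cellPt T))

/-- `G^l(T)`: gradients of `P^{l+1}(T)`. -/
def GT (T : Fin M.nT) (l : ℤ) : Submodule ℝ (E3 → E3) :=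
  (Pol (l + 1)).map (restrV (M.cell T) ∘ₗ gradP)

/-- `G^{c,l}(T) = (x - x_T) × P^{l-1}(T)³`. -/
def GcT (T : Fin M.nT) (l : ℤ) : Submodule ℝ (E3 → E3) :=
  (VPol (l - 1)).map (restrV (M.cell T) ∘ₗ crossPos (M.cellPt T))

end PolyMesh

/-! ## Serendipity spaces -/

/-- A polyhedral mesh with a polynomial degree `k` and, for each element (resp. face), a selection
of at least two of its faces (resp. edges) that are not pairwise aligned and such that the element
(resp. face) lies on one side of the plane (resp. line) spanned by each of them. -/
structure Discretisation extends PolyMesh where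
  /-- polynomial degree -/
  k : ℕ
  bdryT : Fin nT → Finset (Fin nF)
  bdryF : Fin nF → Finset (Fin nE)
  bdryT_subset : ∀ T, bdryT T ⊆ toPolyMesh.facesT T
  bdryF_subset : ∀ F, bdryF F ⊆ toPolyMesh.edgesF F
  two_le_bdryT : ∀ T, 2 ≤ (bdryT T).card
  two_le_bdryF : ∀ F, 2 ≤ (bdryF F).card
  bdryT_not_aligned : ∀ T, ∀ F ∈ bdryT T, ∀ F' ∈ bdryT T, F ≠ F' →
    affineSpan ℝ (face F) ≠ affineSpan ℝ (face F')
  bdryF_not_aligned : ∀ F, ∀ E ∈ bdryF F, ∀ E' ∈ bdryF F, E ≠ E' →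
    affineSpan ℝ (toPolyMesh.edge E) ≠ affineSpan ℝ (toPolyMesh.edge E')
  bdryT_one_side : ∀ T, ∀ F ∈ bdryT T,
    (∀ x ∈ cell T, 0 ≤ inner ℝ (x - facePt F) (normal F)) ∨
    (∀ x ∈ cell T, inner ℝ (x - facePt F) (normal F) ≤ 0)
  bdryF_one_side : ∀ F, ∀ E ∈ bdryF F,
    (∀ x ∈ face F, 0 ≤ inner ℝ (x - vert (src E)) (toPolyMesh.normalFE F E)) ∨
    (∀ x ∈ face F, inner ℝ (x - vert (src E)) (toPolyMesh.normalFE F E) ≤ 0)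

namespace Discretisation

variable (D : Discretisation)

/-- `ℓ_T = k + 1 - η_T`. -/
def lT (T : Fin D.nT) : ℤ := D.k + 1 - (D.bdryT T).card

/-- `ℓ_F = k + 1 - η_F`. -/
def lF (F : Fin D.nF) : ℤ := D.k + 1 - (D.bdryF F).card

/-- Global gradient space: components on elements, faces, edges, vertices. -/
abbrev XGrad : Type :=
  (∀ T, PolS (D.cell T) (D.lT T)) × (∀ F, PolS (D.face F) (D.lF F)) ×
  (∀ E, PolS (D.edge E) (D.k - 1)) × (Fin D.nV → ℝ)

/-- Global curl space: components in `R^{k-1}(T)`, `R^{c,ℓ_T+1}(T)`, `R^{k-1}(F)`,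
`R^{c,ℓ_F+1}(F)` and `P^k(E)`. -/
abbrev XCurl : Type :=
  (∀ T, D.RT T (D.k - 1)) × (∀ T, D.RcT T (D.lT T + 1)) ×
  (∀ F, D.RF F (D.k - 1)) × (∀ F, D.RcF F (D.lF F + 1)) × (∀ E, PolS (D.edge E) D.k)

/-- Global divergence space: components in `G^{k-1}(T)`, `G^{c,k}(T)` and `P^k(F)`. -/
abbrev XDiv : Type :=
  (∀ T, D.GT T (D.k - 1)) × (∀ T, D.GcT T D.k) × (∀ F, PolS (D.face F) D.k)

/-- Gradient space on a face and its edges and vertices. -/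
abbrev XGradF (F : Fin D.nF) : Type :=
  PolS (D.face F) (D.lF F) ×
  (∀ E : {E // E ∈ D.edgesF F}, PolS (D.edge E) (D.k - 1)) × ({V // V ∈ D.vertsF F} → ℝ)

/-- Gradient space on an element and its faces, edges and vertices. -/
abbrev XGradT (T : Fin D.nT) : Type :=
  PolS (D.cell T) (D.lT T) × (∀ F : {F // F ∈ D.facesT T}, PolS (D.face F) (D.lF F)) ×
  (∀ E : {E // E ∈ D.edgesT T}, PolS (D.edge E) (D.k - 1)) × ({V // V ∈ D.vertsT T} → ℝ)

/-- Curl space on a face and its edges. -/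
abbrev XCurlF (F : Fin D.nF) : Type :=
  D.RF F (D.k - 1) × D.RcF F (D.lF F + 1) × (∀ E : {E // E ∈ D.edgesF F}, PolS (D.edge E) D.k)

/-- Curl space on an element and its faces and edges. -/
abbrev XCurlT (T : Fin D.nT) : Type :=
  D.RT T (D.k - 1) × D.RcT T (D.lT T + 1) ×
  (∀ F : {F // F ∈ D.facesT T}, D.RF F (D.k - 1)) ×
  (∀ F : {F // F ∈ D.facesT T}, D.RcF F (D.lF F + 1)) ×
  (∀ E : {E // E ∈ D.edgesT T}, PolS (D.edge E) D.k)

variable {D}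

/-- Restriction of a vector of the gradient space to a face. -/
def XGrad.onF (q : D.XGrad) (F : Fin D.nF) : D.XGradF F :=
  (q.2.1 F, fun E => q.2.2.1 E, fun V => q.2.2.2 V)

/-- Restriction of a vector of the gradient space to an element. -/
def XGrad.onT (q : D.XGrad) (T : Fin D.nT) : D.XGradT T :=
  (q.1 T, fun F => q.2.1 F, fun E => q.2.2.1 E, fun V => q.2.2.2 V)

/-- Restriction of a vector of the curl space to a face. -/
def XCurl.onF (v : D.XCurl) (F : Fin D.nF) : D.XCurlF F :=
  (v.2.2.1 F, v.2.2.2.1 F, fun E => v.2.2.2.2 E)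

/-- Restriction of a vector of the curl space to an element. -/
def XCurl.onT (v : D.XCurl) (T : Fin D.nT) : D.XCurlT T :=
  (v.1 T, v.2.1 T, fun F => v.2.2.1 F, fun F => v.2.2.2.1 F, fun E => v.2.2.2.2 E)

end Discretisation

/-- A choice of linear serendipity gradient and curl operators on all faces and elements. No
property of them other than linearity is required. -/
structure Serendipity (D : Discretisation) where
  gradF : ∀ F, D.XGradF F →ₗ[ℝ] D.vPolF F D.k
  gradT : ∀ T, D.XGradT T →ₗ[ℝ] PolV (D.cell T) D.k
  curlF : ∀ F, D.XCurlF F →ₗ[ℝ] D.vPolF F D.k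
  curlT : ∀ T, D.XCurlT T →ₗ[ℝ] PolV (D.cell T) D.k

/-! ## Polynomial reconstructions -/

namespace Serendipity

open Discretisation

variable {D : Discretisation} (S : Serendipity D)

/-- Edge gradient. -/
def edgeGrad (q : D.XGrad) (E : Fin D.nE) : PolS (D.edge E) D.k :=
  theUnique fun u => ∀ r ∈ Pol D.k,
    ∫ x, u.1 x * evalS r x ∂D.mE E =
      -(∫ x, (q.2.2.1 E).1 x * evalS (dirDeriv (D.tangent E) r) x ∂D.mE E)
      + ∑ V ∈ D.vertsE E, D.oEV E V * q.2.2.2 V * evalS r (D.vert V)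

/-- Edge potential reconstruction. -/
def trE (q : D.XGrad) (E : Fin D.nE) : PolS (D.edge E) (D.k + 1) :=
  theUnique fun u => (∀ V ∈ D.vertsE E, u.1 (D.vert V) = q.2.2.2 V) ∧
    l2proj (D.mE E) (PolS (D.edge E) (D.k - 1)) u.1 = q.2.2.1 E

/-- Face gradient. -/
def faceGrad (q : D.XGrad) (F : Fin D.nF) : D.vPolF F D.k :=
  theUnique fun u => ∀ (w : D.RF F D.k) (τ : D.RcF F D.k),
    ∫ x, inner ℝ (u.1 x) (w.1 x + τ.1 x) ∂D.mF F =
      ∑ E ∈ D.edgesF F, D.oFE F E *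
        ∫ x, (trE q E).1 x * inner ℝ (w.1 x) (D.normalFE F E) ∂D.mE E
      + ∫ x, inner ℝ ((S.gradF F (XGrad.onF q F)).1 x) (τ.1 x) ∂D.mF F

/-- Scalar potential reconstruction on a face; the test fields `w` of `R^{c,k+2}(F)` are written
`(x - x_F) p`. -/
def trF (q : D.XGrad) (F : Fin D.nF) : PolS (D.face F) (D.k + 1) :=
  theUnique fun u => ∀ p ∈ Pol (D.k + 1), ∀ w, w = mulPos (D.facePt F) p →
    ∫ x, u.1 x * evalS (divF (D.normal F) w) x ∂D.mF F =
      -(∫ x, inner ℝ ((S.faceGrad q F).1 x) (evalV w x) ∂D.mF F)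
      + ∑ E ∈ D.edgesF F, D.oFE F E *
        ∫ x, (trE q E).1 x * inner ℝ (evalV w x) (D.normalFE F E) ∂D.mE E

/-- Element gradient. -/
def cellGrad (q : D.XGrad) (T : Fin D.nT) : PolV (D.cell T) D.k :=
  theUnique fun u => ∀ (w : D.RT T D.k) (τ : D.RcT T D.k),
    ∫ x, inner ℝ (u.1 x) (w.1 x + τ.1 x) ∂D.mT T =
      ∑ F ∈ D.facesT T, D.oTF T F *
        ∫ x, (S.trF q F).1 x * inner ℝ (w.1 x) (D.normal F) ∂D.mF F
      + ∫ x, inner ℝ ((S.gradT T (XGrad.onT q T)).1 x) (τ.1 x) ∂D.mT T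

/-- Scalar potential reconstruction `P_grad` on an element; the test fields `w` of `R^{c,k+2}(T)`
are written `(x - x_T) p`. -/
def potGrad (q : D.XGrad) (T : Fin D.nT) : PolS (D.cell T) (D.k + 1) :=
  theUnique fun u => ∀ p ∈ Pol (D.k + 1), ∀ w, w = mulPos (D.cellPt T) p →
    ∫ x, u.1 x * evalS (divP w) x ∂D.mT T =
      -(∫ x, inner ℝ ((S.cellGrad q T).1 x) (evalV w x) ∂D.mT T)
      + ∑ F ∈ D.facesT T, D.oTF T F *
        ∫ x, (S.trF q F).1 x * inner ℝ (evalV w x) (D.normal F) ∂D.mF F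

/-- Face curl. -/
def faceCurl (v : D.XCurl) (F : Fin D.nF) : PolS (D.face F) D.k :=
  theUnique fun u => ∀ r ∈ Pol D.k,
    ∫ x, u.1 x * evalS r x ∂D.mF F =
      ∫ x, inner ℝ ((v.2.2.1 F).1 x) (evalV (rotP (D.normal F) r) x) ∂D.mF F
      - ∑ E ∈ D.edgesF F, D.oFE F E * ∫ x, (v.2.2.2.2 E).1 x * evalS r x ∂D.mE E

/-- Tangential vector potential reconstruction on a face. -/
def trFt (v : D.XCurl) (F : Fin D.nF) : D.vPolF F D.k :=
  theUnique fun u => ∀ r ∈ Pol (D.k + 1), ∫ x, evalS r x ∂D.mF F = 0 → ∀ τ : D.RcF F D.k,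
    ∫ x, inner ℝ (u.1 x) (evalV (rotP (D.normal F) r) x + τ.1 x) ∂D.mF F =
      ∫ x, (faceCurl v F).1 x * evalS r x ∂D.mF F
      + ∑ E ∈ D.edgesF F, D.oFE F E * ∫ x, (v.2.2.2.2 E).1 x * evalS r x ∂D.mE E
      + ∫ x, inner ℝ ((S.curlF F (XCurl.onF v F)).1 x) (τ.1 x) ∂D.mF F

/-- Element curl. -/
def cellCurl (v : D.XCurl) (T : Fin D.nT) : PolV (D.cell T) D.k :=
  theUnique fun u => ∀ w ∈ VPol D.k,
    ∫ x, inner ℝ (u.1 x) (evalV w x) ∂D.mT T =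
      ∫ x, inner ℝ ((v.1 T).1 x) (evalV (curlP w) x) ∂D.mT T
      + ∑ F ∈ D.facesT T, D.oTF T F *
        ∫ x, inner ℝ ((S.trFt v F).1 x) (cross (evalV w x) (D.normal F)) ∂D.mF F

/-- Vector potential reconstruction `P_curl` on an element; the test fields `w` of `G^{c,k+1}(T)`
are written `(x - x_T) × z`. -/
def potCurl (v : D.XCurl) (T : Fin D.nT) : PolV (D.cell T) D.k :=
  theUnique fun u => ∀ z ∈ VPol D.k, ∀ w, w = crossPos (D.cellPt T) z → ∀ τ : D.RcT T D.k,
    ∫ x, inner ℝ (u.1 x) (evalV (curlP w) x + τ.1 x) ∂D.mT T =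
      ∫ x, inner ℝ ((S.cellCurl v T).1 x) (evalV w x) ∂D.mT T
      - ∑ F ∈ D.facesT T, D.oTF T F *
        ∫ x, inner ℝ ((S.trFt v F).1 x) (cross (evalV w x) (D.normal F)) ∂D.mF F
      + ∫ x, inner ℝ ((S.curlT T (XCurl.onT v T)).1 x) (τ.1 x) ∂D.mT T

/-- Element divergence. -/
def cellDiv (w : D.XDiv) (T : Fin D.nT) : PolS (D.cell T) D.k :=
  theUnique fun u => ∀ q ∈ Pol D.k,
    ∫ x, u.1 x * evalS q x ∂D.mT T =
      -(∫ x, inner ℝ ((w.1 T).1 x) (evalV (gradP q) x) ∂D.mT T)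
      + ∑ F ∈ D.facesT T, D.oTF T F * ∫ x, (w.2.2 F).1 x * evalS q x ∂D.mF F

/-- Vector potential reconstruction `P_div` on an element. -/
def potDiv (w : D.XDiv) (T : Fin D.nT) : PolV (D.cell T) D.k :=
  theUnique fun u => ∀ r ∈ Pol (D.k + 1), ∫ x, evalS r x ∂D.mT T = 0 → ∀ τ : D.GcT T D.k,
    ∫ x, inner ℝ (u.1 x) (evalV (gradP r) x + τ.1 x) ∂D.mT T =
      -(∫ x, (cellDiv w T).1 x * evalS r x ∂D.mT T)
      + ∑ F ∈ D.facesT T, D.oTF T F * ∫ x, (w.2.2 F).1 x * evalS r x ∂D.mF F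
      + ∫ x, inner ℝ ((w.2.1 T).1 x) (τ.1 x) ∂D.mT T

/-! ## Discrete gradient and curl, discrete inner products -/

/-- Discrete gradient. -/
def uG (q : D.XGrad) : D.XCurl :=
  (fun T => l2proj (D.mT T) (D.RT T (D.k - 1)) (S.cellGrad q T).1,
   fun T => l2proj (D.mT T) (D.RcT T (D.lT T + 1)) (S.cellGrad q T).1,
   fun F => l2proj (D.mF F) (D.RF F (D.k - 1)) (S.faceGrad q F).1,
   fun F => l2proj (D.mF F) (D.RcF F (D.lF F + 1)) (S.faceGrad q F).1,
   fun E => edgeGrad q E)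

/-- Discrete curl. -/
def uC (v : D.XCurl) : D.XDiv :=
  (fun T => l2proj (D.mT T) (D.GT T (D.k - 1)) (S.cellCurl v T).1,
   fun T => l2proj (D.mT T) (D.GcT T D.k) (S.cellCurl v T).1,
   fun F => faceCurl v F)

/-- Tangential trace on a plane with unit normal `n`. -/
def tanTrace (n v : E3) : E3 := cross n (cross v n)

/-- Local stabilisation on the curl space. -/
def sCurl (w v : D.XCurl) (T : Fin D.nT) : ℝ :=
  ∑ F ∈ D.facesT T, D.hF F * ∫ x, inner ℝ
      (tanTrace (D.normal F) ((S.potCurl w T).1 x) - (S.trFt w F).1 x)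
      (tanTrace (D.normal F) ((S.potCurl v T).1 x) - (S.trFt v F).1 x) ∂D.mF F
  + ∑ E ∈ D.edgesT T, D.hE E ^ 2 * ∫ x,
      (inner ℝ ((S.potCurl w T).1 x) (D.tangent E) - (w.2.2.2.2 E).1 x) *
      (inner ℝ ((S.potCurl v T).1 x) (D.tangent E) - (v.2.2.2.2 E).1 x) ∂D.mE E

/-- Local stabilisation on the divergence space. -/
def sDiv (w v : D.XDiv) (T : Fin D.nT) : ℝ :=
  ∑ F ∈ D.facesT T, D.hF F * ∫ x,
      (inner ℝ ((potDiv w T).1 x) (D.normal F) - (w.2.2 F).1 x) *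
      (inner ℝ ((potDiv v T).1 x) (D.normal F) - (v.2.2 F).1 x) ∂D.mF F

/-- Discrete `L²`-product on the curl space. -/
def ipCurl (w v : D.XCurl) : ℝ :=
  ∑ T, (∫ x, inner ℝ ((S.potCurl w T).1 x) ((S.potCurl v T).1 x) ∂D.mT T + S.sCurl w v T)

/-- Discrete `L²`-product on the divergence space. -/
def ipDiv (w v : D.XDiv) : ℝ :=
  ∑ T, (∫ x, inner ℝ ((potDiv w T).1 x) ((potDiv v T).1 x) ∂D.mT T + sDiv w v T)

end Serendipity

/-! ## Lie algebra-valued objects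

Elements of `X ⊗ 𝔤` are written `v = v^I ⊗ e_I` in a basis `(e_I)` of `𝔤`, and are represented by
their components `v : ι → X`; operators act component by component. -/

section LieValued

open Discretisation

variable {D : Discretisation} (S : Serendipity D) {ι : Type*} [Fintype ι]
  {𝔤 : Type*} [LieRing 𝔤] [LieAlgebra ℝ 𝔤] (b : Module.Basis ι ℝ 𝔤) (B : LinearMap.BilinForm ℝ 𝔤)

/-- Tensorisation of a bilinear form on `X` with the inner product `B` of the Lie algebra. -/
def tens {X : Type*} (f : X → X → ℝ) (x y : ι → X) : ℝ :=
  ∑ I, ∑ J, f (x I) (y J) * B (b I) (b J)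

/-- Structure constants: `[e_I, e_J] = ∑ K, c_{IJ}^K e_K`. -/
def strConst (I J K : ι) : ℝ := b.repr ⁅b I, b J⁆ K

/-- Piecewise (element by element) vector fields. -/
abbrev PwV (D : Discretisation) : Type := Fin D.nT → E3 → E3

/-- Piecewise (element by element) scalar fields. -/
abbrev PwS (D : Discretisation) : Type := Fin D.nT → E3 → ℝ

/-- `L²`-product over the domain of piecewise fields, as a sum over the elements. -/
def l2Dom (f g : PwV D) : ℝ := ∑ T, ∫ x, inner ℝ (f T x) (g T x) ∂D.mT T

/-- The bracket `[v, q] = v^I q^J ⊗ [e_I, e_J]` of a vector and a scalar field. -/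
def bktS (v : ι → PwV D) (q : ι → PwS D) : ι → PwV D :=
  fun K T x => ∑ I, ∑ J, strConst b I J K • (q J T x • v I T x)

/-- The pointwise bracket `(v^I × w^J) ⊗ [e_I, e_J]`. -/
def bktPt (v w : ι → E3) : ι → E3 :=
  fun K => ∑ I, ∑ J, strConst b I J K • cross (v I) (w J)

/-- The bracket `(v^I × w^J) ⊗ [e_I, e_J]` of two piecewise vector fields. -/
def bktV (v w : ι → PwV D) : ι → PwV D :=
  fun K T x => bktPt b (fun I => v I T x) (fun I => w I T x) K

/-- The bracket with values in the divergence space. -/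
def bktDiv (v w : ι → D.XCurl) : ι → D.XDiv := fun K =>
  (fun T => l2proj (D.mT T) (D.GT T (D.k - 1)) fun x =>
      bktPt b (fun I => (S.potCurl (v I) T).1 x) (fun I => (S.potCurl (w I) T).1 x) K,
   fun T => l2proj (D.mT T) (D.GcT T D.k) fun x =>
      bktPt b (fun I => (S.potCurl (v I) T).1 x) (fun I => (S.potCurl (w I) T).1 x) K,
   fun F => l2proj (D.mF F) (PolS (D.face F) D.k) fun x =>
      inner ℝ (bktPt b (fun I => (S.trFt (v I) F).1 x) (fun I => (S.trFt (w I) F).1 x) K)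
        (D.normal F))

/-- Lie algebra-valued discrete gradient. -/
def gG (q : ι → D.XGrad) : ι → D.XCurl := fun I => S.uG (q I)

/-- Lie algebra-valued discrete curl. -/
def gC (v : ι → D.XCurl) : ι → D.XDiv := fun I => S.uC (v I)

/-- Lie algebra-valued piecewise polynomial curl. -/
def gCpw (v : ι → D.XCurl) : ι → PwV D := fun I T => (S.cellCurl (v I) T).1

/-- Lie algebra-valued vector potential on the curl space. -/
def gPcurl (v : ι → D.XCurl) : ι → PwV D := fun I T => (S.potCurl (v I) T).1

/-- Lie algebra-valued scalar potential on the gradient space. -/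
def gPgrad (q : ι → D.XGrad) : ι → PwS D := fun I T => (S.potGrad (q I) T).1

/-- The two discretisations of the nonlinear terms. -/
inductive Variant
  | one
  | two

/-- The nonlinear terms `𝔑(A, A'; v)`, where `A` is the potential at the current time step and `A'`
at the next one. -/
def nonlin : Variant → (ι → D.XCurl) → (ι → D.XCurl) → (ι → D.XCurl) → ℝ
  | .one, A, A', v =>
      tens b B Serendipity.ipDiv (gC S A') (bktDiv S b ((1 / 2 : ℝ) • (A + A')) v)
      + tens b B Serendipity.ipDiv ((1 / 2 : ℝ) • bktDiv S b A' A')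
          (gC S v + bktDiv S b ((1 / 2 : ℝ) • (A + A')) v)
  | .two, A, A', v =>
      tens b B l2Dom (gCpw S A') (bktV b (gPcurl S ((1 / 2 : ℝ) • (A + A'))) (gPcurl S v))
      + tens b B l2Dom ((1 / 2 : ℝ) • bktV b (gPcurl S A') (gPcurl S A'))
          (gCpw S v + bktV b (gPcurl S ((1 / 2 : ℝ) • (A + A'))) (gPcurl S v))

/-- The families `A`, `E`, `lam` solve the constrained scheme on the times `t 0 < ... < t N`. -/
structure IsSolution (m : Variant) (N : ℕ) (t : ℕ → ℝ) (A E : ℕ → ι → D.XCurl)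
    (lam : ℕ → ι → D.XGrad) : Prop where
  potential : ∀ n < N, (t (n + 1) - t n)⁻¹ • (A (n + 1) - A n) = -E (n + 1)
  evolution : ∀ n < N, ∀ v : ι → D.XCurl,
    tens b B S.ipCurl ((t (n + 1) - t n)⁻¹ • (E (n + 1) - E n)) v
      + tens b B S.ipCurl (gG S (lam (n + 1))) v
      + tens b B l2Dom (bktS b (gPcurl S (A (n + 1))) (gPgrad S (lam (n + 1)))) (gPcurl S v)
    = tens b B Serendipity.ipDiv (gC S (A (n + 1))) (gC S v) + nonlin S b B m (A n) (A (n + 1)) v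
  constraint : ∀ n < N, ∀ q : ι → D.XGrad,
    tens b B S.ipCurl ((t (n + 1) - t n)⁻¹ • (E (n + 1) - E n)) (gG S q)
      + tens b B l2Dom (gPcurl S ((t (n + 1) - t n)⁻¹ • (E (n + 1) - E n)))
          (bktS b (gPcurl S (A n)) (gPgrad S q)) = 0

/-- The constraint functional of a pair `(A, E)`. -/
def constraintFun (A E : ι → D.XCurl) (q : ι → D.XGrad) : ℝ :=
  tens b B S.ipCurl E (gG S q)
    + tens b B l2Dom (gPcurl S E) (bktS b (gPcurl S A) (gPgrad S q))

/-- Magnetic field of the first scheme, in the divergence space. -/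
def magOne (A : ι → D.XCurl) : ι → D.XDiv := gC S A + (1 / 2 : ℝ) • bktDiv S b A A

/-- Magnetic field of the second scheme, a piecewise polynomial field. -/
def magTwo (A : ι → D.XCurl) : ι → PwV D :=
  gCpw S A + (1 / 2 : ℝ) • bktV b (gPcurl S A) (gPcurl S A)

/-- Global stabilisation on the divergence space. -/
def sDivGlob (w v : D.XDiv) : ℝ := ∑ T, Serendipity.sDiv w v T

/-- The magnetic energy. -/
def magEnergy : Variant → (ι → D.XCurl) → ℝ
  | .one, A => 1 / 2 * tens b B Serendipity.ipDiv (magOne S b A) (magOne S b A)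
  | .two, A => 1 / 2 * tens b B l2Dom (magTwo S b A) (magTwo S b A)
      + 1 / 2 * tens b B sDivGlob (gC S A) (gC S A)

end LieValued

end

end YM

/-!
Every reconstruction of the scheme is the solution of a compatible linear system, hence linear in
the degrees of freedom, and the discrete products are positive semidefinite bilinear forms.

Let `τ` be the time step and test the evolution equation with `v = E^{n+1} = -(A^{n+1} - A^n) / τ`.
The terms with the multiplier `λ^{n+1}` add up to the constraint functional at `λ^{n+1}`. It
vanishes at all times: the second equation of the scheme says that it is not changed by the step
from `E^n` to `E^{n+1}`, and ad-invariance that it is not changed by the step from `A^n` to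
`A^{n+1} = A^n - τ E^{n+1}`. On the right-hand side, the midpoint `A^{n+1/2}` and the symmetry of
`*[·,·]` make `C v + *[A^{n+1/2}, v]` the exact difference quotient of the curvature
`C A + ½ *[A, A]`, up to the sign. The estimate is then the convexity of the squared seminorms.

For the second choice of the nonlinear terms one also needs that the product `(C_h A, C_h v)_div`
is the `L²`-product of the element curls plus stabilisation, that is `P_div C_h v = C_T v`. This
rests on `D_T C_h v = 0`, in which the edge contributions cancel because the orientations
`ω_TF ω_FE` of the faces of `T` that contain an edge `E` sum to zero.
-/

namespace YM

noncomputable section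

/-! ## Integral products of locally bounded functions -/

section LocallyBounded

variable {X : Type*} [MeasurableSpace X] [Bornology X]

/-- A finite measure carried by a bounded set. -/
class BoundedSupport (m : Measure X) : Prop extends IsFiniteMeasure m where
  exists_isBounded_ae_mem : ∃ s : Set X, Bornology.IsBounded s ∧ ∀ᵐ x ∂m, x ∈ s

/-- The strongly measurable functions that are bounded on bounded sets. Polynomials and their
restrictions belong to this space, which is stable under pointwise products, and all of its elements
are integrable for a measure with bounded support. -/
def LocBdd (X G : Type*) [MeasurableSpace X] [Bornology X] [NormedAddCommGroup G]
    [NormedSpace ℝ G] : Submodule ℝ (X → G) where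
  carrier := {f | StronglyMeasurable f ∧
    ∀ s : Set X, Bornology.IsBounded s → ∃ C : ℝ, ∀ x ∈ s, ‖f x‖ ≤ C}
  add_mem' := by
    rintro f g ⟨hf, hf'⟩ ⟨hg, hg'⟩
    refine ⟨hf.add hg, fun s hs => ?_⟩
    obtain ⟨C, hC⟩ := hf' s hs
    obtain ⟨C', hC'⟩ := hg' s hs
    exact ⟨C + C', fun x hx => norm_add_le_of_le (hC x hx) (hC' x hx)⟩
  zero_mem' := ⟨stronglyMeasurable_zero, fun _ _ => ⟨0, fun x _ => by simp⟩⟩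
  smul_mem' := by
    rintro c f ⟨hf, hf'⟩
    refine ⟨hf.const_smul c, fun s hs => ?_⟩
    obtain ⟨C, hC⟩ := hf' s hs
    exact ⟨‖c‖ * C, fun x hx => (norm_smul_le c (f x)).trans (by gcongr; exact hC x hx)⟩

variable {G G₁ G₂ G₃ : Type*} [NormedAddCommGroup G] [NormedAddCommGroup G₁] [NormedSpace ℝ G₁]
  [NormedAddCommGroup G₂] [NormedSpace ℝ G₂] [NormedAddCommGroup G₃] [NormedSpace ℝ G₃]

lemma indicator_mem_locBdd {f : X → G₁} (hf : f ∈ LocBdd X G₁) {s : Set X}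
    (hs : MeasurableSet s) : s.indicator f ∈ LocBdd X G₁ := by
  refine ⟨hf.1.indicator hs, fun t ht => ?_⟩
  obtain ⟨C, hC⟩ := hf.2 t ht
  exact ⟨C, fun x hx => (norm_indicator_le_norm_self _ _).trans (hC x hx)⟩

lemma bilin_mem_locBdd (φ : G₁ →L[ℝ] G₂ →L[ℝ] G₃) {f : X → G₁} {g : X → G₂}
    (hf : f ∈ LocBdd X G₁) (hg : g ∈ LocBdd X G₂) : (fun x => φ (f x) (g x)) ∈ LocBdd X G₃ := by
  refine ⟨φ.continuous₂.comp_stronglyMeasurable (hf.1.prodMk hg.1), fun s hs => ?_⟩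
  obtain ⟨C, hC⟩ := hf.2 s hs
  obtain ⟨C', hC'⟩ := hg.2 s hs
  refine ⟨‖φ‖ * C * C', fun x hx => (φ.le_opNorm₂ _ _).trans ?_⟩
  have hC₀ : 0 ≤ C := (norm_nonneg _).trans (hC x hx)
  gcongr
  · exact hC x hx
  · exact hC' x hx

lemma integrable_of_mem_locBdd {f : X → G₁} (hf : f ∈ LocBdd X G₁) (m : Measure X)
    [BoundedSupport m] : Integrable f m := by
  obtain ⟨s, hs, hm⟩ := BoundedSupport.exists_isBounded_ae_mem (m := m)
  obtain ⟨C, hC⟩ := hf.2 s hs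
  exact .of_bound hf.1.aestronglyMeasurable C (hm.mono hC)

/-- Pointwise application of a continuous linear map to a locally bounded function. -/
def postComp (φ : G₁ →L[ℝ] G₂) : LocBdd X G₁ →ₗ[ℝ] LocBdd X G₂ where
  toFun f := ⟨fun x => φ (f.1 x), φ.continuous.comp_stronglyMeasurable f.2.1, fun s hs => by
    obtain ⟨C, hC⟩ := f.2.2 s hs
    exact ⟨‖φ‖ * C, fun x hx => φ.le_opNorm_of_le (hC x hx)⟩⟩
  map_add' f g := by ext x; simp
  map_smul' c f := by ext x; simp

/-- Pointwise application of a continuous bilinear map to two locally bounded functions. -/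
def postComp₂ (φ : G₁ →L[ℝ] G₂ →L[ℝ] G₃) :
    LocBdd X G₁ →ₗ[ℝ] LocBdd X G₂ →ₗ[ℝ] LocBdd X G₃ :=
  LinearMap.mk₂ ℝ (fun f g => ⟨_, bilin_mem_locBdd φ f.2 g.2⟩)
    (fun _ _ _ => by ext; simp) (fun _ _ _ => by ext; simp)
    (fun _ _ _ => by ext; simp) (fun _ _ _ => by ext; simp)

/-- The integral as a linear form on the space of locally bounded functions. -/
def integralL (m : Measure X) [BoundedSupport m] : LocBdd X ℝ →ₗ[ℝ] ℝ where
  toFun f := ∫ x, f.1 x ∂m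
  map_add' f g := integral_add (integrable_of_mem_locBdd f.2 m) (integrable_of_mem_locBdd g.2 m)
  map_smul' c f := integral_const_mul c f.1

variable [InnerProductSpace ℝ G] (m : Measure X) [BoundedSupport m]

/-- The `L²(m)`-product of locally bounded functions. -/
def l2Inner : LocBdd X G →ₗ[ℝ] LocBdd X G →ₗ[ℝ] ℝ :=
  (postComp₂ (innerSL ℝ)).compr₂ (integralL m)

lemma l2Inner_apply (f g : LocBdd X G) : l2Inner m f g = ∫ x, inner ℝ (f.1 x) (g.1 x) ∂m := rfl

lemma l2Inner_apply_real (f g : LocBdd X ℝ) : l2Inner m f g = ∫ x, f.1 x * g.1 x ∂m := by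
  rw [l2Inner_apply]
  exact integral_congr_ae (.of_forall fun x => mul_comm _ _)

lemma l2Inner_comm (f g : LocBdd X G) : l2Inner m f g = l2Inner m g f := by
  simp only [l2Inner_apply, real_inner_comm]

lemma l2Inner_self_nonneg (f : LocBdd X G) : 0 ≤ l2Inner m f f :=
  integral_nonneg fun _ => real_inner_self_nonneg

lemma isPosSemidef_l2Inner : LinearMap.BilinForm.IsPosSemidef (l2Inner (G := G) m) :=
  ⟨⟨l2Inner_comm m⟩, ⟨l2Inner_self_nonneg m⟩⟩

variable {m}

lemma ae_eq_zero_of_l2Inner_self {f : LocBdd X G} (h : l2Inner m f f = 0) : f.1 =ᵐ[m] 0 := by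
  rw [l2Inner_apply, integral_eq_zero_iff_of_nonneg (fun _ => real_inner_self_nonneg)
    (integrable_of_mem_locBdd (bilin_mem_locBdd (innerSL ℝ) f.2 f.2) m)] at h
  filter_upwards [h] with x hx
  simpa using hx

lemma l2Inner_congr_ae {f f' g g' : LocBdd X G} (hf : f.1 =ᵐ[m] f'.1) (hg : g.1 =ᵐ[m] g'.1) :
    l2Inner m f g = l2Inner m f' g' := by
  refine integral_congr_ae ?_
  filter_upwards [hf, hg] with x hx hx'
  simp [postComp₂, hx, hx']

lemma l2Inner_eq_zero_of_ae_right (f : LocBdd X G) {g : LocBdd X G} (hg : g.1 =ᵐ[m] 0) :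
    l2Inner m f g = 0 := by
  rw [l2Inner_congr_ae (f' := f) (g' := 0) .rfl hg, map_zero]

lemma boundedSupport_restrict {X : Type*} [MeasurableSpace X] [PseudoMetricSpace X]
    [OpensMeasurableSpace X] {μ : Measure X} {s : Set X} (hs : Bornology.IsBounded s)
    (hμ : μ s < ⊤) : BoundedSupport (μ.restrict s) where
  measure_univ_lt_top := by simpa using hμ
  exists_isBounded_ae_mem := ⟨closure s, hs.closure, ae_restrict_of_ae_restrict_of_subset
    subset_closure (ae_restrict_mem isClosed_closure.measurableSet)⟩

lemma mem_locBdd_of_continuous {X : Type*} [MeasurableSpace X] [PseudoMetricSpace X] [ProperSpace X]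
    [OpensMeasurableSpace X] {f : X → G₁} (hf : Continuous f) : f ∈ LocBdd X G₁ := by
  refine ⟨hf.stronglyMeasurable, fun s hs => ?_⟩
  obtain ⟨C, hC⟩ := hs.isCompact_closure.exists_bound_of_continuousOn hf.continuousOn
  exact ⟨C, fun x hx => hC x (subset_closure hx)⟩

end LocallyBounded

/-! ## Objects defined by linear relations -/

section LinearRelations

variable {X V P : Type*} [AddCommGroup X] [Module ℝ X] [AddCommGroup V] [Module ℝ V]
  [AddCommGroup P] [Module ℝ P]

lemma theUnique_spec {α : Type*} [Zero α] {Q : α → Prop} (h : ∃! a, Q a) : Q (theUnique Q) := by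
  rw [theUnique, dif_pos h]
  exact h.choose_spec.1

lemma exists_eq_of_forall_eq_zero [FiniteDimensional ℝ V] (β : V →ₗ[ℝ] P →ₗ[ℝ] ℝ)
    {φ : P →ₗ[ℝ] ℝ} (hφ : ∀ p, (∀ u, β u p = 0) → φ p = 0) : ∃ u, β u = φ := by
  rw [← LinearMap.mem_range, ← Subspace.dualCoannihilator_dualAnnihilator_eq
    (W := LinearMap.range β), Submodule.mem_dualAnnihilator]
  intro p hp
  exact hφ p fun u => (Submodule.mem_dualCoannihilator p).1 hp _ (LinearMap.mem_range_self β u)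

variable [FiniteDimensional ℝ V] {β : V →ₗ[ℝ] P →ₗ[ℝ] ℝ} {R : X →ₗ[ℝ] P →ₗ[ℝ] ℝ}
  {Q : X → V → Prop}

lemma theUnique_spec_of_linear (hβ : ∀ u, β u = 0 → u = 0)
    (hR : ∀ p, (∀ u, β u p = 0) → ∀ x, R x p = 0) (hQ : ∀ x u, Q x u ↔ β u = R x) (x : X) :
    β (theUnique (Q x)) = R x := by
  rw [← hQ]
  obtain ⟨u, hu⟩ := exists_eq_of_forall_eq_zero β fun p hp => hR p hp x
  refine theUnique_spec ⟨u, (hQ x u).2 hu, fun u' hu' => sub_eq_zero.1 (hβ _ ?_)⟩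
  rw [map_sub, (hQ x u').1 hu', hu, sub_self]

/-- If `β` has a kernel, no relation has a unique solution, and `theUnique` is identically `0`. -/
lemma isLinearMap_theUnique (hR : ∀ p, (∀ u, β u p = 0) → ∀ x, R x p = 0)
    (hQ : ∀ x u, Q x u ↔ β u = R x) : IsLinearMap ℝ fun x => theUnique (Q x) := by
  by_cases hβ : ∀ u, β u = 0 → u = 0
  · have hinj : Function.Injective β := (injective_iff_map_eq_zero β).2 hβ
    have hspec := theUnique_spec_of_linear hβ hR hQ
    exact ⟨fun x y => hinj (by simp only [map_add, hspec]),
      fun c x => hinj (by simp only [map_smul, hspec])⟩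
  · push Not at hβ
    obtain ⟨d, hd, hd0⟩ := hβ
    have hzero : ∀ x, theUnique (Q x) = 0 := fun x => by
      refine dif_neg fun ⟨u, hu, huniq⟩ => hd0 ?_
      simpa using huniq (u + d) ((hQ x _).2 (by rw [map_add, hd, add_zero, (hQ x u).1 hu]))
    exact ⟨fun x y => by simp only [hzero, add_zero], fun c x => by simp only [hzero, smul_zero]⟩

end LinearRelations

/-! ## Polynomial calculus -/

section Degree

variable {l l' : ℤ} {p q : Poly3} {u v : VPoly3}

lemma mem_pol : p ∈ Pol l ↔ p = 0 ∨ (p.totalDegree : ℤ) ≤ l := by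
  unfold Pol
  split_ifs with hl
  · rw [mem_restrictTotalDegree]
    refine ⟨fun h => .inr (by omega), ?_⟩
    rintro (rfl | h)
    · simp
    · omega
  · rw [Submodule.mem_bot]
    exact ⟨.inl, fun h => h.resolve_right (by omega)⟩

lemma mem_vPol : u ∈ VPol l ↔ ∀ i, u i ∈ Pol l := by
  simp only [VPol, Submodule.mem_pi, Set.mem_univ, true_implies]

instance (l : ℤ) : FiniteDimensional ℝ (Pol l) := by
  by_cases h : 0 ≤ l
  · rw [show Pol l = restrictTotalDegree (Fin 3) ℝ l.toNat from if_pos h]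
    infer_instance
  · rw [show Pol l = ⊥ from if_neg h]
    infer_instance

instance (l : ℤ) : FiniteDimensional ℝ (VPol l) :=
  .of_injective
    (LinearMap.pi fun i => ((LinearMap.proj i).comp (VPol l).subtype).codRestrict (Pol l)
      fun w => mem_vPol.1 w.2 i)
    fun _ _ h => Subtype.ext (funext fun i => congrArg Subtype.val (congrFun h i))

lemma pol_mono (h : l ≤ l') : Pol l ≤ Pol l' := fun _ hp =>
  mem_pol.2 ((mem_pol.1 hp).imp_right h.trans')

lemma mul_mem_pol (hp : p ∈ Pol l) (hq : q ∈ Pol l') : p * q ∈ Pol (l + l') := by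
  rcases mem_pol.1 hp with rfl | hp
  · simp
  rcases mem_pol.1 hq with rfl | hq
  · simp
  have := totalDegree_mul p q
  exact mem_pol.2 (.inr (by omega))

lemma C_mem_pol (a : ℝ) : (C a : Poly3) ∈ Pol 0 := mem_pol.2 (.inr (by simp))

lemma C_mul_mem_pol (a : ℝ) (hp : p ∈ Pol l) : C a * p ∈ Pol l := by
  simpa using mul_mem_pol (C_mem_pol a) hp

lemma posV_apply_mem_pol (c : E3) (i : Fin 3) : posV c i ∈ Pol 1 :=
  sub_mem (mem_pol.2 (.inr (by simp))) (pol_mono zero_le_one (C_mem_pol _))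

lemma pderiv_mem_pol (i : Fin 3) (hp : p ∈ Pol l) : pderiv i p ∈ Pol (l - 1) := by
  rcases mem_pol.1 hp with rfl | hp
  · simp
  rw [p.as_sum, map_sum]
  refine sum_mem fun m hm => ?_
  rw [pderiv_monomial]
  rcases Nat.eq_zero_or_pos (m i) with h0 | h0
  · simp [h0]
  have hdeg : m.degree = (m - Finsupp.single i 1).degree + 1 := by
    have hle : Finsupp.single i 1 ≤ m := Finsupp.single_le_iff.2 h0
    conv_lhs => rw [← tsub_add_cancel_of_le hle]
    simp
  have hm' : m.degree ≤ p.totalDegree := le_totalDegree hm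
  have hle : (monomial (m - Finsupp.single i 1) (coeff m p * m i)).totalDegree ≤
    (m - Finsupp.single i 1).degree := totalDegree_monomial_le _ _
  exact mem_pol.2 (.inr (by omega))

lemma gradP_mem_vPol (hp : p ∈ Pol l) : gradP p ∈ VPol (l - 1) :=
  mem_vPol.2 fun i => pderiv_mem_pol i hp

lemma curlP_mem_vPol (hu : u ∈ VPol l) : curlP u ∈ VPol (l - 1) := by
  rw [mem_vPol] at *
  intro i
  fin_cases i <;> exact sub_mem (pderiv_mem_pol _ (hu _)) (pderiv_mem_pol _ (hu _))

lemma cross_mem_vPol (hu : u ∈ VPol l) (hv : v ∈ VPol l') : u ⨯₃ v ∈ VPol (l + l') := by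
  rw [mem_vPol] at *
  intro i
  fin_cases i <;> exact sub_mem (mul_mem_pol (hu _) (hv _)) (mul_mem_pol (hu _) (hv _))

lemma dotProduct_mem_pol (hu : u ∈ VPol l) (hv : v ∈ VPol l') : u ⬝ᵥ v ∈ Pol (l + l') :=
  sum_mem fun i _ => mul_mem_pol (mem_vPol.1 hu i) (mem_vPol.1 hv i)

lemma posV_mem_vPol (c : E3) : posV c ∈ VPol 1 := mem_vPol.2 (posV_apply_mem_pol c)

lemma constV_mem_vPol (a : E3) : constV a ∈ VPol 0 := mem_vPol.2 fun i => C_mem_pol (a i)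

lemma rotP_mem_vPol (n : E3) (hp : p ∈ Pol l) : rotP n p ∈ VPol (l - 1) := by
  rw [← add_zero (l - 1)]
  exact cross_mem_vPol (gradP_mem_vPol hp) (constV_mem_vPol n)

lemma mulPos_mem_vPol (c : E3) (hp : p ∈ Pol l) : mulPos c p ∈ VPol (l + 1) :=
  mem_vPol.2 fun i => mul_mem_pol hp (posV_apply_mem_pol c i)

lemma crossPos_mem_vPol (c : E3) (hu : u ∈ VPol l) : crossPos c u ∈ VPol (l + 1) := by
  rw [add_comm]
  exact cross_mem_vPol (posV_mem_vPol c) hu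

end Degree

/-- The polynomial function of a polynomial, as a linear map. -/
def evS : Poly3 →ₗ[ℝ] LocBdd E3 ℝ where
  toFun p := ⟨evalS p, mem_locBdd_of_continuous ((continuous_eval p).comp (by fun_prop))⟩
  map_add' p q := by ext x; simp [evalS]
  map_smul' c p := by ext x; simp [evalS]

/-- The vector field of a polynomial vector field, as a linear map. -/
def evV : VPoly3 →ₗ[ℝ] LocBdd E3 E3 where
  toFun w := ⟨evalV w, mem_locBdd_of_continuous ((PiLp.continuous_toLp 2 _).comp
    (continuous_pi fun i => (continuous_eval (w i)).comp (by fun_prop)))⟩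
  map_add' p q := by ext x i; simp [evalV]
  map_smul' c p := by ext x i; simp [evalV]

lemma hasDerivAt_eval_add_smul {σ : Type*} [Fintype σ] (p : MvPolynomial σ ℝ) (c y : σ → ℝ)
    (t : ℝ) : HasDerivAt (fun t : ℝ => eval (c + t • y) p)
      (∑ i, y i * eval (c + t • y) (pderiv i p)) t := by
  classical
  induction p using MvPolynomial.induction_on with
  | C a => simpa using hasDerivAt_const t a
  | add p q hp hq => simpa [mul_add, Finset.sum_add_distrib] using! hp.add hq
  | mul_X p i hp =>
    have hX : HasDerivAt (fun t : ℝ => c i + t * y i) (y i) t := by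
      simpa using ((hasDerivAt_id t).mul_const (y i)).const_add (c i)
    simp only [map_mul, eval_X, Pi.add_apply, Pi.smul_apply, smul_eq_mul]
    refine (hp.mul hX).congr_deriv ?_
    have hi : ∑ j, y j * (eval (c + t • y) p *
        eval (c + t • y) (Pi.single (M := fun _ => MvPolynomial σ ℝ) j 1 i)) =
          eval (c + t • y) p * y i := by
      rw [Finset.sum_eq_single i (fun j _ hj => by simp [hj.symm]) (by simp)]
      simp [mul_comm]
    simp only [pderiv_mul, pderiv_X, map_add, map_mul, eval_X, mul_add, Finset.sum_add_distrib, hi,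
      Finset.sum_mul, Pi.add_apply, Pi.smul_apply, smul_eq_mul, mul_assoc]

section Koszul

variable {l : ℤ} {p : Poly3}

/-- The Euler operator `(x - c) · ∇`. Adding it to the identity gives an automorphism of each space
`Pol l`, whose inverse yields the potentials of the Koszul decompositions below. -/
def euler (c : E3) : Poly3 →ₗ[ℝ] Poly3 :=
  ∑ i, LinearMap.mulLeft ℝ (posV c i) ∘ₗ (pderiv i).toLinearMap

lemma euler_apply (c : E3) (p : Poly3) : euler c p = ∑ i, posV c i * pderiv i p := by
  simp [euler]

lemma euler_mem_pol (c : E3) (hp : p ∈ Pol l) : euler c p ∈ Pol l := by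
  rw [euler_apply]
  refine sum_mem fun i _ => ?_
  simpa using mul_mem_pol (posV_apply_mem_pol c i) (pderiv_mem_pol i hp)

lemma eq_zero_of_add_euler_eq_zero {c : E3} (h : p + euler c p = 0) : p = 0 := by
  have hd (y : Fin 3 → ℝ) (t : ℝ) :
      HasDerivAt (fun t : ℝ => t * eval (c.ofLp + t • y) p) 0 t := by
    refine ((hasDerivAt_id t).mul (hasDerivAt_eval_add_smul p c.ofLp y t)).congr_deriv ?_
    have h' := congrArg (eval (c.ofLp + t • y)) h
    simpa [euler_apply, posV, Finset.mul_sum, mul_assoc] using h'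
  refine MvPolynomial.funext fun x => ?_
  simpa using is_const_of_deriv_eq_zero (fun t => (hd (x - c.ofLp) t).differentiableAt)
    (fun t => (hd (x - c.ofLp) t).deriv) 1 0

lemma exists_add_euler_eq (c : E3) (hp : p ∈ Pol l) : ∃ u ∈ Pol l, u + euler c u = p := by
  let f : Pol l →ₗ[ℝ] Pol l :=
    (LinearMap.id + euler c).restrict fun q hq => add_mem hq (euler_mem_pol c hq)
  have hf : Function.Injective f := (injective_iff_map_eq_zero f).2 fun q hq =>
    Subtype.ext (eq_zero_of_add_euler_eq_zero (congrArg Subtype.val hq))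
  obtain ⟨u, hu⟩ := LinearMap.injective_iff_surjective.1 hf ⟨p, hp⟩
  exact ⟨u, u.2, congrArg Subtype.val hu⟩

lemma exists_vPol_add_euler_eq (c : E3) {w : VPoly3} (hw : w ∈ VPol l) :
    ∃ u ∈ VPol l, (u + fun i => euler c (u i)) = w := by
  choose! u hu hu' using fun i => exists_add_euler_eq c (mem_vPol.1 hw i)
  exact ⟨u, mem_vPol.2 hu, funext hu'⟩

lemma gradP_dot_posV (c : E3) (u : VPoly3) :
    gradP (posV c ⬝ᵥ u) = (u + fun i => euler c (u i)) + posV c ⨯₃ curlP u := by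
  funext i
  fin_cases i <;>
  · simp only [gradP, dotProduct, Fin.sum_univ_three, posV, curlP, crossProduct, euler_apply,
      LinearMap.coe_mk, AddHom.coe_mk, LinearMap.mk₂_apply, map_add, map_sub, Derivation.leibniz,
      smul_eq_mul, derivation_C, pderiv_X, Pi.single_apply, Pi.add_apply, Fin.zero_eta, Fin.mk_one,
      Fin.reduceFinMk, Fin.reduceEq, Fin.isValue, reduceIte, one_ne_zero, zero_ne_one,
      Matrix.cons_val]
    ring

lemma curlP_gradP (p : Poly3) : curlP (gradP p) = 0 := by
  have hcomm (i j : Fin 3) : pderiv i (pderiv j p) = pderiv j (pderiv i p) := by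
    have h : (⁅pderiv i, pderiv j⁆ : Derivation ℝ Poly3 Poly3) = 0 :=
      derivation_ext fun k => by
        rw [Derivation.commutator_apply]
        simp [pderiv_X, Pi.single_apply, apply_ite]
    simpa [Derivation.commutator_apply, sub_eq_zero] using DFunLike.congr_fun h p
  funext i
  fin_cases i <;> simp [curlP, gradP, hcomm 1 2, hcomm 2 0, hcomm 0 1]

lemma exists_gradP_add_crossPos (c : E3) {w : VPoly3} (hw : w ∈ VPol l) :
    ∃ r ∈ Pol (l + 1), ∃ z ∈ VPol (l - 1), gradP r + crossPos c z = w := by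
  obtain ⟨u, hu, rfl⟩ := exists_vPol_add_euler_eq c hw
  refine ⟨posV c ⬝ᵥ u, ?_, -curlP u, neg_mem (curlP_mem_vPol hu), ?_⟩
  · rw [add_comm]
    exact dotProduct_mem_pol (posV_mem_vPol c) hu
  · rw [gradP_dot_posV, map_neg]
    exact add_neg_cancel_right _ _

/-- The potential comes from the Koszul decomposition of `n × w`: taking the product with `n` on the
right turns `n × w` back into `w`, and `(x - c) × k` into a multiple of `x - c` on the plane. -/
lemma exists_rotP_add_mulPos (c : E3) {n : E3} (hn : ‖n‖ = 1) {w : VPoly3} (hw : w ∈ VPol l)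
    (hwn : w ⬝ᵥ constV n = 0) :
    ∃ r ∈ Pol (l + 1), ∃ p ∈ Pol (l - 1), ∀ x ∈ planeAt c n,
      evalV (rotP n r + mulPos c p) x = evalV w x := by
  have hz : constV n ⨯₃ w ∈ VPol l := by simpa using cross_mem_vPol (constV_mem_vPol n) hw
  obtain ⟨u, hu, hu'⟩ := exists_vPol_add_euler_eq c hz
  refine ⟨posV c ⬝ᵥ u, ?_, curlP u ⬝ᵥ constV n, ?_, fun x hx => ?_⟩
  · rw [add_comm]
    exact dotProduct_mem_pol (posV_mem_vPol c) hu
  · simpa using dotProduct_mem_pol (curlP_mem_vPol hu) (constV_mem_vPol n)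
  have hx' : (x.ofLp - c.ofLp) ⬝ᵥ n.ofLp = 0 := by
    simpa [planeAt, PiLp.inner_apply, dotProduct, mul_comm] using hx
  have hn' : n.ofLp ⬝ᵥ n.ofLp = 1 := by
    simpa [hn, dotProduct, sq] using (EuclideanSpace.real_norm_sq_eq n).symm
  have hwn' := congrArg (eval x.ofLp) hwn
  have hrot : rotP n (posV c ⬝ᵥ u) = (constV n ⨯₃ w + posV c ⨯₃ curlP u) ⨯₃ constV n := by
    simp only [rotP, LinearMap.coe_mk, AddHom.coe_mk, gradP_dot_posV, hu']
  rw [hrot]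
  generalize curlP u = k
  simp only [dotProduct, Fin.sum_univ_three, constV, Pi.sub_apply, map_add, map_mul, eval_C,
    map_zero] at hx' hn' hwn'
  ext i
  fin_cases i <;>
    simp [evalV, mulPos, posV, constV, crossProduct, dotProduct, Fin.sum_univ_three]
  · linear_combination eval x.ofLp (w 0) * hn' - n 0 * hwn' + eval x.ofLp (k 0) * hx'
  · linear_combination eval x.ofLp (w 1) * hn' - n 1 * hwn' + eval x.ofLp (k 1) * hx'
  · linear_combination eval x.ofLp (w 2) * hn' - n 2 * hwn' + eval x.ofLp (k 2) * hx'

lemma crossPos_eq_zero_of_curlP_add_mulPos {c : E3} {z : VPoly3}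
    (h : curlP (crossPos c z) + mulPos c p = 0) : crossPos c z = 0 := by
  have hdot : posV c ⬝ᵥ crossPos c z = 0 := by simp [crossPos]
  have hcross : posV c ⨯₃ mulPos c p = 0 := by
    rw [show mulPos c p = p • posV c by funext i; simp [mulPos], map_smul, cross_self, smul_zero]
  have hgrad := gradP_dot_posV c (crossPos c z)
  rw [hdot, map_zero, eq_neg_of_add_eq_zero_left h, map_neg, hcross, neg_zero, add_zero] at hgrad
  exact funext fun i => eq_zero_of_add_euler_eq_zero (congrFun hgrad i).symm

end Koszul

/-! ## Measures on mesh entities -/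

section HausdorffMeasure

lemma isometry_const_add_coe {V : Type*} [NormedAddCommGroup V] [InnerProductSpace ℝ V] (c : V)
    (W : Submodule ℝ V) : Isometry fun w : W => c + (w : V) :=
  (isometry_vadd V c).comp isometry_subtype_coe

variable {V : Type*} [NormedAddCommGroup V] [InnerProductSpace ℝ V] [FiniteDimensional ℝ V]
  [MeasurableSpace V] [BorelSpace V] {W : Submodule ℝ V} {d : ℕ}

lemma euclideanHausdorffMeasure_image_const_add_coe (hd : Module.finrank ℝ W = d) (c : V)
    (s : Set W) :
    Measure.euclideanHausdorffMeasure d ((fun w : W => c + (w : V)) '' s) = volume s := by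
  rw [(isometry_const_add_coe c W).euclideanHausdorffMeasure_image, ← hd,
    InnerProductSpace.euclideanHausdorffMeasure_eq_volume]

lemma euclideanHausdorffMeasure_lt_top_of_forall_sub_mem (hd : Module.finrank ℝ W = d) {c : V}
    {s : Set V} (hs : Bornology.IsBounded s) (hsW : ∀ x ∈ s, x - c ∈ W) :
    Measure.euclideanHausdorffMeasure d s < ⊤ := by
  have himage : (fun w : W => c + (w : V)) '' ((fun w : W => c + (w : V)) ⁻¹' s) = s :=
    Set.image_preimage_eq_of_subset fun x hx => ⟨⟨x - c, hsW x hx⟩, add_sub_cancel _ _⟩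
  rw [← himage, euclideanHausdorffMeasure_image_const_add_coe hd]
  obtain ⟨C, hC⟩ := Metric.isBounded_iff.1 hs
  refine (Metric.isBounded_iff.2 ⟨C, fun x hx y hy => ?_⟩).measure_lt_top
  rw [← (isometry_const_add_coe c W).dist_eq]
  exact hC hx hy

lemma eqOn_zero_of_ae_euclideanHausdorffMeasure (hd : Module.finrank ℝ W = d) {c : V}
    {U : Set V} (hU : IsOpen U) {G : Type*} [NormedAddCommGroup G] {f : V → G} (hf : Continuous f)
    (h : f =ᵐ[(Measure.euclideanHausdorffMeasure d).restrict (U ∩ {x | x - c ∈ W})] 0) :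
    Set.EqOn f 0 (U ∩ {x | x - c ∈ W}) := by
  have hW : IsClosed {x : V | x - c ∈ W} :=
    W.closed_of_finiteDimensional.preimage (f := fun x : V => x - c) (by fun_prop)
  have hnull := ae_iff.1 ((ae_restrict_iff' (hU.measurableSet.inter hW.measurableSet)).1 h)
  by_contra! hne
  obtain ⟨x, hx, hfx⟩ : ∃ x ∈ U ∩ {x | x - c ∈ W}, f x ≠ 0 := by
    simpa [Set.EqOn, -Set.mem_inter_iff] using hne
  let t : Set W := (fun w : W => c + (w : V)) ⁻¹' (U ∩ {x | f x ≠ 0})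
  have ht : IsOpen t := (hU.inter (isOpen_ne_fun hf continuous_const)).preimage (by fun_prop)
  have hxt : (⟨x - c, hx.2⟩ : W) ∈ t := by simpa [t] using ⟨hx.1, hfx⟩
  refine (ht.measure_pos (volume : Measure W) ⟨_, hxt⟩).ne' ?_
  rw [← euclideanHausdorffMeasure_image_const_add_coe hd c]
  refine measure_mono_null ?_ hnull
  rintro _ ⟨w, ⟨hw, hw'⟩, rfl⟩
  exact fun h0 => hw' (h0 ⟨hw, by simp⟩)

end HausdorffMeasure

lemma ae_restrict_of_forall_closure {X : Type*} [TopologicalSpace X] [MeasurableSpace X]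
    [OpensMeasurableSpace X] {μ : Measure X} {s t : Set X} (hst : s ⊆ closure t) {p : X → Prop}
    (hp : ∀ x ∈ closure t, p x) : ∀ᵐ x ∂μ.restrict s, p x :=
  ae_restrict_of_ae_restrict_of_subset hst
    (ae_restrict_of_forall_mem isClosed_closure.measurableSet hp)

lemma eq_zero_of_integral_eq_zero_of_ae_eq {X : Type*} [MeasurableSpace X] {m : Measure X}
    [IsFiniteMeasure m] [NeZero m] {f : X → ℝ} {a : ℝ} (hf : ∀ᵐ x ∂m, f x = a)
    (h : ∫ x, f x ∂m = 0) : a = 0 := by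
  rw [integral_congr_ae hf, integral_const, smul_eq_mul] at h
  exact (mul_eq_zero.1 h).resolve_left (measureReal_univ_ne_zero)

lemma mem_planeAt {c n x : E3} : x ∈ planeAt c n ↔ x - c ∈ (ℝ ∙ n)ᗮ := by
  rw [Submodule.mem_orthogonal_singleton_iff_inner_left]
  rfl

lemma isClosed_planeAt (c n : E3) : IsClosed (planeAt c n) :=
  isClosed_eq (by fun_prop) continuous_const

namespace PolyMesh

variable {M : PolyMesh}

lemma normal_ne_zero (F : Fin M.nF) : M.normal F ≠ 0 :=
  norm_ne_zero_iff.1 (by simp [M.normal_unit F])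

lemma finrank_orthogonal_normal (F : Fin M.nF) :
    Module.finrank ℝ (ℝ ∙ M.normal F : Submodule ℝ E3)ᗮ = 2 :=
  have : Fact (Module.finrank ℝ E3 = 2 + 1) := ⟨by simp⟩
  Submodule.finrank_orthogonal_span_singleton (normal_ne_zero F)

lemma closure_face_subset_planeAt (F : Fin M.nF) :
    closure (M.face F) ⊆ planeAt (M.facePt F) (M.normal F) := by
  obtain ⟨U, -, h⟩ := M.face_planar F
  rw [h]
  exact closure_minimal Set.inter_subset_right (isClosed_planeAt _ _)

lemma face_subset_planeAt (F : Fin M.nF) : M.face F ⊆ planeAt (M.facePt F) (M.normal F) :=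
  subset_closure.trans (closure_face_subset_planeAt F)

lemma vert_injective : Function.Injective M.vert := by
  intro V V' h
  by_contra hne
  have := M.entities_disjoint (i := .inr (.inr (.inr V))) (j := .inr (.inr (.inr V')))
    (by simpa using hne)
  simp [Function.onFun, h] at this

lemma vert_tgt_sub_vert_src_ne_zero (E : Fin M.nE) : M.vert (M.tgt E) - M.vert (M.src E) ≠ 0 :=
  sub_ne_zero.2 fun h => M.src_ne_tgt E (vert_injective h).symm

instance (T : Fin M.nT) : BoundedSupport (M.mT T) :=
  boundedSupport_restrict (M.cell_bounded T) (M.cell_bounded T).measure_lt_top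

instance (F : Fin M.nF) : BoundedSupport (M.mF F) :=
  boundedSupport_restrict (M.face_bounded F)
    (euclideanHausdorffMeasure_lt_top_of_forall_sub_mem (finrank_orthogonal_normal F)
      (M.face_bounded F) fun _ hx => mem_planeAt.1 (face_subset_planeAt F hx))

instance (E : Fin M.nE) : BoundedSupport (M.mE E) := by
  have hb : Bornology.IsBounded (M.edge E) := by
    refine Bornology.IsBounded.subset ?_ (openSegment_subset_segment ℝ _ _)
    rw [← convexHull_pair]
    exact isBounded_convexHull.2 (by simp)
  refine boundedSupport_restrict hb (euclideanHausdorffMeasure_lt_top_of_forall_sub_mem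
    (c := M.vert (M.src E)) (finrank_span_singleton (vert_tgt_sub_vert_src_ne_zero E)) hb ?_)
  intro x hx
  rw [edge, openSegment_eq_image'] at hx
  obtain ⟨θ, -, rfl⟩ := hx
  rw [add_sub_cancel_left]
  exact Submodule.smul_mem _ _ (Submodule.mem_span_singleton_self _)

section Closure

variable {G : Type*} [NormedAddCommGroup G] {f : E3 → G}

lemma eqOn_zero_closure_cell {T : Fin M.nT} (hf : Continuous f) (h : f =ᵐ[M.mT T] 0) :
    Set.EqOn f 0 (closure (M.cell T)) :=
  Set.EqOn.closure (Measure.eqOn_open_of_ae_eq h (M.cell_open T) hf.continuousOn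
    continuousOn_const) hf continuous_const

lemma eqOn_zero_closure_face {F : Fin M.nF} (hf : Continuous f) (h : f =ᵐ[M.mF F] 0) :
    Set.EqOn f 0 (closure (M.face F)) := by
  obtain ⟨U, hU, hFU⟩ := M.face_planar F
  have hFU' : M.face F = U ∩ {x | x - M.facePt F ∈ (ℝ ∙ M.normal F)ᗮ} := by
    rw [hFU]
    exact congrArg (U ∩ ·) (Set.ext fun _ => mem_planeAt)
  rw [mF, hFU'] at h
  rw [hFU']
  exact (eqOn_zero_of_ae_euclideanHausdorffMeasure (finrank_orthogonal_normal F) hU hf h).closure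
    hf continuous_const

end Closure

lemma ae_mT {T : Fin M.nT} {p : E3 → Prop} (hp : ∀ x ∈ closure (M.cell T), p x) :
    ∀ᵐ x ∂M.mT T, p x :=
  ae_restrict_of_forall_closure subset_closure hp

lemma ae_mF {F : Fin M.nF} {p : E3 → Prop} (hp : ∀ x ∈ closure (M.face F), p x) :
    ∀ᵐ x ∂M.mF F, p x :=
  ae_restrict_of_forall_closure subset_closure hp

lemma mem_edgesF {F : Fin M.nF} {E : Fin M.nE} :
    E ∈ M.edgesF F ↔ M.edge E ⊆ closure (M.face F) \ M.face F := by
  simp [edgesF]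

lemma ae_mE_of_mem_edgesF {F : Fin M.nF} {E : Fin M.nE} (hE : E ∈ M.edgesF F) {p : E3 → Prop}
    (hp : ∀ x ∈ closure (M.face F), p x) : ∀ᵐ x ∂M.mE E, p x :=
  ae_restrict_of_forall_closure ((mem_edgesF.1 hE).trans Set.sdiff_subset) hp

instance (T : Fin M.nT) : NeZero (M.mT T) where
  out h := one_ne_zero (eqOn_zero_closure_cell (f := fun _ => (1 : ℝ)) continuous_const
    (by rw [h]; rfl) (subset_closure (M.cellPt_mem T)))

instance (F : Fin M.nF) : NeZero (M.mF F) where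
  out h := one_ne_zero (eqOn_zero_closure_face (f := fun _ => (1 : ℝ)) continuous_const
    (by rw [h]; rfl) (subset_closure (M.facePt_mem F)))

lemma starConvex_cell (T : Fin M.nT) : StarConvex ℝ (M.cellPt T) (M.cell T) := by
  obtain ⟨r, hr, h⟩ := M.cell_star T
  exact h _ (Metric.mem_ball_self hr)

lemma starConvex_face (F : Fin M.nF) : StarConvex ℝ (M.facePt F) (M.face F) := by
  obtain ⟨r, hr, h⟩ := M.face_star F
  exact h _ ⟨Metric.mem_ball_self hr, by simp [planeAt]⟩

lemma eventually_add_smul_mem_face {F : Fin M.nF} {x v : E3} (hx : x ∈ M.face F)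
    (hv : inner ℝ v (M.normal F) = 0) : ∀ᶠ t : ℝ in nhds 0, x + t • v ∈ M.face F := by
  obtain ⟨U, hU, hFU⟩ := M.face_planar F
  have hxp := mem_planeAt.1 (face_subset_planeAt F hx)
  rw [hFU] at hx ⊢
  have hc : Continuous fun t : ℝ => x + t • v := by fun_prop
  filter_upwards [hc.continuousAt.preimage_mem_nhds (hU.mem_nhds (by simpa using hx.1))] with t ht
  refine ⟨ht, mem_planeAt.2 ?_⟩
  rw [add_sub_right_comm]
  exact add_mem hxp (Submodule.smul_mem _ _
    (Submodule.mem_orthogonal_singleton_iff_inner_left.2 hv))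

end PolyMesh

/-! ## Direct sums of polynomial fields -/

lemma continuous_evalS (p : Poly3) : Continuous (evalS p) :=
  (continuous_eval p).comp (by fun_prop)

lemma continuous_evalV (w : VPoly3) : Continuous (evalV w) :=
  (PiLp.continuous_toLp 2 _).comp
    (continuous_pi fun i => (continuous_eval (w i)).comp (by fun_prop))

lemma evalV_add (v w : VPoly3) (x : E3) : evalV (v + w) x = evalV v x + evalV w x :=
  congrFun (congrArg Subtype.val (evV.map_add v w)) x

lemma evalS_dotProduct (v w : VPoly3) (x : E3) :
    evalS (v ⬝ᵥ w) x = inner ℝ (evalV v x) (evalV w x) := by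
  simp [evalS, evalV, dotProduct, PiLp.inner_apply, mul_comm]

lemma evalV_posV (c x : E3) : evalV (posV c) x = x - c := by
  ext i
  simp [evalV, posV]

lemma evalV_constV (a x : E3) : evalV (constV a) x = a := by
  ext i
  simp [evalV, constV]

lemma evalV_eq_zero_of_forall_dotProduct {w : VPoly3} {x : E3}
    (h : ∀ a : E3, evalS (w ⬝ᵥ constV a) x = 0) : evalV w x = 0 := by
  refine ext_inner_right ℝ fun a => ?_
  rw [inner_zero_left, ← h a, evalS_dotProduct, evalV_constV]

lemma eq_zero_of_evalS_eq_zero {p : Poly3} {U : Set E3} (hU : IsOpen U) (hne : U.Nonempty)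
    (h : ∀ x ∈ U, evalS p x = 0) : p = 0 := by
  obtain ⟨c, hc⟩ := hne
  have hU' : IsOpen ((WithLp.toLp 2 : (Fin 3 → ℝ) → E3) ⁻¹' U) :=
    hU.preimage (PiLp.continuous_toLp 2 _)
  obtain ⟨ε, hε, hball⟩ := Metric.isOpen_iff.1 hU' c.ofLp (by simpa using hc)
  refine MvPolynomial.funext_set (fun i => Metric.ball (c i) ε) (fun i => ?_) fun x hx => ?_
  · rw [Real.ball_eq_Ioo]
    exact Set.Ioo_infinite (by linarith)
  · rw [map_zero]
    refine h (WithLp.toLp 2 x) (hball ?_)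
    rwa [ball_pi _ hε]

lemma eq_zero_of_evalV_eq_zero {w : VPoly3} {U : Set E3} (hU : IsOpen U) (hne : U.Nonempty)
    (h : ∀ x ∈ U, evalV w x = 0) : w = 0 :=
  funext fun i => eq_zero_of_evalS_eq_zero hU hne fun x hx =>
    congrArg (fun v : E3 => v i) (h x hx)

lemma hasDerivAt_evalS_add_smul (p : Poly3) (x v : E3) (t : ℝ) :
    HasDerivAt (fun t : ℝ => evalS p (x + t • v)) (evalS (constV v ⬝ᵥ gradP p) (x + t • v)) t := by
  simpa [evalS, dotProduct, constV, gradP] using hasDerivAt_eval_add_smul p x.ofLp v.ofLp t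

lemma evalS_eq_of_posV_dotProduct_gradP {r : Poly3} {c : E3} {S : Set E3} (hS : StarConvex ℝ c S)
    (h : ∀ x ∈ S, evalS (posV c ⬝ᵥ gradP r) x = 0) : ∀ x ∈ S, evalS r x = evalS r c := by
  intro x hx
  have hd := hasDerivAt_evalS_add_smul r c (x - c)
  obtain ⟨t, ht, hslope⟩ := exists_hasDerivAt_eq_slope _ _ zero_lt_one
    (fun t _ => (hd t).continuousAt.continuousWithinAt) fun t _ => hd t
  have hmem : c + t • (x - c) ∈ S := by
    convert hS hx (sub_nonneg.2 ht.2.le) ht.1.le (by simp) using 1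
    module
  have hz := h _ hmem
  simp only [evalS_dotProduct, evalV_posV, evalV_constV, add_sub_cancel_left, inner_smul_left,
    RCLike.conj_to_real, mul_eq_zero, ht.1.ne', false_or] at hz hslope
  rw [hz, one_smul, zero_smul, add_zero, add_sub_cancel, sub_zero, div_one] at hslope
  exact sub_eq_zero.1 hslope.symm

namespace PolyMesh

variable {M : PolyMesh}

lemma constV_normal_dotProduct_self (F : Fin M.nF) :
    constV (M.normal F) ⬝ᵥ constV (M.normal F) = 1 := by
  have h := EuclideanSpace.real_norm_sq_eq (M.normal F)
  rw [M.normal_unit, one_pow] at h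
  rw [← C_1, h]
  simp [constV, dotProduct, sq]

lemma evalV_rotP_eq_zero_of_const {F : Fin M.nF} {r : Poly3} {a : ℝ}
    (h : ∀ x ∈ M.face F, evalS r x = a) :
    ∀ x ∈ closure (M.face F), evalV (rotP (M.normal F) r) x = 0 := by
  refine Set.EqOn.closure (g := 0) (fun x hx => ?_) (continuous_evalV _) continuous_const
  have htangent (v : E3) (hv : inner ℝ v (M.normal F) = 0) :
      evalS (constV v ⬝ᵥ gradP r) x = 0 := by
    have hconst : (fun t : ℝ => evalS r (x + t • v)) =ᶠ[nhds 0] fun _ => a :=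
      (eventually_add_smul_mem_face hx hv).mono fun t ht => h _ ht
    simpa using ((hasDerivAt_evalS_add_smul r x v 0).congr_of_eventuallyEq hconst.symm).unique
      (hasDerivAt_const 0 a)
  refine evalV_eq_zero_of_forall_dotProduct fun b => ?_
  have hperm : rotP (M.normal F) r ⬝ᵥ constV b =
      constV (cross (M.normal F) b) ⬝ᵥ gradP r := by
    rw [show constV (cross (M.normal F) b) = constV (M.normal F) ⨯₃ constV b by
      funext i; fin_cases i <;> simp [constV, cross, crossProduct]]
    simp only [rotP, LinearMap.coe_mk, AddHom.coe_mk]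
    rw [dotProduct_comm, triple_product_permutation, dotProduct_comm]
  rw [hperm]
  refine htangent _ ?_
  simp only [cross, crossProduct, LinearMap.mk₂_apply, PiLp.inner_apply, RCLike.inner_apply,
    Real.ringHom_apply, Fin.sum_univ_three, Matrix.cons_val]
  ring

/-- On the face, `n × (x - x_F)` times the field is `-(x - x_F) · ∇r`, so that `r` is constant along
the rays issued from `x_F`. -/
lemma eq_zero_of_rotP_add_mulPos {F : Fin M.nF} {r p : Poly3}
    (h : ∀ x ∈ M.face F, evalV (rotP (M.normal F) r + mulPos (M.facePt F) p) x = 0)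
    (h0 : ∫ x, evalS r x ∂M.mF F = 0) :
    (∀ x ∈ closure (M.face F), evalS r x = 0) ∧
      ∀ x ∈ closure (M.face F), evalV (mulPos (M.facePt F) p) x = 0 := by
  set n := constV (M.normal F)
  set y := posV (M.facePt F) with hy
  have hprod : (n ⨯₃ y) ⬝ᵥ (rotP (M.normal F) r + mulPos (M.facePt F) p) =
      (n ⬝ᵥ gradP r) * (y ⬝ᵥ n) - y ⬝ᵥ gradP r := by
    rw [show mulPos (M.facePt F) p = p • y by funext i; simp [mulPos, hy],
      show rotP (M.normal F) r = gradP r ⨯₃ n from rfl, dotProduct_add, dotProduct_smul,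
      cross_dot_cross, constV_normal_dotProduct_self, dotProduct_comm (n ⨯₃ y) y, dot_cross_self,
      smul_zero, add_zero, one_mul]
  have hconst : ∀ x ∈ M.face F, evalS r x = evalS r (M.facePt F) := by
    refine evalS_eq_of_posV_dotProduct_gradP (starConvex_face F) fun x hx => ?_
    have hplane : evalS (y ⬝ᵥ n) x = 0 := by
      rw [evalS_dotProduct, evalV_posV, evalV_constV]
      exact face_subset_planeAt F hx
    have hz := congrArg (evalS · x) hprod
    simp only [evalS_dotProduct (n ⨯₃ y), h x hx, inner_zero_right] at hz
    simp only [evalS, map_sub, map_mul] at hz hplane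
    rwa [hplane, mul_zero, zero_sub, eq_comm, neg_eq_zero] at hz
  have hconst' : Set.EqOn (evalS r) (fun _ => evalS r (M.facePt F)) (closure (M.face F)) :=
    Set.EqOn.closure hconst (continuous_evalS r) continuous_const
  have hr := eq_zero_of_integral_eq_zero_of_ae_eq (ae_mF hconst') h0
  refine ⟨fun x hx => (hconst' hx).trans hr, Set.EqOn.closure (g := 0) (fun x hx => ?_)
    (continuous_evalV _) continuous_const⟩
  simpa [evalV_add, evalV_rotP_eq_zero_of_const hconst x (subset_closure hx)] using h x hx

lemma eq_zero_of_gradP_add_crossPos {T : Fin M.nT} {r : Poly3} {z : VPoly3}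
    (h : ∀ x ∈ M.cell T, evalV (gradP r + crossPos (M.cellPt T) z) x = 0)
    (h0 : ∫ x, evalS r x ∂M.mT T = 0) : r = 0 ∧ crossPos (M.cellPt T) z = 0 := by
  have hconst : ∀ x ∈ M.cell T, evalS r x = evalS r (M.cellPt T) := by
    refine evalS_eq_of_posV_dotProduct_gradP (starConvex_cell T) fun x hx => ?_
    have hdot : posV (M.cellPt T) ⬝ᵥ (gradP r + crossPos (M.cellPt T) z) =
        posV (M.cellPt T) ⬝ᵥ gradP r := by simp [crossPos, dotProduct_add]
    rw [← hdot, evalS_dotProduct, h x hx, inner_zero_right]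
  have hconst' : Set.EqOn (evalS r) (fun _ => evalS r (M.cellPt T)) (closure (M.cell T)) :=
    Set.EqOn.closure hconst (continuous_evalS r) continuous_const
  have hne : (M.cell T).Nonempty := ⟨_, M.cellPt_mem T⟩
  have hr : r = 0 := eq_zero_of_evalS_eq_zero (M.cell_open T) hne fun x hx =>
    (hconst x hx).trans (eq_zero_of_integral_eq_zero_of_ae_eq (ae_mT hconst') h0)
  refine ⟨hr, eq_zero_of_evalV_eq_zero (M.cell_open T) hne fun x hx => ?_⟩
  simpa [hr] using h x hx

end PolyMesh

/-! ## The boundary of the boundary of an element -/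

open Filter Topology

section Jumps

lemma eq_of_eventually_eq_nhdsGT_nhdsLT {G : Type*} [NormedAddCommGroup G] [NormedSpace ℝ G]
    {g : ℝ → G} {a b : ℝ} (hab : a ≤ b) (hright : ∀ x ∈ Set.Icc a b, ∀ᶠ y in 𝓝[>] x, g y = g x)
    (hleft : ∀ x ∈ Set.Ioc a b, ∀ᶠ y in 𝓝[<] x, g y = g x) : g b = g a := by
  have hge (x : ℝ) (hx : x ∈ Set.Icc a b) : g =ᶠ[𝓝[≥] x] fun _ => g x := by
    rw [← Set.Ioi_insert, EventuallyEq, nhdsWithin_insert, eventually_sup]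
    exact ⟨rfl, hright x hx⟩
  refine constant_of_has_deriv_right_zero (fun x hx => ?_) (fun x hx => ?_) b ⟨hab, le_rfl⟩
  · have hge' := continuousWithinAt_const.congr_of_eventuallyEq (hge x hx) rfl
    rcases hx.1.eq_or_lt with rfl | hax
    · exact hge'.mono fun y hy => hy.1
    · refine (continuousAt_iff_continuous_left_right.2 ⟨?_, hge'⟩).continuousWithinAt
      rw [← Set.Iio_insert, continuousWithinAt_insert_self]
      exact continuousWithinAt_const.congr_of_eventuallyEq (hleft x ⟨hax, hx.2⟩) rfl
  · exact (hasDerivWithinAt_const x _ (g x)).congr_of_eventuallyEq (hge x ⟨hx.1, hx.2.le⟩) rfl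

lemma eventually_nhdsGT_forall_le_iff (K : Finset ℝ) (x : ℝ) :
    ∀ᶠ y in 𝓝[>] x, ∀ z ∈ K, z ≤ y ↔ z ≤ x := by
  refine (Finset.eventually_all K).2 fun z _ => ?_
  rcases le_or_gt z x with h | h
  · filter_upwards [self_mem_nhdsWithin] with y hy
    exact iff_of_true (h.trans (le_of_lt hy)) h
  · filter_upwards [mem_nhdsWithin_of_mem_nhds (Iio_mem_nhds h)] with y hy
    exact iff_of_false (not_le.2 hy) (not_le.2 h)

lemma eventually_nhdsLT_forall_le_iff (K : Finset ℝ) (x : ℝ) :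
    ∀ᶠ y in 𝓝[<] x, ∀ z ∈ K, z ≤ y ↔ z < x := by
  refine (Finset.eventually_all K).2 fun z _ => ?_
  rcases lt_or_ge z x with h | h
  · filter_upwards [mem_nhdsWithin_of_mem_nhds (Ioi_mem_nhds h)] with y hy
    exact iff_of_true (le_of_lt hy) h
  · filter_upwards [self_mem_nhdsWithin] with y hy
    exact iff_of_false (not_le.2 (lt_of_lt_of_le hy h)) (not_lt.2 h)

lemma eventually_eq_of_forall_nhdsGT {G : Type*} {f r : ℝ → G}
    (hr : ∀ x, ∀ᶠ y in 𝓝[>] x, f y = r x) {t : Set ℝ} (ht : IsOpen t) {x : ℝ} {c : G}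
    (hc : ∀ᶠ y in 𝓝[t] x, f y = c) : ∀ᶠ y in 𝓝[t] x, r y = c := by
  filter_upwards [eventually_eventually_nhdsWithin.2 hc, self_mem_nhdsWithin] with y hy hyt
  rw [ht.nhdsWithin_eq hyt] at hy
  obtain ⟨z, hz, hz'⟩ := ((hr y).and (hy.filter_mono nhdsWithin_le_nhds)).exists
  exact hz.symm.trans hz'

variable {G : Type*} [NormedAddCommGroup G] [NormedSpace ℝ G] {f l r : ℝ → G} {a T : ℝ}
  {K : Finset ℝ}

/-- Subtracting its jumps makes the right limit of `f` locally constant. -/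
lemma sub_eq_sum_jumps {b : ℝ} (hab : a ≤ b) (hl : ∀ x, ∀ᶠ y in 𝓝[<] x, f y = l x)
    (hr : ∀ x, ∀ᶠ y in 𝓝[>] x, f y = r x) (hK : ↑K ⊆ Set.Ioc a b)
    (hlr : ∀ x ∈ Set.Ioc a b, x ∉ K → l x = r x) : r b - r a = ∑ x ∈ K, (r x - l x) := by
  let g (x : ℝ) : G := r x - ∑ y ∈ K with y ≤ x, (r y - l y)
  have hleft (x : ℝ) (hx : x ∈ Set.Ioc a b) : g x = l x - ∑ y ∈ K with y < x, (r y - l y) := by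
    by_cases hxK : x ∈ K
    · have hinsert : K.filter (· ≤ x) = insert x (K.filter (· < x)) := by ext y; grind
      simp only [g, hinsert]
      rw [Finset.sum_insert (by simp)]
      abel
    · have hfilter : K.filter (· ≤ x) = K.filter (· < x) := by ext y; grind
      simp only [g, hfilter, hlr x hx hxK]
  have hconst : g b = g a := by
    refine eq_of_eventually_eq_nhdsGT_nhdsLT hab (fun x _ => ?_) fun x hx => ?_
    · filter_upwards [eventually_nhdsGT_forall_le_iff K x,
        eventually_eq_of_forall_nhdsGT hr isOpen_Ioi (hr x)] with y hy hry
      simp only [g, hry, Finset.filter_congr hy]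
    · filter_upwards [eventually_nhdsLT_forall_le_iff K x,
        eventually_eq_of_forall_nhdsGT hr isOpen_Iio (hl x)] with y hy hry
      rw [hleft x hx]
      simp only [g, hry, Finset.filter_congr hy]
  simp only [g] at hconst
  rw [Finset.filter_true_of_mem fun x hx => (hK hx).2,
    Finset.filter_false_of_mem fun x hx => (hK hx).1.not_ge, Finset.sum_empty, sub_zero] at hconst
  rw [← hconst, sub_sub_cancel]

lemma sum_jumps_eq_zero_of_periodic (hT : 0 ≤ T) (hf : Function.Periodic f T)
    (hl : ∀ x, ∀ᶠ y in 𝓝[<] x, f y = l x) (hr : ∀ x, ∀ᶠ y in 𝓝[>] x, f y = r x)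
    (hK : ↑K ⊆ Set.Ioc a (a + T)) (hlr : ∀ x ∈ Set.Ioc a (a + T), x ∉ K → l x = r x) :
    ∑ x ∈ K, (r x - l x) = 0 := by
  have hshift : Tendsto (· + T) (𝓝[>] a) (𝓝[>] (a + T)) :=
    (continuous_add_const T).continuousWithinAt.tendsto_nhdsWithin fun x hx => by simpa using hx
  obtain ⟨y, hy, hy'⟩ := ((hr a).and (hshift.eventually (hr (a + T)))).exists
  rw [← sub_eq_sum_jumps (le_add_of_nonneg_right hT) hl hr hK hlr, ← hy', hf, hy, sub_self]

end Jumps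

section Cross

lemma inner_eq_sum (x y : E3) : (inner ℝ x y : ℝ) = x 0 * y 0 + x 1 * y 1 + x 2 * y 2 := by
  rw [PiLp.inner_apply, Fin.sum_univ_three]
  simp only [RCLike.inner_apply, conj_trivial, mul_comm]

lemma cross_eq (x y : E3) : cross x y = !₂[x 1 * y 2 - x 2 * y 1, x 2 * y 0 - x 0 * y 2,
    x 0 * y 1 - x 1 * y 0] := by
  simp [cross, crossProduct]

lemma cross_add_right (a b c : E3) : cross a (b + c) = cross a b + cross a c := by
  simp [cross]

lemma cross_smul_right (a b : E3) (c : ℝ) : cross a (c • b) = c • cross a b := by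
  simp [cross]

lemma inner_cross_self_left (a b : E3) : inner ℝ a (cross a b) = 0 := by
  simp only [inner_eq_sum, cross_eq, Matrix.cons_val]
  ring

lemma inner_cross_self_right (a b : E3) : inner ℝ b (cross a b) = 0 := by
  simp only [inner_eq_sum, cross_eq, Matrix.cons_val]
  ring

lemma inner_cross_cross (a b c d : E3) : (inner ℝ (cross a b) (cross c d) : ℝ) =
    inner ℝ a c * inner ℝ b d - inner ℝ a d * inner ℝ b c := by
  simp only [inner_eq_sum, cross_eq, Matrix.cons_val]
  ring

lemma cross_cross_right (a b c : E3) :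
    cross a (cross b c) = (inner ℝ a c : ℝ) • b - (inner ℝ a b : ℝ) • c := by
  ext i
  fin_cases i <;>
  · simp only [inner_eq_sum, cross_eq, PiLp.sub_apply, PiLp.smul_apply, smul_eq_mul, Fin.zero_eta,
      Fin.mk_one, Fin.reduceFinMk, Fin.isValue, Matrix.cons_val]
    ring

lemma cross_cross_left (a b c : E3) :
    cross (cross a b) c = (inner ℝ a c : ℝ) • b - (inner ℝ b c : ℝ) • a := by
  ext i
  fin_cases i <;>
  · simp only [inner_eq_sum, cross_eq, PiLp.sub_apply, PiLp.smul_apply, smul_eq_mul, Fin.zero_eta,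
      Fin.mk_one, Fin.reduceFinMk, Fin.isValue, Matrix.cons_val]
    ring

lemma norm_cross_eq_one {a b : E3} (ha : ‖a‖ = 1) (hb : ‖b‖ = 1) (hab : inner ℝ a b = 0) :
    ‖cross a b‖ = 1 := by
  have h := inner_cross_cross a b a b
  simp only [real_inner_self_eq_norm_sq, ha, hb, hab, one_pow, mul_one, zero_mul, sub_zero] at h
  exact (pow_eq_one_iff_of_nonneg (norm_nonneg _) two_ne_zero).1 h

end Cross

section Rotation

/-- The rotation of `u` by the angle `θ` about the axis spanned by the unit vector `t`, for `u`
orthogonal to `t`. It parametrizes the unit circle of the plane orthogonal to `t`. -/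
def rotAbout (t u : E3) (θ : ℝ) : E3 := Real.cos θ • u + Real.sin θ • cross t u

variable {t u : E3}

lemma continuous_rotAbout : Continuous (rotAbout t u) := by
  unfold rotAbout
  fun_prop

lemma periodic_rotAbout : Function.Periodic (rotAbout t u) (2 * Real.pi) := fun θ => by
  simp only [rotAbout, Real.cos_add_two_pi, Real.sin_add_two_pi]

lemma inner_rotAbout (htu : inner ℝ t u = 0) (θ : ℝ) : inner ℝ t (rotAbout t u θ) = 0 := by
  rw [rotAbout, inner_add_right, inner_smul_right, inner_smul_right, htu, inner_cross_self_left,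
    mul_zero, mul_zero, add_zero]

lemma inner_add_smul_cross (ht : ‖t‖ = 1) (hu : ‖u‖ = 1) (htu : inner ℝ t u = 0) (a b c d : ℝ) :
    inner ℝ (a • u + b • cross t u) (c • u + d • cross t u) = a * c + b * d := by
  have hw := norm_cross_eq_one ht hu htu
  have huw := inner_cross_self_right t u
  simp only [inner_add_left, inner_add_right, real_inner_smul_left, real_inner_smul_right,
    real_inner_self_eq_norm_sq, hu, hw, huw, real_inner_comm u (cross t u)]
  ring

lemma norm_rotAbout (ht : ‖t‖ = 1) (hu : ‖u‖ = 1) (htu : inner ℝ t u = 0) (θ : ℝ) :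
    ‖rotAbout t u θ‖ = 1 := by
  rw [← pow_eq_one_iff_of_nonneg (norm_nonneg _) two_ne_zero, ← real_inner_self_eq_norm_sq,
    rotAbout, inner_add_smul_cross ht hu htu, ← sq, ← sq, Real.cos_sq_add_sin_sq]

lemma inner_rotAbout_cross_rotAbout (ht : ‖t‖ = 1) (hu : ‖u‖ = 1) (htu : inner ℝ t u = 0)
    (φ θ : ℝ) : inner ℝ (rotAbout t u φ) (cross t (rotAbout t u θ)) = Real.sin (φ - θ) := by
  have hcross : cross t (rotAbout t u θ) = (-Real.sin θ) • u + Real.cos θ • cross t u := by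
    rw [rotAbout, cross_add_right, cross_smul_right, cross_smul_right, cross_cross_right, htu,
      real_inner_self_eq_norm_sq, ht]
    module
  rw [hcross, rotAbout, inner_add_smul_cross ht hu htu, Real.sin_sub]
  ring

lemma eq_add_smul_cross {d : E3} (ht : ‖t‖ = 1) (hu : ‖u‖ = 1) (htu : inner ℝ t u = 0)
    (htd : inner ℝ t d = 0) :
    d = (inner ℝ u d : ℝ) • u + (inner ℝ (cross t u) d : ℝ) • cross t u := by
  have hd : cross d (cross t u) = (inner ℝ u d : ℝ) • t := by
    rw [cross_cross_right, real_inner_comm t d, htd, real_inner_comm u d, zero_smul, sub_zero]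
  have ht' : cross (cross t u) t = u := by
    rw [cross_cross_left, real_inner_comm t u, htu, real_inner_self_eq_norm_sq, ht, one_pow,
      one_smul, zero_smul, sub_zero]
  have h := cross_cross_right (cross t u) d (cross t u)
  rw [hd, cross_smul_right, ht', real_inner_self_eq_norm_sq, norm_cross_eq_one ht hu htu, one_pow,
    one_smul, eq_sub_iff_add_eq] at h
  exact h.symm

lemma exists_eq_rotAbout {d : E3} (ht : ‖t‖ = 1) (hu : ‖u‖ = 1) (htu : inner ℝ t u = 0)
    (hd : ‖d‖ = 1) (htd : inner ℝ t d = 0) :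
    ∃ α ∈ Set.Ioc (-Real.pi) Real.pi, rotAbout t u α = d := by
  have hframe := eq_add_smul_cross ht hu htu htd
  set z : ℂ := ⟨inner ℝ u d, inner ℝ (cross t u) d⟩
  have hz : ‖z‖ = 1 := by
    rw [← pow_eq_one_iff_of_nonneg (norm_nonneg _) two_ne_zero, Complex.sq_norm, Complex.normSq_mk,
      ← inner_add_smul_cross ht hu htu, ← hframe, real_inner_self_eq_norm_sq, hd, one_pow]
  refine ⟨z.arg, z.arg_mem_Ioc, ?_⟩
  have hcos := Complex.norm_mul_cos_arg z
  have hsin := Complex.norm_mul_sin_arg z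
  rw [hz, one_mul] at hcos hsin
  rw [rotAbout, hcos, hsin]
  exact hframe.symm

lemma injOn_rotAbout (ht : ‖t‖ = 1) (hu : ‖u‖ = 1) (htu : inner ℝ t u = 0) :
    Set.InjOn (rotAbout t u) (Set.Ioc (-Real.pi) Real.pi) := by
  intro α hα β hβ h
  have hcos := congrArg (fun x => inner ℝ x ((1 : ℝ) • u + (0 : ℝ) • cross t u)) h
  have hsin := congrArg (fun x => inner ℝ x ((0 : ℝ) • u + (1 : ℝ) • cross t u)) h
  simp only [rotAbout, inner_add_smul_cross ht hu htu, mul_one, mul_zero, add_zero, zero_add]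
    at hcos hsin
  rw [← Real.Angle.toReal_coe_eq_self_iff_mem_Ioc.2 hα, Real.Angle.cos_sin_inj hcos hsin,
    Real.Angle.toReal_coe_eq_self_iff_mem_Ioc.2 hβ]

end Rotation

lemma subset_or_subset_compl_of_disjoint_frontier {X : Type*} [TopologicalSpace X] {H S : Set X}
    (hH : IsPreconnected H) (h : Disjoint H (frontier S)) : H ⊆ S ∨ H ⊆ Sᶜ := by
  have hcover : H ⊆ interior S ∪ interior Sᶜ := by
    rw [← compl_frontier_eq_union_interior]
    exact h.subset_compl_right
  exact (hH.subset_or_subset isOpen_interior isOpen_interior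
    (disjoint_compl_right.mono interior_subset interior_subset) hcover).imp
    (·.trans interior_subset) (·.trans interior_subset)

lemma halfBall_subset_or_subset_compl {V : Type*} [NormedAddCommGroup V] [InnerProductSpace ℝ V]
    {S : Set V} {p m : V} {δ : ℝ}
    (hS : ∀ x ∈ Metric.ball p δ, x ∈ frontier S → inner ℝ m (x - p) = 0) :
    Metric.ball p δ ∩ {x | 0 < inner ℝ m (x - p)} ⊆ S ∨
      Metric.ball p δ ∩ {x | 0 < inner ℝ m (x - p)} ⊆ Sᶜ := by
  refine subset_or_subset_compl_of_disjoint_frontier (Convex.isPreconnected ?_)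
    (Set.disjoint_left.2 fun x hx hxS => hx.2.ne' (hS x hx.1 hxS))
  simp only [inner_sub_right, sub_pos]
  exact (convex_ball p δ).inter (convex_halfSpace_gt (innerₛₗ ℝ m).isLinear _)

lemma PointsOut.smul {S : Set E3} {x n : E3} (h : PointsOut S x n) {c : ℝ} (hc : 0 < c) :
    PointsOut S x (c • n) := by
  obtain ⟨ε, hε, h⟩ := h
  refine ⟨ε / c, by positivity, fun s hs => ?_⟩
  have := h (s * c) ⟨mul_pos hs.1 hc, (lt_div_iff₀ hc).1 hs.2⟩
  rwa [mul_smul] at this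

lemma PointsOut.eventually {S : Set E3} {x n : E3} (h : PointsOut S x n) :
    ∀ᶠ s : ℝ in 𝓝[>] 0, x - s • n ∈ S ∧ x + s • n ∉ S := by
  obtain ⟨ε, hε, h⟩ := h
  filter_upwards [Ioo_mem_nhdsGT hε] with s hs using h s hs

lemma eventually_mem_or_notMem_of_pointsOut {S : Set E3} {p n : E3} (h : PointsOut S p n)
    (hS : ∀ᶠ x in 𝓝 p, x ∈ frontier S → inner ℝ n (x - p) = 0) :
    ∀ᶠ x in 𝓝 p, (inner ℝ n (x - p) < 0 → x ∈ S) ∧ (0 < inner ℝ n (x - p) → x ∉ S) := by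
  obtain ⟨δ, hδ, hball⟩ := Metric.eventually_nhds_iff_ball.1 hS
  have hnear (m : E3) : ∀ᶠ s : ℝ in 𝓝[>] 0, p + s • m ∈ Metric.ball p δ := by
    have hcont : Continuous fun s : ℝ => p + s • m := by fun_prop
    refine (hcont.tendsto' 0 p (by simp)).mono_left nhdsWithin_le_nhds ?_
    exact Metric.ball_mem_nhds p hδ
  obtain ⟨s, ⟨⟨hin, hout⟩, hs⟩, ⟨hs', hs0⟩⟩ :=
    ((h.eventually.and (hnear n)).and ((hnear (-n)).and self_mem_nhdsWithin)).exists
  have hn : n ≠ 0 := fun hn => hout (by simpa [hn] using hin)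
  have hpos : 0 < s * inner ℝ n n := mul_pos hs0 (real_inner_self_pos.2 hn)
  have hneg := (halfBall_subset_or_subset_compl (m := -n)
    fun x hx hxS => by rw [inner_neg_left, hball x hx hxS, neg_zero]).resolve_right fun hc =>
      hc ⟨hs', by simpa [inner_smul_right] using hpos⟩ (by simpa [sub_eq_add_neg] using hin)
  have hpos' := (halfBall_subset_or_subset_compl hball).resolve_left fun hc =>
    hout (hc ⟨hs, by simpa [inner_smul_right] using hpos⟩)
  filter_upwards [Metric.ball_mem_nhds p hδ] with x hx
  exact ⟨fun hlt => hneg ⟨hx, by simpa [inner_neg_left] using hlt⟩, fun hgt => hpos' ⟨hx, hgt⟩⟩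

lemma eventually_forall_unit_add_smul_notMem {V : Type*} [NormedAddCommGroup V] [NormedSpace ℝ V]
    {K : Set V} (hK : IsClosed K) {x : V} (hx : x ∉ K) :
    ∀ᶠ ρ : ℝ in 𝓝[>] 0, ∀ d : V, ‖d‖ = 1 → x + ρ • d ∉ K := by
  obtain ⟨ε, hε, hb⟩ := Metric.isOpen_iff.1 hK.isOpen_compl x hx
  filter_upwards [Ioo_mem_nhdsGT hε] with ρ hρ d hd
  exact hb (by simpa [norm_smul, hd, abs_of_pos hρ.1] using hρ.2)

namespace PolyMesh

variable {M : PolyMesh}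

lemma mem_facesT {T : Fin M.nT} {F : Fin M.nF} :
    F ∈ M.facesT T ↔ M.face F ⊆ frontier (M.cell T) := by
  simp [facesT]

lemma closure_edge (E : Fin M.nE) :
    closure (M.edge E) = insert (M.vert (M.src E)) (insert (M.vert (M.tgt E)) (M.edge E)) := by
  rw [edge, closure_openSegment, insert_endpoints_openSegment]

lemma disjoint_face_edge (F : Fin M.nF) (E : Fin M.nE) : Disjoint (M.face F) (M.edge E) :=
  M.entities_disjoint (i := Sum.inr (Sum.inl F)) (j := Sum.inr (Sum.inr (Sum.inl E))) (by simp)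

lemma vert_notMem_face (F : Fin M.nF) (V : Fin M.nV) : M.vert V ∉ M.face F := by
  have := M.entities_disjoint (i := Sum.inr (Sum.inl F)) (j := Sum.inr (Sum.inr (Sum.inr V)))
    (by simp)
  simpa [Function.onFun] using this

lemma vert_notMem_edge (E : Fin M.nE) (V : Fin M.nV) : M.vert V ∉ M.edge E := by
  have := M.entities_disjoint (i := Sum.inr (Sum.inr (Sum.inl E)))
    (j := Sum.inr (Sum.inr (Sum.inr V))) (by simp)
  exact fun h => Set.disjoint_left.1 this h rfl

lemma eq_of_mem_edge {E E' : Fin M.nE} {x : E3} (hx : x ∈ M.edge E) (hx' : x ∈ M.edge E') :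
    E = E' := by
  by_contra hne
  have := M.entities_disjoint (i := Sum.inr (Sum.inr (Sum.inl E)))
    (j := Sum.inr (Sum.inr (Sum.inl E'))) (by simpa using hne)
  exact Set.disjoint_left.1 this hx hx'

lemma eq_of_mem_face {F F' : Fin M.nF} {x : E3} (hx : x ∈ M.face F) (hx' : x ∈ M.face F') :
    F = F' := by
  by_contra hne
  have := M.entities_disjoint (i := Sum.inr (Sum.inl F)) (j := Sum.inr (Sum.inl F'))
    (by simpa using hne)
  exact Set.disjoint_left.1 this hx hx'

lemma eq_of_mem_closure_edge {E E' : Fin M.nE} {x : E3} (hx : x ∈ M.edge E)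
    (hx' : x ∈ closure (M.edge E')) : E' = E := by
  rw [closure_edge] at hx'
  rcases hx' with rfl | rfl | hx'
  · exact absurd hx (vert_notMem_edge _ _)
  · exact absurd hx (vert_notMem_edge _ _)
  · exact eq_of_mem_edge hx' hx

lemma exists_edge_of_mem_closure_face {F : Fin M.nF} {x : E3} (hx : x ∈ closure (M.face F))
    (hx' : x ∉ M.face F) : ∃ E ∈ M.edgesF F, x ∈ closure (M.edge E) := by
  have : x ∈ closure (M.face F) \ M.face F := ⟨hx, hx'⟩
  rw [M.face_boundary F] at this
  simp only [Set.mem_iUnion] at this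
  obtain ⟨E, hE, h⟩ := this
  exact ⟨E, mem_edgesF.2 hE, h⟩

lemma mem_edgesF_of_mem_closure_face {F : Fin M.nF} {E : Fin M.nE} {x : E3} (hx : x ∈ M.edge E)
    (hx' : x ∈ closure (M.face F)) : E ∈ M.edgesF F := by
  obtain ⟨E', hE', h⟩ := exists_edge_of_mem_closure_face hx'
    fun h => Set.disjoint_left.1 (disjoint_face_edge F E) h hx
  rwa [eq_of_mem_closure_edge hx h] at hE'

lemma eq_of_mem_closure_face {F F' : Fin M.nF} {x : E3} (hx : x ∈ M.face F)
    (hx' : x ∈ closure (M.face F')) : F' = F := by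
  by_contra hne
  obtain ⟨E, -, h⟩ := exists_edge_of_mem_closure_face hx' fun h => hne (eq_of_mem_face h hx)
  rw [closure_edge] at h
  rcases h with rfl | rfl | h
  · exact vert_notMem_face _ _ hx
  · exact vert_notMem_face _ _ hx
  · exact Set.disjoint_left.1 (disjoint_face_edge F E) hx h

lemma exists_face_of_mem_frontier {T : Fin M.nT} {x : E3} (hx : x ∈ frontier (M.cell T)) :
    ∃ F ∈ M.facesT T, x ∈ closure (M.face F) := by
  rw [M.cell_boundary T] at hx
  simp only [Set.mem_iUnion] at hx
  obtain ⟨F, hF, h⟩ := hx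
  exact ⟨F, mem_facesT.2 hF, h⟩

lemma oTF_eq (T : Fin M.nT) (F : Fin M.nF) : M.oTF T F = 1 ∨ M.oTF T F = -1 := by
  unfold oTF
  split_ifs <;> simp

lemma oFE_eq (F : Fin M.nF) (E : Fin M.nE) : M.oFE F E = 1 ∨ M.oFE F E = -1 := by
  unfold oFE
  split_ifs <;> simp

lemma pointsOut_cell {T : Fin M.nT} {F : Fin M.nF} (hF : F ∈ M.facesT T) {x : E3}
    (hx : x ∈ M.face F) : PointsOut (M.cell T) x (M.oTF T F • M.normal F) := by
  unfold oTF
  split_ifs with h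
  · simpa using h x hx
  · rcases M.cell_one_sided T F (mem_facesT.1 hF) with h' | h'
    · exact absurd h' h
    · simpa using h' x hx

lemma pointsOut_face {F : Fin M.nF} {E : Fin M.nE} (hE : E ∈ M.edgesF F) {x : E3}
    (hx : x ∈ M.edge E) : PointsOut (M.face F) x (M.oFE F E • M.normalFE F E) := by
  have hpos : 0 < ‖M.vert (M.tgt E) - M.vert (M.src E)‖⁻¹ :=
    inv_pos.2 (norm_pos_iff.2 (vert_tgt_sub_vert_src_ne_zero E))
  have heq : M.normalFE F E = ‖M.vert (M.tgt E) - M.vert (M.src E)‖⁻¹ •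
      cross (M.normal F) (M.vert (M.tgt E) - M.vert (M.src E)) := by
    rw [normalFE, tangent, cross_smul_right]
  unfold oFE
  split_ifs with h
  · simpa using h x hx
  · rcases M.face_one_sided F E (mem_edgesF.1 hE) with h' | h'
    · refine absurd (fun y hy => ?_) h
      rw [heq]
      exact (h' y hy).smul hpos
    · rw [heq, neg_one_smul, ← smul_neg]
      exact (h' x hx).smul hpos

lemma nonempty_edge (E : Fin M.nE) : (M.edge E).Nonempty :=
  ⟨_, 2⁻¹, 2⁻¹, by norm_num, by norm_num, by norm_num, rfl⟩

lemma norm_tangent (E : Fin M.nE) : ‖M.tangent E‖ = 1 := by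
  rw [tangent, norm_smul, norm_inv, norm_norm]
  exact inv_mul_cancel₀ (norm_ne_zero_iff.2 (vert_tgt_sub_vert_src_ne_zero E))

lemma inner_normal_sub_eq_zero {F : Fin M.nF} {x y : E3} (hx : x ∈ closure (M.face F))
    (hy : y ∈ closure (M.face F)) : inner ℝ (M.normal F) (x - y) = 0 := by
  rw [← sub_sub_sub_cancel_right x y (M.facePt F)]
  exact Submodule.mem_orthogonal_singleton_iff_inner_right.1
    (sub_mem (mem_planeAt.1 (closure_face_subset_planeAt F hx))
      (mem_planeAt.1 (closure_face_subset_planeAt F hy)))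

lemma inner_normal_tangent {F : Fin M.nF} {E : Fin M.nE} (hE : E ∈ M.edgesF F) :
    inner ℝ (M.normal F) (M.tangent E) = 0 := by
  have hsub : closure (M.edge E) ⊆ closure (M.face F) :=
    closure_minimal ((mem_edgesF.1 hE).trans Set.sdiff_subset) isClosed_closure
  rw [tangent, inner_smul_right, inner_normal_sub_eq_zero (hsub _) (hsub _), mul_zero] <;>
    simp [closure_edge]

lemma exists_sub_eq_smul_tangent {E : Fin M.nE} {x y : E3} (hx : x ∈ closure (M.edge E))
    (hy : y ∈ closure (M.edge E)) : ∃ c : ℝ, y - x = c • M.tangent E := by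
  rw [edge, closure_openSegment, segment_eq_image'] at hx hy
  obtain ⟨a, -, rfl⟩ := hx
  obtain ⟨b, -, rfl⟩ := hy
  refine ⟨(b - a) * ‖M.vert (M.tgt E) - M.vert (M.src E)‖, ?_⟩
  rw [tangent, smul_smul, mul_assoc, mul_inv_cancel₀
    (norm_ne_zero_iff.2 (vert_tgt_sub_vert_src_ne_zero E))]
  module

lemma eventually_mem_or_notMem_cell {T : Fin M.nT} {F : Fin M.nF} (hF : F ∈ M.facesT T) {p : E3}
    (hp : p ∈ M.face F) : ∀ᶠ x in 𝓝 p,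
      (inner ℝ (M.oTF T F • M.normal F) (x - p) < 0 → x ∈ M.cell T) ∧
      (0 < inner ℝ (M.oTF T F • M.normal F) (x - p) → x ∉ M.cell T) := by
  refine eventually_mem_or_notMem_of_pointsOut (pointsOut_cell hF hp) ?_
  have honly : ∀ᶠ x in 𝓝 p, ∀ F', x ∈ closure (M.face F') → F' = F := by
    refine eventually_all.2 fun F' => ?_
    by_cases hF' : p ∈ closure (M.face F')
    · exact .of_forall fun _ _ => eq_of_mem_closure_face hp hF'
    · filter_upwards [isClosed_closure.isOpen_compl.mem_nhds hF'] with x hx h using absurd h hx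
  filter_upwards [honly] with x hx hxT
  obtain ⟨F', -, hxF'⟩ := exists_face_of_mem_frontier hxT
  rw [real_inner_smul_left, inner_normal_sub_eq_zero (hx F' hxF' ▸ hxF') (subset_closure hp),
    mul_zero]

/-- The unit vector orthogonal to the edge `E`, in the plane of the face `F`, that points into
`F`. -/
def inward (M : PolyMesh) (F : Fin M.nF) (E : Fin M.nE) : E3 := -(M.oFE F E • M.normalFE F E)

lemma oFE_mul_self (F : Fin M.nF) (E : Fin M.nE) : M.oFE F E * M.oFE F E = 1 := by
  rcases oFE_eq F E with h | h <;> simp [h]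

lemma norm_inward {F : Fin M.nF} {E : Fin M.nE} (hE : E ∈ M.edgesF F) : ‖M.inward F E‖ = 1 := by
  rw [inward, norm_neg, norm_smul, normalFE, norm_cross_eq_one (M.normal_unit F)
    (norm_tangent E) (inner_normal_tangent hE)]
  rcases oFE_eq F E with h | h <;> simp [h]

lemma inner_tangent_inward (F : Fin M.nF) (E : Fin M.nE) :
    inner ℝ (M.tangent E) (M.inward F E) = 0 := by
  rw [inward, inner_neg_right, inner_smul_right, normalFE, inner_cross_self_right, mul_zero,
    neg_zero]

lemma normal_eq_cross_inward {F : Fin M.nF} {E : Fin M.nE} (hE : E ∈ M.edgesF F) :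
    M.normal F = (-M.oFE F E) • cross (M.tangent E) (M.inward F E) := by
  rw [inward, ← neg_smul, cross_smul_right, smul_smul, neg_mul_neg, oFE_mul_self, one_smul,
    normalFE, cross_cross_right, real_inner_self_eq_norm_sq, norm_tangent,
    real_inner_comm (M.normal F), inner_normal_tangent hE]
  module

lemma eventually_add_smul_inward_mem_face {F : Fin M.nF} {E : Fin M.nE} (hE : E ∈ M.edgesF F)
    {x : E3} (hx : x ∈ M.edge E) : ∀ᶠ s : ℝ in 𝓝[>] 0,
      x + s • M.inward F E ∈ M.face F ∧ x - s • M.inward F E ∉ M.face F := by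
  simpa only [inward, smul_neg, sub_neg_eq_add, ← sub_eq_add_neg] using
    (pointsOut_face hE hx).eventually

lemma inward_injOn (E : Fin M.nE) : Set.InjOn (M.inward · E) {F | E ∈ M.edgesF F} := by
  intro F hE F' hE' h
  obtain ⟨x, hx⟩ := nonempty_edge E
  obtain ⟨s, hs, hs'⟩ := ((eventually_add_smul_inward_mem_face hE hx).and
    (eventually_add_smul_inward_mem_face hE' hx)).exists
  rw [← show M.inward F E = M.inward F' E from h] at hs'
  exact eq_of_mem_face hs.1 hs'.1

end PolyMesh

lemma eventually_indicator_one_eq_of_notMem_frontier {X : Type*} [TopologicalSpace X] {s : Set X}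
    {x : X} (hx : x ∉ frontier s) :
    ∀ᶠ y in 𝓝 x, s.indicator (1 : X → ℝ) y = s.indicator 1 x := by
  rw [← Set.mem_compl_iff, compl_frontier_eq_union_interior] at hx
  rcases hx with hx | hx <;> filter_upwards [isOpen_interior.mem_nhds hx] with y hy
  · simp [interior_subset hx, interior_subset hy]
  · have hx' := interior_subset hx
    have hy' := interior_subset hy
    simp_all

namespace PolyMesh

variable {M : PolyMesh}

lemma eq_inward_or_eq_neg_inward {F : Fin M.nF} {E : Fin M.nE} (hE : E ∈ M.edgesF F) {d : E3}
    (hd : ‖d‖ = 1) (htd : inner ℝ (M.tangent E) d = 0) (hnd : inner ℝ (M.normal F) d = 0) :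
    d = M.inward F E ∨ d = -M.inward F E := by
  have ho : -M.oFE F E ≠ 0 := neg_ne_zero.2 fun h => by simpa [h] using oFE_mul_self F E
  rw [normal_eq_cross_inward hE, real_inner_smul_left, mul_eq_zero, or_iff_right ho] at hnd
  have hframe := eq_add_smul_cross (norm_tangent E) (norm_inward hE) (inner_tangent_inward F E) htd
  rw [hnd, zero_smul, add_zero] at hframe
  have habs := congrArg norm hframe
  rw [hd, norm_smul, norm_inward hE, mul_one, eq_comm, Real.norm_eq_abs,
    abs_eq zero_le_one] at habs
  rcases habs with h | h <;> rw [h] at hframe <;> simp [hframe]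

lemma eventually_add_smul_notMem_closure_edge {E : Fin M.nE} {x : E3} (hx : x ∈ M.edge E) :
    ∀ᶠ ρ : ℝ in 𝓝[>] 0, ∀ E' d, ‖d‖ = 1 → inner ℝ (M.tangent E) d = 0 →
      x + ρ • d ∉ closure (M.edge E') := by
  refine eventually_all.2 fun E' => ?_
  by_cases hE' : x ∈ closure (M.edge E')
  · obtain rfl := eq_of_mem_closure_edge hx hE'
    filter_upwards [self_mem_nhdsWithin] with ρ hρ d hd htd hmem
    obtain ⟨c, hc⟩ := exists_sub_eq_smul_tangent hE' hmem
    rw [add_sub_cancel_left] at hc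
    have hc0 := congrArg (inner ℝ (M.tangent E')) hc
    rw [real_inner_smul_right, real_inner_smul_right, htd, mul_zero, real_inner_self_eq_norm_sq,
      norm_tangent, one_pow, mul_one] at hc0
    rw [← hc0, zero_smul, smul_eq_zero, or_iff_right (ne_of_gt hρ)] at hc
    exact norm_ne_zero_iff.1 (hd.trans_ne one_ne_zero) hc
  · filter_upwards [eventually_forall_unit_add_smul_notMem isClosed_closure hE'] with ρ hρ d hd _
      using hρ d hd

/-- `ρ` is so small that the circle of radius `ρ` about the point `x` of the edge `E`, in the plane
orthogonal to `E`, meets a face of the mesh only if `E` is one of its edges, and then exactly in the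
inward direction. -/
def IsLinkRadius (M : PolyMesh) (E : Fin M.nE) (x : E3) (ρ : ℝ) : Prop :=
  0 < ρ ∧ ∀ F,
    (∀ d, ‖d‖ = 1 → inner ℝ (M.tangent E) d = 0 → x + ρ • d ∈ closure (M.face F) →
      E ∈ M.edgesF F ∧ d = M.inward F E) ∧
    (E ∈ M.edgesF F → x + ρ • M.inward F E ∈ M.face F)

lemma exists_isLinkRadius {E : Fin M.nE} {x : E3} (hx : x ∈ M.edge E) :
    ∃ ρ, M.IsLinkRadius E x ρ := by
  suffices h : ∀ᶠ ρ in 𝓝[>] 0, M.IsLinkRadius E x ρ from h.exists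
  refine Eventually.and self_mem_nhdsWithin (eventually_all.2 fun F => ?_)
  by_cases hE : E ∈ M.edgesF F
  · filter_upwards [eventually_add_smul_inward_mem_face hE hx,
      eventually_add_smul_notMem_closure_edge hx, self_mem_nhdsWithin] with ρ hface hedge hρ
    refine ⟨fun d hd htd hmem => ⟨hE, ?_⟩, fun _ => hface.1⟩
    have hnd := inner_normal_sub_eq_zero hmem ((mem_edgesF.1 hE) hx).1
    rw [add_sub_cancel_left, real_inner_smul_right, mul_eq_zero, or_iff_right (ne_of_gt hρ)] at hnd
    refine (eq_inward_or_eq_neg_inward hE hd htd hnd).resolve_right fun hneg => ?_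
    obtain ⟨E', -, hE'⟩ := exists_edge_of_mem_closure_face hmem
      (by rw [hneg, smul_neg, ← sub_eq_add_neg]; exact hface.2)
    exact hedge E' d hd htd hE'
  · filter_upwards [eventually_forall_unit_add_smul_notMem isClosed_closure
      fun h => hE (mem_edgesF_of_mem_closure_face hx h)] with ρ hρ
    exact ⟨fun d hd _ hmem => absurd hmem (hρ d hd), fun h => absurd h hE⟩

lemma oTF_mul_oFE_eq (T : Fin M.nT) (F : Fin M.nF) (E : Fin M.nE) :
    M.oTF T F * M.oFE F E = 1 ∨ M.oTF T F * M.oFE F E = -1 := by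
  rcases oTF_eq T F with hT | hT <;> rcases oFE_eq F E with hFE | hFE <;> simp [hT, hFE]

section Link

variable {T : Fin M.nT} {E : Fin M.nE} {x u : E3} {ρ : ℝ}

lemma IsLinkRadius.exists_eq_inward (h : M.IsLinkRadius E x ρ) {d : E3} (hd : ‖d‖ = 1)
    (htd : inner ℝ (M.tangent E) d = 0) (hmem : x + ρ • d ∈ frontier (M.cell T)) :
    ∃ F ∈ M.facesT T, E ∈ M.edgesF F ∧ d = M.inward F E := by
  obtain ⟨F, hF, hcl⟩ := exists_face_of_mem_frontier hmem
  exact ⟨F, hF, (h.2 F).1 d hd htd hcl⟩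

/-- Turning about `E` in the positive direction, one enters `T` through `F` if and only if
`ω_TF ω_FE = 1`. -/
lemma IsLinkRadius.eventually_mem_cell_iff (h : M.IsLinkRadius E x ρ) {F : Fin M.nF}
    (hF : F ∈ M.facesT T) (hE : E ∈ M.edgesF F) (hu : ‖u‖ = 1)
    (htu : inner ℝ (M.tangent E) u = 0) {θ : ℝ} (hθ : rotAbout (M.tangent E) u θ = M.inward F E) :
    ∀ᶠ φ in 𝓝 θ,
      (Real.sin (φ - θ) < 0 → (x + ρ • rotAbout (M.tangent E) u φ ∈ M.cell T ↔
        M.oTF T F * M.oFE F E = -1)) ∧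
      (0 < Real.sin (φ - θ) → (x + ρ • rotAbout (M.tangent E) u φ ∈ M.cell T ↔
        M.oTF T F * M.oFE F E = 1)) := by
  have hcont : Continuous fun φ => x + ρ • rotAbout (M.tangent E) u φ :=
    continuous_const.add (continuous_rotAbout.const_smul ρ)
  have hp := hθ ▸ (h.2 F).2 hE
  filter_upwards [hcont.continuousAt.eventually (eventually_mem_or_notMem_cell hF hp)] with φ hφ
  have hinner : inner ℝ (M.oTF T F • M.normal F) (x + ρ • rotAbout (M.tangent E) u φ -
      (x + ρ • rotAbout (M.tangent E) u θ)) =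
      -(M.oTF T F * M.oFE F E) * (ρ * Real.sin (φ - θ)) := by
    rw [add_sub_add_left_eq_sub, normal_eq_cross_inward hE, ← hθ, ← smul_sub,
      real_inner_smul_left, real_inner_smul_left, real_inner_smul_right, real_inner_comm,
      inner_sub_left, inner_rotAbout_cross_rotAbout (norm_tangent E) hu htu,
      inner_rotAbout_cross_rotAbout (norm_tangent E) hu htu, sub_self, Real.sin_zero]
    ring
  rw [hinner] at hφ
  have hρ (hsin : Real.sin (φ - θ) < 0) : ρ * Real.sin (φ - θ) < 0 := mul_neg_of_pos_of_neg h.1 hsin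
  have hρ' (hsin : 0 < Real.sin (φ - θ)) : 0 < ρ * Real.sin (φ - θ) := mul_pos h.1 hsin
  rcases oTF_mul_oFE_eq T F E with hs | hs <;> rw [hs] at hφ ⊢ <;> norm_num at hφ ⊢
  · exact ⟨fun hsin => hφ.2 (hρ hsin), fun hsin => hφ.1 (hρ' hsin)⟩
  · exact ⟨fun hsin => hφ.1 (hρ hsin), fun hsin => hφ.2 (hρ' hsin)⟩

lemma IsLinkRadius.eventually_indicator_eq_of_eq_inward (h : M.IsLinkRadius E x ρ) {F : Fin M.nF}
    (hF : F ∈ M.facesT T) (hE : E ∈ M.edgesF F) (hu : ‖u‖ = 1)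
    (htu : inner ℝ (M.tangent E) u = 0) {θ : ℝ} (hθ : rotAbout (M.tangent E) u θ = M.inward F E) :
    (∀ᶠ φ in 𝓝[<] θ, (M.cell T).indicator 1 (x + ρ • rotAbout (M.tangent E) u φ) =
      (1 - M.oTF T F * M.oFE F E) / 2) ∧
    ∀ᶠ φ in 𝓝[>] θ, (M.cell T).indicator 1 (x + ρ • rotAbout (M.tangent E) u φ) =
      (1 + M.oTF T F * M.oFE F E) / 2 := by
  classical
  have hside := h.eventually_mem_cell_iff hF hE hu htu hθ
  constructor
  · filter_upwards [hside.filter_mono nhdsWithin_le_nhds,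
      Ioo_mem_nhdsLT (show θ - Real.pi < θ by linarith [Real.pi_pos])] with φ hφ hφθ
    have hsin := Real.sin_neg_of_neg_of_neg_pi_lt (sub_neg.2 hφθ.2) (by linarith [hφθ.1])
    rw [Set.indicator_apply, hφ.1 hsin]
    rcases oTF_mul_oFE_eq T F E with hs | hs <;> norm_num [hs]
  · filter_upwards [hside.filter_mono nhdsWithin_le_nhds,
      Ioo_mem_nhdsGT (show θ < θ + Real.pi by linarith [Real.pi_pos])] with φ hφ hφθ
    have hsin := Real.sin_pos_of_pos_of_lt_pi (sub_pos.2 hφθ.1) (by linarith [hφθ.2])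
    rw [Set.indicator_apply, hφ.2 hsin]
    rcases oTF_mul_oFE_eq T F E with hs | hs <;> norm_num [hs]

lemma IsLinkRadius.eventually_indicator_eq_of_ne_inward (h : M.IsLinkRadius E x ρ) (hu : ‖u‖ = 1)
    (htu : inner ℝ (M.tangent E) u = 0) {θ : ℝ}
    (hθ : ∀ F ∈ M.facesT T, E ∈ M.edgesF F → rotAbout (M.tangent E) u θ ≠ M.inward F E) :
    ∀ᶠ φ in 𝓝 θ, (M.cell T).indicator (1 : E3 → ℝ) (x + ρ • rotAbout (M.tangent E) u φ) =
      (M.cell T).indicator 1 (x + ρ • rotAbout (M.tangent E) u θ) := by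
  have hfr : x + ρ • rotAbout (M.tangent E) u θ ∉ frontier (M.cell T) := fun hmem => by
    obtain ⟨F, hF, hE, heq⟩ := h.exists_eq_inward (norm_rotAbout (norm_tangent E) hu htu θ)
      (inner_rotAbout htu θ) hmem
    exact hθ F hF hE heq
  have hcont : Continuous fun φ => x + ρ • rotAbout (M.tangent E) u φ :=
    continuous_const.add (continuous_rotAbout.const_smul ρ)
  exact hcont.continuousAt.eventually
    (eventually_indicator_one_eq_of_notMem_frontier hfr)

lemma IsLinkRadius.exists_eventually_indicator_eq (h : M.IsLinkRadius E x ρ) (T : Fin M.nT)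
    (hu : ‖u‖ = 1) (htu : inner ℝ (M.tangent E) u = 0) (θ : ℝ) : ∃ l r : ℝ,
      (∀ᶠ φ in 𝓝[<] θ, (M.cell T).indicator 1 (x + ρ • rotAbout (M.tangent E) u φ) = l) ∧
      (∀ᶠ φ in 𝓝[>] θ, (M.cell T).indicator 1 (x + ρ • rotAbout (M.tangent E) u φ) = r) ∧
      (∀ F ∈ M.facesT T, E ∈ M.edgesF F → rotAbout (M.tangent E) u θ = M.inward F E →
        r - l = M.oTF T F * M.oFE F E) ∧
      ((∀ F ∈ M.facesT T, E ∈ M.edgesF F → rotAbout (M.tangent E) u θ ≠ M.inward F E) →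
        l = r) := by
  by_cases hθ : ∃ F ∈ M.facesT T, E ∈ M.edgesF F ∧ rotAbout (M.tangent E) u θ = M.inward F E
  · obtain ⟨F, hF, hE, hFθ⟩ := hθ
    obtain ⟨hl, hr⟩ := h.eventually_indicator_eq_of_eq_inward hF hE hu htu hFθ
    refine ⟨_, _, hl, hr, fun F' _ hE' hFθ' => ?_, fun hne => absurd hFθ (hne F hF hE)⟩
    obtain rfl : F = F' := inward_injOn E hE hE' (hFθ.symm.trans hFθ')
    ring
  · push Not at hθ
    have hconst := h.eventually_indicator_eq_of_ne_inward hu htu hθ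
    exact ⟨_, _, hconst.filter_mono nhdsWithin_le_nhds, hconst.filter_mono nhdsWithin_le_nhds,
      fun F hF hE heq => absurd heq (hθ F hF hE), fun _ => rfl⟩

end Link

/-- The indicator of `T` along a small circle around `E` is periodic, and jumps by `ω_TF ω_FE` where
the circle crosses the face `F`. -/
theorem sum_oTF_mul_oFE (T : Fin M.nT) (E : Fin M.nE) :
    ∑ F ∈ M.facesT T with E ∈ M.edgesF F, M.oTF T F * M.oFE F E = 0 := by
  classical
  obtain ⟨F₀, hF₀⟩ := M.edge_used E
  have hu := norm_inward (mem_edgesF.2 hF₀)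
  have htu := inner_tangent_inward F₀ E
  obtain ⟨x, hx⟩ := nonempty_edge E
  obtain ⟨ρ, hρ⟩ := exists_isLinkRadius hx
  choose l r hl hr hjump hcont using hρ.exists_eventually_indicator_eq T hu htu
  have hangle (F : Fin M.nF) (hE : E ∈ M.edgesF F) :
      ∃ α ∈ Set.Ioc (-Real.pi) Real.pi, rotAbout (M.tangent E) (M.inward F₀ E) α = M.inward F E :=
    exists_eq_rotAbout (norm_tangent E) hu htu (norm_inward hE) (inner_tangent_inward F E)
  choose! α hαmem hα using hangle
  have hinj : Set.InjOn α {F | E ∈ M.edgesF F} := fun F hF F' hF' heq =>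
    inward_injOn E hF hF' ((hα F hF).symm.trans (heq ▸ hα F' hF'))
  set S := {F ∈ M.facesT T | E ∈ M.edgesF F}
  have hSE (F : Fin M.nF) (hF : F ∈ S) : E ∈ M.edgesF F := (Finset.mem_filter.1 hF).2
  have hIoc : Set.Ioc (-Real.pi) (-Real.pi + 2 * Real.pi) = Set.Ioc (-Real.pi) Real.pi := by
    ring_nf
  have hsum : ∑ θ ∈ S.image α, (r θ - l θ) = 0 := by
    refine sum_jumps_eq_zero_of_periodic (a := -Real.pi) Real.two_pi_pos.le
      (periodic_rotAbout.comp fun d => (M.cell T).indicator 1 (x + ρ • d)) hl hr ?_ ?_ <;>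
      rw [hIoc]
    · exact fun θ hθ => by
        obtain ⟨F, hF, rfl⟩ := Finset.mem_image.1 hθ
        exact hαmem F (hSE F hF)
    · refine fun θ hθ hθK => hcont θ fun F hF hE heq => hθK ?_
      refine Finset.mem_image.2 ⟨F, Finset.mem_filter.2 ⟨hF, hE⟩, ?_⟩
      exact injOn_rotAbout (norm_tangent E) hu htu (hαmem F hE) hθ ((hα F hE).trans heq.symm)
  rw [← hsum, Finset.sum_image (hinj.mono fun F hF => hSE F hF)]
  exact Finset.sum_congr rfl fun F hF =>
    (hjump _ F (Finset.mem_filter.1 hF).1 (hSE F hF) (hα F (hSE F hF))).symm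

lemma sum_oTF_mul_sum_oFE (T : Fin M.nT) (a : Fin M.nE → ℝ) :
    ∑ F ∈ M.facesT T, M.oTF T F * ∑ E ∈ M.edgesF F, M.oFE F E * a E = 0 := by
  classical
  calc ∑ F ∈ M.facesT T, M.oTF T F * ∑ E ∈ M.edgesF F, M.oFE F E * a E
      = ∑ F ∈ M.facesT T, ∑ E with E ∈ M.edgesF F, M.oTF T F * M.oFE F E * a E := by
        simp only [Finset.mul_sum, mul_assoc, Finset.filter_univ_mem]
    _ = ∑ E, (∑ F ∈ M.facesT T with E ∈ M.edgesF F, M.oTF T F * M.oFE F E) * a E := by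
        simp only [Finset.sum_filter, Finset.sum_mul, ite_mul, zero_mul]
        exact Finset.sum_comm
    _ = 0 := by simp only [sum_oTF_mul_oFE, zero_mul, Finset.sum_const_zero]

end PolyMesh

/-! ## Spaces defined by `L²`-relations -/

section L2Relations

variable {X G : Type*} [MeasurableSpace X] [Bornology X] [NormedAddCommGroup G]

/-- Linear subspaces of the space of locally bounded functions. As a class, it lets spaces of
restricted polynomials inherit the integral products of `LocBdd`. -/
class LocBddSub [NormedSpace ℝ G] (V : Submodule ℝ (X → G)) : Prop where
  le : V ≤ LocBdd X G

/-- The inclusion of a space of locally bounded functions in the space of all of them. -/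
def toLB [NormedSpace ℝ G] {V : Submodule ℝ (X → G)} [LocBddSub V] : V →ₗ[ℝ] LocBdd X G :=
  Submodule.inclusion LocBddSub.le

variable [InnerProductSpace ℝ G] {V : Submodule ℝ (X → G)} [LocBddSub V] {P Y : Type*}
  [AddCommGroup P] [Module ℝ P] [AddCommGroup Y] [Module ℝ Y]

/-- `f y` is the unique element of `V` satisfying the relations `∫ f y · t p = R y p` for all tests
`p ∈ W`, and this linear system is compatible: up to null sets `t` maps `W` to `V`, and `R y`
vanishes on the kernel of `t`. All reconstructions of the scheme are of this form. -/
structure IsL2Reconstruction (m : Measure X) [BoundedSupport m] (W : Submodule ℝ P)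
    (t : P →ₗ[ℝ] LocBdd X G) (R : Y →ₗ[ℝ] P →ₗ[ℝ] ℝ) (f : Y → V) : Prop where
  eq_theUnique : ∀ y, f y = theUnique fun u => ∀ p ∈ W, l2Inner m (toLB u) (t p) = R y p
  exists_ae_eq : ∀ p ∈ W, ∃ u : V, u.1 =ᵐ[m] (t p).1
  rhs_eq_zero : ∀ p ∈ W, (t p).1 =ᵐ[m] 0 → ∀ y, R y p = 0

namespace IsL2Reconstruction

variable {m : Measure X} [BoundedSupport m] {W : Submodule ℝ P} {t : P →ₗ[ℝ] LocBdd X G}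
  {R : Y →ₗ[ℝ] P →ₗ[ℝ] ℝ} {f : Y → V}

lemma rhs_eq_zero_of_forall (hf : IsL2Reconstruction m W t R f) (p : W)
    (hp : ∀ u : V, l2Inner m (toLB u) (t p) = 0) (y : Y) : R y p = 0 := by
  obtain ⟨u, hu⟩ := hf.exists_ae_eq p p.2
  exact hf.rhs_eq_zero p p.2
    (ae_eq_zero_of_l2Inner_self ((l2Inner_congr_ae hu.symm .rfl).trans (hp u))) y

lemma forall_l2Inner_eq_iff (R : Y →ₗ[ℝ] P →ₗ[ℝ] ℝ) (y : Y) (u : V) :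
    (∀ p ∈ W, l2Inner m (toLB u) (t p) = R y p) ↔
      (l2Inner m).compl₁₂ (toLB (V := V)) (t ∘ₗ W.subtype) u = R.compl₂ W.subtype y := by
  simp [LinearMap.ext_iff]

lemma isLinearMap [FiniteDimensional ℝ V] (hf : IsL2Reconstruction m W t R f) :
    IsLinearMap ℝ f := by
  rw [funext hf.eq_theUnique]
  exact isLinearMap_theUnique (β := (l2Inner m).compl₁₂ (toLB (V := V)) (t ∘ₗ W.subtype))
    (R := R.compl₂ W.subtype) hf.rhs_eq_zero_of_forall (forall_l2Inner_eq_iff R)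

lemma eq_zero_of_forall_l2Inner_eq_zero (hV : ∀ u : V, u.1 =ᵐ[m] 0 → u = 0)
    (ht : ∀ u : V, ∃ p ∈ W, u.1 =ᵐ[m] (t p).1) {u : V}
    (hu : ∀ p ∈ W, l2Inner m (toLB u) (t p) = 0) : u = 0 := by
  obtain ⟨p, hp, hup⟩ := ht u
  exact hV u (ae_eq_zero_of_l2Inner_self (f := toLB u)
    ((l2Inner_congr_ae .rfl hup).trans (hu p hp)))

lemma l2Inner_eq [FiniteDimensional ℝ V] (hf : IsL2Reconstruction m W t R f)
    (hV : ∀ u : V, u.1 =ᵐ[m] 0 → u = 0) (ht : ∀ u : V, ∃ p ∈ W, u.1 =ᵐ[m] (t p).1) (y : Y) {p : P}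
    (hp : p ∈ W) : l2Inner m (toLB (f y)) (t p) = R y p := by
  rw [hf.eq_theUnique]
  exact LinearMap.congr_fun (theUnique_spec_of_linear
    (β := (l2Inner m).compl₁₂ (toLB (V := V)) (t ∘ₗ W.subtype)) (R := R.compl₂ W.subtype)
    (fun u hu => eq_zero_of_forall_l2Inner_eq_zero hV ht fun p hp =>
      LinearMap.congr_fun hu ⟨p, hp⟩)
    hf.rhs_eq_zero_of_forall (forall_l2Inner_eq_iff R) y) ⟨p, hp⟩

lemma eq_of_forall_l2Inner_eq [FiniteDimensional ℝ V] (hf : IsL2Reconstruction m W t R f)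
    (hV : ∀ u : V, u.1 =ᵐ[m] 0 → u = 0) (ht : ∀ u : V, ∃ p ∈ W, u.1 =ᵐ[m] (t p).1) {y : Y} {u : V}
    (hu : ∀ p ∈ W, l2Inner m (toLB u) (t p) = R y p) : f y = u := by
  refine sub_eq_zero.1 (eq_zero_of_forall_l2Inner_eq_zero hV ht fun p hp => ?_)
  rw [map_sub, map_sub, LinearMap.sub_apply, hf.l2Inner_eq hV ht y hp, hu p hp, sub_self]

end IsL2Reconstruction

end L2Relations

section Projection

variable {G : Type*} [NormedAddCommGroup G] [InnerProductSpace ℝ G] (m : Measure E3)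
  [BoundedSupport m] (V : Submodule ℝ (E3 → G)) [LocBddSub V]

lemma isL2Reconstruction_l2proj : IsL2Reconstruction m ⊤ (toLB (V := V))
    ((l2Inner m).compl₂ toLB) fun f : LocBdd E3 G => l2proj m V f.1 where
  eq_theUnique _ := congrArg theUnique <| funext fun _ => propext
    ⟨fun h p _ => h p, fun h p => h p trivial⟩
  exists_ae_eq p _ := ⟨p, .rfl⟩
  rhs_eq_zero _ _ hp f := l2Inner_eq_zero_of_ae_right f hp

variable [FiniteDimensional ℝ V]

/-- The `L²(m)`-orthogonal projection on `V` as a linear map. -/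
def l2projL : LocBdd E3 G →ₗ[ℝ] V := (isL2Reconstruction_l2proj m V).isLinearMap.mk'

variable {m V}

lemma l2proj_eq_l2projL (f : LocBdd E3 G) : l2proj m V f.1 = l2projL m V f := rfl

lemma l2Inner_l2projL (hV : ∀ u : V, u.1 =ᵐ[m] 0 → u = 0) (f : LocBdd E3 G) (w : V) :
    l2Inner m (toLB (l2projL m V f)) (toLB w) = l2Inner m f (toLB w) :=
  (isL2Reconstruction_l2proj m V).l2Inner_eq hV (fun u => ⟨u, trivial, .rfl⟩) f trivial

end Projection

/-! ## Restrictions of polynomials -/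

section Restriction

variable {P : Set E3} {x : E3}

lemma restrS_apply (p : Poly3) (hx : x ∈ closure P) : restrS P p x = evalS p x :=
  Set.indicator_of_mem hx _

lemma restrV_apply (w : VPoly3) (hx : x ∈ closure P) : restrV P w x = evalV w x :=
  Set.indicator_of_mem hx _

lemma restrS_eq_zero {p : Poly3} (h : Set.EqOn (evalS p) 0 (closure P)) : restrS P p = 0 :=
  Set.indicator_eq_zero.2 (Set.disjoint_left.2 fun _ hx hxP => hx (h hxP))

lemma restrV_eq_zero {w : VPoly3} (h : Set.EqOn (evalV w) 0 (closure P)) : restrV P w = 0 :=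
  Set.indicator_eq_zero.2 (Set.disjoint_left.2 fun _ hx hxP => hx (h hxP))

lemma restrV_mem_locBdd (P : Set E3) (w : VPoly3) : restrV P w ∈ LocBdd E3 E3 :=
  indicator_mem_locBdd (evV w).2 isClosed_closure.measurableSet

lemma locBddSub_map_restrV (P : Set E3) {Y : Type*} [AddCommGroup Y] [Module ℝ Y]
    (f : Y →ₗ[ℝ] VPoly3) (W : Submodule ℝ Y) : LocBddSub (W.map (restrV P ∘ₗ f)) where
  le := by
    rintro _ ⟨y, -, rfl⟩
    exact restrV_mem_locBdd P (f y)

variable (P) (n : E3) (l : ℤ)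

lemma polTan_le_polV : PolTan P n l ≤ PolV P l := fun _ hf => hf.1

instance : LocBddSub (PolS P l) where
  le := by
    rintro _ ⟨p, -, rfl⟩
    exact indicator_mem_locBdd (evS p).2 isClosed_closure.measurableSet

instance : LocBddSub (PolV P l) where
  le := by
    rintro _ ⟨w, -, rfl⟩
    exact restrV_mem_locBdd P w

instance : LocBddSub (PolTan P n l) where
  le := (polTan_le_polV P n l).trans LocBddSub.le

instance : FiniteDimensional ℝ (PolS P l) :=
  inferInstanceAs (FiniteDimensional ℝ ((Pol l).map (restrS P)))

instance : FiniteDimensional ℝ (PolV P l) :=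
  inferInstanceAs (FiniteDimensional ℝ ((VPol l).map (restrV P)))

instance : FiniteDimensional ℝ (PolTan P n l) :=
  Submodule.finiteDimensional_of_le (polTan_le_polV P n l)

end Restriction

namespace PolyMesh

variable {M : PolyMesh} {F : Fin M.nF} {T : Fin M.nT} {l : ℤ}

instance : LocBddSub (M.vPolF F l) := inferInstanceAs (LocBddSub (PolTan _ _ _))
instance : LocBddSub (M.RF F l) := locBddSub_map_restrV _ _ _
instance : LocBddSub (M.RcF F l) := locBddSub_map_restrV _ _ _
instance : LocBddSub (M.RT T l) := locBddSub_map_restrV _ _ _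
instance : LocBddSub (M.RcT T l) := locBddSub_map_restrV _ _ _
instance : LocBddSub (M.GT T l) := locBddSub_map_restrV _ _ _
instance : LocBddSub (M.GcT T l) := locBddSub_map_restrV _ _ _

instance : FiniteDimensional ℝ (M.vPolF F l) :=
  inferInstanceAs (FiniteDimensional ℝ (PolTan _ _ _))

instance : FiniteDimensional ℝ (M.GT T l) :=
  inferInstanceAs (FiniteDimensional ℝ ((Pol (l + 1)).map (restrV (M.cell T) ∘ₗ gradP)))

instance : FiniteDimensional ℝ (M.GcT T l) :=
  inferInstanceAs
    (FiniteDimensional ℝ ((VPol (l - 1)).map (restrV (M.cell T) ∘ₗ crossPos (M.cellPt T))))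

lemma restrS_ae_eq_mT (p : Poly3) : restrS (M.cell T) p =ᵐ[M.mT T] evalS p :=
  ae_mT fun _ hx => restrS_apply p hx

lemma restrV_ae_eq_mT (w : VPoly3) : restrV (M.cell T) w =ᵐ[M.mT T] evalV w :=
  ae_mT fun _ hx => restrV_apply w hx

lemma restrS_ae_eq_mF (p : Poly3) : restrS (M.face F) p =ᵐ[M.mF F] evalS p :=
  ae_mF fun _ hx => restrS_apply p hx

lemma restrV_ae_eq_mF (w : VPoly3) : restrV (M.face F) w =ᵐ[M.mF F] evalV w :=
  ae_mF fun _ hx => restrV_apply w hx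

lemma eq_zero_of_evalS_ae_eq_zero {p : Poly3} (h : evalS p =ᵐ[M.mT T] 0) : p = 0 :=
  eq_zero_of_evalS_eq_zero (M.cell_open T) ⟨_, M.cellPt_mem T⟩ fun _ hx =>
    eqOn_zero_closure_cell (continuous_evalS p) h (subset_closure hx)

lemma eq_zero_of_evalV_ae_eq_zero {w : VPoly3} (h : evalV w =ᵐ[M.mT T] 0) : w = 0 :=
  eq_zero_of_evalV_eq_zero (M.cell_open T) ⟨_, M.cellPt_mem T⟩ fun _ hx =>
    eqOn_zero_closure_cell (continuous_evalV w) h (subset_closure hx)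

lemma eq_zero_of_mem_polS_cell {f : E3 → ℝ} (hf : f ∈ PolS (M.cell T) l)
    (h : f =ᵐ[M.mT T] 0) : f = 0 := by
  obtain ⟨p, -, rfl⟩ := hf
  rw [eq_zero_of_evalS_ae_eq_zero ((restrS_ae_eq_mT p).symm.trans h), map_zero]

lemma eq_zero_of_mem_polV_cell {f : E3 → E3} (hf : f ∈ PolV (M.cell T) l)
    (h : f =ᵐ[M.mT T] 0) : f = 0 := by
  obtain ⟨w, -, rfl⟩ := hf
  rw [eq_zero_of_evalV_ae_eq_zero ((restrV_ae_eq_mT w).symm.trans h), map_zero]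

lemma eq_zero_of_mem_polS_face {f : E3 → ℝ} (hf : f ∈ PolS (M.face F) l)
    (h : f =ᵐ[M.mF F] 0) : f = 0 := by
  obtain ⟨p, -, rfl⟩ := hf
  exact restrS_eq_zero (eqOn_zero_closure_face (continuous_evalS p)
    ((restrS_ae_eq_mF p).symm.trans h))

lemma eq_zero_of_mem_vPolF {f : E3 → E3} (hf : f ∈ M.vPolF F l) (h : f =ᵐ[M.mF F] 0) :
    f = 0 := by
  obtain ⟨⟨w, -, rfl⟩, -⟩ := hf
  exact restrV_eq_zero (eqOn_zero_closure_face (continuous_evalV w)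
    ((restrV_ae_eq_mF w).symm.trans h))

lemma gT_le_polV : M.GT T l ≤ PolV (M.cell T) l := by
  rintro _ ⟨p, hp, rfl⟩
  exact ⟨gradP p, by simpa using gradP_mem_vPol hp, rfl⟩

lemma gcT_le_polV : M.GcT T l ≤ PolV (M.cell T) l := by
  rintro _ ⟨z, hz, rfl⟩
  exact ⟨crossPos (M.cellPt T) z, by simpa using crossPos_mem_vPol _ hz, rfl⟩

end PolyMesh

section MeanValue

variable (m : Measure E3) [BoundedSupport m] {l : ℤ}

/-- The polynomials of degree at most `l` with zero mean value for `m`. -/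
def PolZero (l : ℤ) : Submodule ℝ Poly3 := Pol l ⊓ LinearMap.ker (integralL m ∘ₗ evS)

lemma exists_sub_C_mem_polZero [NeZero m] (hl : 0 ≤ l) {r : Poly3} (hr : r ∈ Pol l) :
    ∃ a : ℝ, r - C a ∈ PolZero m l := by
  have hC (a : ℝ) : integralL m (evS (C a)) = m.real Set.univ * a := by
    simp [integralL, evS, evalS]
  refine ⟨(m.real Set.univ)⁻¹ * integralL m (evS r),
    sub_mem hr (pol_mono hl (C_mem_pol _)), ?_⟩
  rw [SetLike.mem_coe, LinearMap.mem_ker, map_sub, LinearMap.comp_apply, LinearMap.comp_apply, hC,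
    mul_inv_cancel_left₀ measureReal_univ_ne_zero, sub_self]

end MeanValue

lemma gradP_C (a : ℝ) : gradP (C a) = 0 := by
  ext1 i
  simp [gradP]

lemma rotP_C (n : E3) (a : ℝ) : rotP n (C a) = 0 := by
  simp [rotP, gradP_C]

/-- The cross product `w ↦ w × n` with a constant field. -/
def crossConst (n : E3) : VPoly3 →ₗ[ℝ] VPoly3 where
  toFun w := w ⨯₃ constV n
  map_add' p q := by simp
  map_smul' a p := by
    ext1 i; fin_cases i <;> simp [crossProduct]

lemma evalV_crossConst (n : E3) (w : VPoly3) (x : E3) :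
    evalV (crossConst n w) x = cross (evalV w x) n := by
  ext i
  fin_cases i <;> simp [evalV, crossConst, cross, crossProduct, constV]

namespace PolyMesh

variable {M : PolyMesh} {F : Fin M.nF} {l : ℤ}

lemma restrV_rotP_add_mulPos_mem_vPolF {r p : Poly3} (hr : r ∈ Pol (l + 1)) (hp : p ∈ Pol (l - 1)) :
    restrV (M.face F) (rotP (M.normal F) r + mulPos (M.facePt F) p) ∈ M.vPolF F l := by
  refine ⟨⟨_, add_mem (by simpa using rotP_mem_vPol _ hr) (by simpa using mulPos_mem_vPol _ hp),
    rfl⟩, fun x => ?_⟩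
  by_cases hx : x ∈ closure (M.face F)
  · have hrot : inner ℝ (evalV (rotP (M.normal F) r) x) (M.normal F) = 0 := by
      change inner ℝ (evalV (crossConst _ (gradP r)) x) _ = 0
      rw [evalV_crossConst, real_inner_comm, inner_cross_self_right]
    have hpos : evalV (mulPos (M.facePt F) p) x = evalS p x • (x - M.facePt F) := by
      ext i
      simp [evalV, evalS, mulPos, posV]
    have hx' : inner ℝ (x - M.facePt F) (M.normal F) = 0 := closure_face_subset_planeAt F hx
    rw [restrV_apply _ hx, evalV_add, inner_add_left, hrot, hpos, inner_smul_left, hx', mul_zero,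
      add_zero]
  · simp [restrV, hx]

lemma exists_tangential_eqOn {w : VPoly3} (hw : w ∈ VPol l)
    (hwn : ∀ x ∈ closure (M.face F), inner ℝ (evalV w x) (M.normal F) = 0) :
    ∃ w' ∈ VPol l, w' ⬝ᵥ constV (M.normal F) = 0 ∧
      Set.EqOn (evalV w') (evalV w) (closure (M.face F)) := by
  set n := M.normal F
  have hdot : w ⬝ᵥ constV n ∈ Pol l := by simpa using dotProduct_mem_pol hw (constV_mem_vPol n)
  refine ⟨w - fun i => C (n i) * (w ⬝ᵥ constV n),
    sub_mem hw (mem_vPol.2 fun i => C_mul_mem_pol _ hdot), ?_, fun x hx => ?_⟩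
  · have hn : (fun i => C (n i) * (w ⬝ᵥ constV n) : VPoly3) = (w ⬝ᵥ constV n) • constV n := by
      ext1 i
      exact mul_comm _ _
    rw [hn, sub_dotProduct, smul_dotProduct, constV_normal_dotProduct_self, smul_eq_mul, mul_one,
      sub_self]
  · have h0 : eval x.ofLp (w ⬝ᵥ constV n) = 0 :=
      (evalS_dotProduct w (constV n) x).trans (by rw [evalV_constV, hwn x hx])
    ext i
    simp [evalV, h0]

lemma exists_ae_eq_rotP_add_mulPos (hl : 0 ≤ l) {f : E3 → E3} (hf : f ∈ M.vPolF F l) :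
    ∃ r ∈ PolZero (M.mF F) (l + 1), ∃ p ∈ Pol (l - 1),
      f =ᵐ[M.mF F] evalV (rotP (M.normal F) r + mulPos (M.facePt F) p) := by
  obtain ⟨⟨w, hw, rfl⟩, hwn⟩ := hf
  obtain ⟨w', hw', hwn', hww'⟩ := exists_tangential_eqOn (F := F) hw fun x hx => by
    rw [← restrV_apply w hx, hwn]
  obtain ⟨r, hr, p, hp, hrp⟩ := exists_rotP_add_mulPos (M.facePt F) (M.normal_unit F) hw' hwn'
  obtain ⟨a, ha⟩ := exists_sub_C_mem_polZero (M.mF F) (by lia) hr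
  refine ⟨r - C a, ha, p, hp, ae_mF fun x hx => ?_⟩
  rw [map_sub, rotP_C, sub_zero, hrp x (closure_face_subset_planeAt F hx), restrV_apply w hx,
    hww' hx]

end PolyMesh

namespace Discretisation

variable {D : Discretisation}

/-- The component `v_F` of a vector of the curl space. -/
def curlCompF (F : Fin D.nF) : D.XCurl →ₗ[ℝ] D.RF F (D.k - 1) :=
  LinearMap.proj F ∘ₗ .fst ℝ _ _ ∘ₗ .snd ℝ _ _ ∘ₗ .snd ℝ _ _

/-- The component `v_E` of a vector of the curl space. -/
def curlCompE (E : Fin D.nE) : D.XCurl →ₗ[ℝ] PolS (D.edge E) D.k :=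
  LinearMap.proj E ∘ₗ .snd ℝ _ _ ∘ₗ .snd ℝ _ _ ∘ₗ .snd ℝ _ _ ∘ₗ .snd ℝ _ _

/-- The component `v_T` of a vector of the curl space. -/
def curlCompT (T : Fin D.nT) : D.XCurl →ₗ[ℝ] D.RT T (D.k - 1) :=
  LinearMap.proj T ∘ₗ .fst ℝ _ _

/-- The restriction of a vector of the curl space to a face, as a linear map. -/
def curlOnF (F : Fin D.nF) : D.XCurl →ₗ[ℝ] D.XCurlF F where
  toFun v := XCurl.onF v F
  map_add' _ _ := rfl
  map_smul' _ _ := rfl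

/-- The restriction of a vector of the curl space to an element, as a linear map. -/
def curlOnT (T : Fin D.nT) : D.XCurl →ₗ[ℝ] D.XCurlT T where
  toFun v := XCurl.onT v T
  map_add' _ _ := rfl
  map_smul' _ _ := rfl

/-- The component `w_T` of a vector of the divergence space. -/
def divCompT (T : Fin D.nT) : D.XDiv →ₗ[ℝ] D.GT T (D.k - 1) :=
  LinearMap.proj T ∘ₗ .fst ℝ _ _

/-- The component `w_T^c` of a vector of the divergence space. -/
def divCompTc (T : Fin D.nT) : D.XDiv →ₗ[ℝ] D.GcT T D.k :=
  LinearMap.proj T ∘ₗ .fst ℝ _ _ ∘ₗ .snd ℝ _ _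

/-- The component `w_F` of a vector of the divergence space. -/
def divCompF (F : Fin D.nF) : D.XDiv →ₗ[ℝ] PolS (D.face F) D.k :=
  LinearMap.proj F ∘ₗ .snd ℝ _ _ ∘ₗ .snd ℝ _ _

end Discretisation

/-! ## Polynomial reconstructions -/

lemma theUnique_congr {α : Type*} [Zero α] {Q Q' : α → Prop} (h : ∀ u, Q u ↔ Q' u) :
    theUnique Q = theUnique Q' :=
  congrArg theUnique (funext fun u => propext (h u))

namespace PolyMesh

variable {M : PolyMesh} {F : Fin M.nF} {T : Fin M.nT} {l : ℤ} {V : Submodule ℝ (E3 → E3)}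
  [LocBddSub V]

lemma evV_add_toLB_ae_eq_mF (w z : VPoly3) {τ : V} (hτ : restrV (M.face F) z = τ.1) :
    (evV w + toLB τ).1 =ᵐ[M.mF F] evalV (w + z) := by
  filter_upwards [restrV_ae_eq_mF (F := F) z] with x hx
  rw [evalV_add, ← hx, hτ]
  rfl

lemma evV_add_toLB_ae_eq_mT (w z : VPoly3) {τ : V} (hτ : restrV (M.cell T) z = τ.1) :
    (evV w + toLB τ).1 =ᵐ[M.mT T] evalV (w + z) := by
  filter_upwards [restrV_ae_eq_mT (T := T) z] with x hx
  rw [evalV_add, ← hx, hτ]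
  rfl

end PolyMesh

namespace Serendipity

open Discretisation PolyMesh

variable {D : Discretisation} (S : Serendipity D) (F : Fin D.nF) (T : Fin D.nT)

/-- The flux `∑_E ω_{FE} ∫_E v_E r` through the boundary of the face `F`. -/
def edgeFlux : D.XCurl →ₗ[ℝ] Poly3 →ₗ[ℝ] ℝ :=
  ∑ E ∈ D.edgesF F, D.oFE F E • (l2Inner (D.mE E)).compl₁₂ (toLB ∘ₗ curlCompE E) evS

lemma edgeFlux_apply (v : D.XCurl) (r : Poly3) : edgeFlux F v r =
    ∑ E ∈ D.edgesF F, D.oFE F E * ∫ x, (v.2.2.2.2 E).1 x * evalS r x ∂D.mE E := by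
  simp only [edgeFlux, LinearMap.sum_apply, LinearMap.smul_apply, LinearMap.compl₁₂_apply,
    l2Inner_apply_real, smul_eq_mul]
  rfl

variable {F} in
lemma edgeFlux_eq_zero {r : Poly3} (hr : ∀ x ∈ closure (D.face F), evalS r x = 0) (v : D.XCurl) :
    edgeFlux F v r = 0 := by
  simp only [edgeFlux, LinearMap.sum_apply, LinearMap.smul_apply, LinearMap.compl₁₂_apply]
  exact Finset.sum_eq_zero fun E hE => by
    rw [l2Inner_eq_zero_of_ae_right _ (ae_mE_of_mem_edgesF hE hr), smul_zero]

/-- The right-hand side of the relations defining the face curl. -/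
def faceCurlRhs : D.XCurl →ₗ[ℝ] Poly3 →ₗ[ℝ] ℝ :=
  (l2Inner (D.mF F)).compl₁₂ (toLB ∘ₗ curlCompF F) (evV ∘ₗ rotP (D.normal F)) - edgeFlux F

lemma isL2Reconstruction_faceCurl :
    IsL2Reconstruction (D.mF F) (Pol D.k) evS (faceCurlRhs F) fun v => faceCurl v F where
  eq_theUnique v := theUnique_congr fun u => forall₂_congr fun r _ => by
    simp only [l2Inner_apply_real, faceCurlRhs, LinearMap.sub_apply, edgeFlux_apply]
    rfl
  exists_ae_eq r hr := ⟨⟨_, r, hr, rfl⟩, restrS_ae_eq_mF r⟩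
  rhs_eq_zero r _ hr v := by
    have hr0 := eqOn_zero_closure_face (continuous_evalS r) hr
    rw [faceCurlRhs, LinearMap.sub_apply, LinearMap.sub_apply, edgeFlux_eq_zero hr0, sub_zero]
    exact l2Inner_eq_zero_of_ae_right _ (ae_mF (evalV_rotP_eq_zero_of_const fun x hx =>
      hr0 (subset_closure hx)))

/-- The face curl as a linear map. -/
def faceCurlL : D.XCurl →ₗ[ℝ] PolS (D.face F) D.k :=
  (isL2Reconstruction_faceCurl F).isLinearMap.mk'

lemma l2Inner_faceCurlL (v : D.XCurl) {r : Poly3} (hr : r ∈ Pol D.k) :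
    l2Inner (D.mF F) (toLB (faceCurlL F v)) (evS r) = faceCurlRhs F v r := by
  refine (isL2Reconstruction_faceCurl F).l2Inner_eq
    (fun u hu => Subtype.ext (eq_zero_of_mem_polS_face u.2 hu)) ?_ v hr
  rintro ⟨_, p, hp, rfl⟩
  exact ⟨p, hp, restrS_ae_eq_mF p⟩

/-- The test fields `rot_F r + τ` on a face. -/
def rotTest : Poly3 × D.RcF F D.k →ₗ[ℝ] LocBdd E3 E3 :=
  (evV ∘ₗ rotP (D.normal F)).coprod toLB

/-- The right-hand side of the relations defining the tangential trace. -/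
def trFtRhs : D.XCurl →ₗ[ℝ] Poly3 × D.RcF F D.k →ₗ[ℝ] ℝ :=
  (l2Inner (D.mF F)).compl₁₂ (toLB ∘ₗ faceCurlL F) (evS ∘ₗ .fst ℝ _ _)
    + (edgeFlux F).compl₂ (.fst ℝ _ _)
    + (l2Inner (D.mF F)).compl₁₂ (toLB ∘ₗ S.curlF F ∘ₗ curlOnF F) (toLB ∘ₗ .snd ℝ _ _)

lemma isL2Reconstruction_trFt : IsL2Reconstruction (D.mF F)
    ((PolZero (D.mF F) (D.k + 1)).prod ⊤) (rotTest F) (S.trFtRhs F) fun v => S.trFt v F where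
  eq_theUnique v := theUnique_congr fun u => by
    simp only [trFtRhs, LinearMap.add_apply, LinearMap.compl₁₂_apply, LinearMap.compl₂_apply,
      LinearMap.comp_apply, l2Inner_apply_real, edgeFlux_apply]
    exact ⟨fun h p hp => h p.1 hp.1.1 hp.1.2 p.2,
      fun h r hr hr0 τ => h (r, τ) ⟨⟨hr, hr0⟩, trivial⟩⟩
  exists_ae_eq := by
    rintro ⟨r, τ⟩ hr
    obtain ⟨p, hp, hpτ⟩ := τ.2
    exact ⟨⟨_, restrV_rotP_add_mulPos_mem_vPolF hr.1.1 hp⟩,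
      (restrV_ae_eq_mF _).trans (evV_add_toLB_ae_eq_mF _ _ hpτ).symm⟩
  rhs_eq_zero := by
    rintro ⟨r, τ⟩ hr h0 v
    obtain ⟨p, -, hpτ⟩ := τ.2
    obtain ⟨hr0, hp0⟩ := eq_zero_of_rotP_add_mulPos (r := r) (fun x hx => eqOn_zero_closure_face
      (continuous_evalV _) ((evV_add_toLB_ae_eq_mF _ _ hpτ).symm.trans h0) (subset_closure hx))
      hr.1.2
    obtain rfl : τ = 0 := Subtype.ext (hpτ.symm.trans (restrV_eq_zero hp0))
    have hr0_ae : (evS r : LocBdd E3 ℝ).1 =ᵐ[D.mF F] 0 := ae_mF hr0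
    simp [trFtRhs, edgeFlux_eq_zero hr0, l2Inner_eq_zero_of_ae_right _ hr0_ae]

/-- The tangential trace reconstruction as a linear map. -/
def trFtL : D.XCurl →ₗ[ℝ] D.vPolF F D.k := (S.isL2Reconstruction_trFt F).isLinearMap.mk'

lemma l2Inner_trFtL_of_mem_polZero (v : D.XCurl) {r : Poly3}
    (hr : r ∈ PolZero (D.mF F) (D.k + 1)) :
    l2Inner (D.mF F) (toLB (S.trFtL F v)) (evV (rotP (D.normal F) r)) =
      l2Inner (D.mF F) (toLB (faceCurlL F v)) (evS r) + edgeFlux F v r := by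
  have h : l2Inner (D.mF F) (toLB (S.trFtL F v)) (rotTest F (r, 0)) = S.trFtRhs F v (r, 0) :=
    (S.isL2Reconstruction_trFt F).l2Inner_eq
      (fun u hu => Subtype.ext (eq_zero_of_mem_vPolF u.2 hu)) ?_ v (p := (r, 0)) ⟨hr, trivial⟩
  · simpa [rotTest, trFtRhs] using h
  · rintro ⟨f, hf⟩
    obtain ⟨r, hr, p, hp, hfp⟩ := exists_ae_eq_rotP_add_mulPos (by positivity) hf
    exact ⟨(r, ⟨_, p, hp, rfl⟩), ⟨hr, trivial⟩,
      hfp.trans (evV_add_toLB_ae_eq_mF (V := D.RcF F D.k) _ _ rfl).symm⟩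

lemma l2Inner_trFtL (v : D.XCurl) {r : Poly3} (hr : r ∈ Pol (D.k + 1)) :
    l2Inner (D.mF F) (toLB (S.trFtL F v)) (evV (rotP (D.normal F) r)) =
      l2Inner (D.mF F) (toLB (faceCurlL F v)) (evS r) + edgeFlux F v r := by
  obtain ⟨a, ha⟩ := exists_sub_C_mem_polZero (D.mF F) (by positivity) hr
  have h0 := S.l2Inner_trFtL_of_mem_polZero F v ha
  have hC : l2Inner (D.mF F) (toLB (faceCurlL F v)) (evS (C a)) = -edgeFlux F v (C a) := by
    rw [l2Inner_faceCurlL F v (pol_mono (by positivity) (C_mem_pol a))]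
    simp [faceCurlRhs, rotP_C]
  simp only [map_sub, rotP_C, sub_zero, hC] at h0
  rw [h0]
  ring

/-- The flux `∑_F ω_{TF} ∫_F γ_{t,F}v · (w × n_F)` through the boundary of the element `T`. -/
def tanFlux : D.XCurl →ₗ[ℝ] VPoly3 →ₗ[ℝ] ℝ :=
  ∑ F ∈ D.facesT T, D.oTF T F •
    (l2Inner (D.mF F)).compl₁₂ (toLB ∘ₗ S.trFtL F) (evV ∘ₗ crossConst (D.normal F))

lemma tanFlux_apply (v : D.XCurl) (w : VPoly3) : S.tanFlux T v w = ∑ F ∈ D.facesT T, D.oTF T F *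
    ∫ x, inner ℝ ((S.trFt v F).1 x) (cross (evalV w x) (D.normal F)) ∂D.mF F := by
  simp only [tanFlux, LinearMap.sum_apply, LinearMap.smul_apply, LinearMap.compl₁₂_apply,
    smul_eq_mul, ← evalV_crossConst]
  rfl

/-- The right-hand side of the relations defining the element curl. -/
def cellCurlRhs : D.XCurl →ₗ[ℝ] VPoly3 →ₗ[ℝ] ℝ :=
  (l2Inner (D.mT T)).compl₁₂ (toLB ∘ₗ curlCompT T) (evV ∘ₗ curlP) + S.tanFlux T

lemma isL2Reconstruction_cellCurl :
    IsL2Reconstruction (D.mT T) (VPol D.k) evV (S.cellCurlRhs T) fun v => S.cellCurl v T where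
  eq_theUnique v := theUnique_congr fun u => forall₂_congr fun w _ => by
    rw [cellCurlRhs, LinearMap.add_apply, LinearMap.add_apply, tanFlux_apply]
    rfl
  exists_ae_eq w hw := ⟨⟨_, w, hw, rfl⟩, restrV_ae_eq_mT w⟩
  rhs_eq_zero w _ hw v := by rw [eq_zero_of_evalV_ae_eq_zero hw, map_zero]

/-- The element curl as a linear map. -/
def cellCurlL : D.XCurl →ₗ[ℝ] PolV (D.cell T) D.k :=
  (S.isL2Reconstruction_cellCurl T).isLinearMap.mk'

lemma l2Inner_cellCurlL (v : D.XCurl) {w : VPoly3} (hw : w ∈ VPol D.k) :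
    l2Inner (D.mT T) (toLB (S.cellCurlL T v)) (evV w) = S.cellCurlRhs T v w := by
  refine (S.isL2Reconstruction_cellCurl T).l2Inner_eq
    (fun u hu => Subtype.ext (eq_zero_of_mem_polV_cell u.2 hu)) ?_ v hw
  rintro ⟨_, w, hw, rfl⟩
  exact ⟨w, hw, restrV_ae_eq_mT w⟩

/-- The test fields `curl w + τ` on an element, with `w = (x - x_T) × z`. -/
def curlTest : VPoly3 × D.RcT T D.k →ₗ[ℝ] LocBdd E3 E3 :=
  (evV ∘ₗ curlP ∘ₗ crossPos (D.cellPt T)).coprod toLB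

/-- The right-hand side of the relations defining the potential on the curl space. -/
def potCurlRhs : D.XCurl →ₗ[ℝ] VPoly3 × D.RcT T D.k →ₗ[ℝ] ℝ :=
  ((l2Inner (D.mT T)).compl₁₂ (toLB ∘ₗ S.cellCurlL T) evV - S.tanFlux T).compl₂
      (crossPos (D.cellPt T) ∘ₗ .fst ℝ _ _)
    + (l2Inner (D.mT T)).compl₁₂ (toLB ∘ₗ S.curlT T ∘ₗ curlOnT T) (toLB ∘ₗ .snd ℝ _ _)

lemma isL2Reconstruction_potCurl : IsL2Reconstruction (D.mT T) ((VPol D.k).prod ⊤) (curlTest T)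
    (S.potCurlRhs T) fun v => S.potCurl v T where
  eq_theUnique v := theUnique_congr fun u => by
    simp only [potCurlRhs, LinearMap.add_apply, LinearMap.sub_apply, LinearMap.compl₁₂_apply,
      LinearMap.compl₂_apply, LinearMap.comp_apply, tanFlux_apply]
    exact ⟨fun h p hp => h p.1 hp.1 _ rfl p.2, fun h z hz w hw τ => hw ▸ h (z, τ) ⟨hz, trivial⟩⟩
  exists_ae_eq := by
    rintro ⟨z, τ⟩ hz
    obtain ⟨p, hp, hpτ⟩ := τ.2
    have hcurl := curlP_mem_vPol (crossPos_mem_vPol (D.cellPt T) hz.1)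
    have hpos := mulPos_mem_vPol (D.cellPt T) hp
    rw [add_sub_cancel_right] at hcurl
    rw [sub_add_cancel] at hpos
    exact ⟨⟨_, _, add_mem hcurl hpos, rfl⟩,
      (restrV_ae_eq_mT _).trans (evV_add_toLB_ae_eq_mT _ _ hpτ).symm⟩
  rhs_eq_zero := by
    rintro ⟨z, τ⟩ - h0 v
    obtain ⟨p, -, hpτ⟩ := τ.2
    have h : curlP (crossPos (D.cellPt T) z) + mulPos (D.cellPt T) p = 0 :=
      eq_zero_of_evalV_ae_eq_zero ((evV_add_toLB_ae_eq_mT _ _ hpτ).symm.trans h0)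
    have hz := crossPos_eq_zero_of_curlP_add_mulPos h
    obtain rfl : τ = 0 := Subtype.ext <| hpτ.symm.trans <| by
      rw [hz, map_zero, zero_add] at h
      exact (congrArg (restrV _) h).trans (map_zero _)
    simp [potCurlRhs, hz]

/-- The vector potential on the curl space as a linear map. -/
def potCurlL : D.XCurl →ₗ[ℝ] PolV (D.cell T) D.k :=
  (S.isL2Reconstruction_potCurl T).isLinearMap.mk'

/-- The flux `∑_F ω_{TF} ∫_F w_F r` through the boundary of the element `T`. -/
def normalFlux : D.XDiv →ₗ[ℝ] Poly3 →ₗ[ℝ] ℝ :=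
  ∑ F ∈ D.facesT T, D.oTF T F • (l2Inner (D.mF F)).compl₁₂ (toLB ∘ₗ divCompF F) evS

lemma normalFlux_apply (w : D.XDiv) (r : Poly3) : normalFlux T w r =
    ∑ F ∈ D.facesT T, D.oTF T F * ∫ x, (w.2.2 F).1 x * evalS r x ∂D.mF F := by
  simp only [normalFlux, LinearMap.sum_apply, LinearMap.smul_apply, LinearMap.compl₁₂_apply,
    l2Inner_apply_real, smul_eq_mul]
  rfl

/-- The right-hand side of the relations defining the element divergence. -/
def cellDivRhs : D.XDiv →ₗ[ℝ] Poly3 →ₗ[ℝ] ℝ :=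
  -(l2Inner (D.mT T)).compl₁₂ (toLB ∘ₗ divCompT T) (evV ∘ₗ gradP) + normalFlux T

lemma isL2Reconstruction_cellDiv :
    IsL2Reconstruction (D.mT T) (Pol D.k) evS (cellDivRhs T) fun w => cellDiv w T where
  eq_theUnique w := theUnique_congr fun u => forall₂_congr fun q _ => by
    simp only [l2Inner_apply_real, cellDivRhs, LinearMap.add_apply, normalFlux_apply]
    rfl
  exists_ae_eq q hq := ⟨⟨_, q, hq, rfl⟩, restrS_ae_eq_mT q⟩
  rhs_eq_zero q _ hq w := by rw [eq_zero_of_evalS_ae_eq_zero hq, map_zero]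

/-- The element divergence as a linear map. -/
def cellDivL : D.XDiv →ₗ[ℝ] PolS (D.cell T) D.k :=
  (isL2Reconstruction_cellDiv T).isLinearMap.mk'

lemma cellDivL_eq_zero {w : D.XDiv} (hw : ∀ q ∈ Pol D.k, cellDivRhs T w q = 0) :
    cellDivL T w = 0 := by
  refine (isL2Reconstruction_cellDiv T).eq_of_forall_l2Inner_eq
    (fun u hu => Subtype.ext (eq_zero_of_mem_polS_cell u.2 hu)) ?_ fun q hq => by simp [hw q hq]
  rintro ⟨_, q, hq, rfl⟩
  exact ⟨q, hq, restrS_ae_eq_mT q⟩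

/-- The test fields `∇r + τ` on an element. -/
def gradTest : Poly3 × D.GcT T D.k →ₗ[ℝ] LocBdd E3 E3 :=
  (evV ∘ₗ gradP).coprod toLB

/-- The right-hand side of the relations defining the potential on the divergence space. -/
def potDivRhs : D.XDiv →ₗ[ℝ] Poly3 × D.GcT T D.k →ₗ[ℝ] ℝ :=
  (-(l2Inner (D.mT T)).compl₁₂ (toLB ∘ₗ cellDivL T) evS + normalFlux T).compl₂ (.fst ℝ _ _)
    + (l2Inner (D.mT T)).compl₁₂ (toLB ∘ₗ divCompTc T) (toLB ∘ₗ .snd ℝ _ _)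

lemma isL2Reconstruction_potDiv : IsL2Reconstruction (D.mT T)
    ((PolZero (D.mT T) (D.k + 1)).prod ⊤) (gradTest T) (potDivRhs T) fun w => potDiv w T where
  eq_theUnique w := theUnique_congr fun u => by
    simp only [potDivRhs, LinearMap.add_apply, LinearMap.neg_apply, LinearMap.compl₁₂_apply,
      LinearMap.compl₂_apply, LinearMap.comp_apply, l2Inner_apply_real, normalFlux_apply]
    exact ⟨fun h p hp => h p.1 hp.1.1 hp.1.2 p.2,
      fun h r hr hr0 τ => h (r, τ) ⟨⟨hr, hr0⟩, trivial⟩⟩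
  exists_ae_eq := by
    rintro ⟨r, τ⟩ hr
    obtain ⟨z, hz, hzτ⟩ := τ.2
    have hgrad := gradP_mem_vPol hr.1.1
    have hpos := crossPos_mem_vPol (D.cellPt T) hz
    rw [add_sub_cancel_right] at hgrad
    rw [sub_add_cancel] at hpos
    exact ⟨⟨_, _, add_mem hgrad hpos, rfl⟩,
      (restrV_ae_eq_mT _).trans (evV_add_toLB_ae_eq_mT _ _ hzτ).symm⟩
  rhs_eq_zero := by
    rintro ⟨r, τ⟩ hr h0 w
    obtain ⟨z, -, hzτ⟩ := τ.2
    have h : gradP r + crossPos (D.cellPt T) z = 0 :=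
      eq_zero_of_evalV_ae_eq_zero ((evV_add_toLB_ae_eq_mT _ _ hzτ).symm.trans h0)
    obtain ⟨rfl, hz⟩ := eq_zero_of_gradP_add_crossPos (T := T) (r := r) (z := z)
      (fun x _ => by rw [h]; ext i; simp [evalV]) hr.1.2
    obtain rfl : τ = 0 := Subtype.ext <| hzτ.symm.trans <|
      (congrArg (restrV _) hz).trans (map_zero _)
    exact map_zero _

/-- The vector potential on the divergence space as a linear map. -/
def potDivL : D.XDiv →ₗ[ℝ] PolV (D.cell T) D.k :=
  (isL2Reconstruction_potDiv T).isLinearMap.mk'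

lemma potDivL_eq {w : D.XDiv} {u : PolV (D.cell T) D.k}
    (h : ∀ p ∈ (PolZero (D.mT T) (D.k + 1)).prod ⊤,
      l2Inner (D.mT T) (toLB u) (gradTest T p) = potDivRhs T w p) : potDivL T w = u := by
  refine (isL2Reconstruction_potDiv T).eq_of_forall_l2Inner_eq
    (fun u hu => Subtype.ext (eq_zero_of_mem_polV_cell u.2 hu)) ?_ h
  rintro ⟨_, w, hw, rfl⟩
  obtain ⟨r, hr, z, hz, rfl⟩ := exists_gradP_add_crossPos (D.cellPt T) hw
  obtain ⟨a, ha⟩ := exists_sub_C_mem_polZero (D.mT T) (by positivity) hr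
  refine ⟨(r - C a, ⟨_, z, hz, rfl⟩), ⟨ha, trivial⟩, (restrV_ae_eq_mT _).trans ?_⟩
  rw [← sub_zero (gradP r), ← gradP_C a, ← map_sub]
  exact (evV_add_toLB_ae_eq_mT (V := D.GcT T D.k) _ _ rfl).symm

/-! ## The element potential of a discrete curl -/

/-- The discrete curl as a linear map. -/
def uCL : D.XCurl →ₗ[ℝ] D.XDiv :=
  (LinearMap.pi fun T => l2projL (D.mT T) (D.GT T (D.k - 1)) ∘ₗ toLB ∘ₗ S.cellCurlL T).prod
    ((LinearMap.pi fun T => l2projL (D.mT T) (D.GcT T D.k) ∘ₗ toLB ∘ₗ S.cellCurlL T).prod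
      (LinearMap.pi fun F => faceCurlL F))

lemma l2Inner_cellCurlL_gradP (v : D.XCurl) {r : Poly3} (hr : r ∈ Pol (D.k + 1)) :
    l2Inner (D.mT T) (toLB (S.cellCurlL T v)) (evV (gradP r)) = normalFlux T (S.uCL v) r := by
  have hflux (F : Fin D.nF) : l2Inner (D.mF F) (toLB (S.trFtL F v))
      (evV (crossConst (D.normal F) (gradP r))) =
        l2Inner (D.mF F) (toLB (faceCurlL F v)) (evS r) + edgeFlux F v r :=
    S.l2Inner_trFtL F v hr
  have hboundary : ∑ F ∈ D.facesT T, D.oTF T F * edgeFlux F v r = 0 := by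
    simp only [edgeFlux_apply]
    exact sum_oTF_mul_sum_oFE T _
  rw [l2Inner_cellCurlL S T v (by simpa using gradP_mem_vPol hr), cellCurlRhs,
    LinearMap.add_apply, LinearMap.add_apply, LinearMap.compl₁₂_apply, LinearMap.comp_apply evV,
    curlP_gradP, map_zero, map_zero, zero_add]
  simp only [tanFlux, LinearMap.sum_apply, LinearMap.smul_apply, LinearMap.compl₁₂_apply,
    LinearMap.comp_apply, hflux, smul_eq_mul, mul_add, Finset.sum_add_distrib, hboundary, add_zero]
  simp only [normalFlux, LinearMap.sum_apply, LinearMap.smul_apply, LinearMap.compl₁₂_apply,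
    smul_eq_mul]
  rfl

lemma cellDivL_uCL (v : D.XCurl) : cellDivL T (S.uCL v) = 0 := by
  refine cellDivL_eq_zero T fun q hq => ?_
  let g : D.GT T (D.k - 1) := ⟨restrV (D.cell T) (gradP q), q, by simpa using hq, rfl⟩
  have hg : (toLB g).1 =ᵐ[D.mT T] (evV (gradP q)).1 := restrV_ae_eq_mT _
  have hproj : l2Inner (D.mT T) (toLB (l2projL (D.mT T) (D.GT T (D.k - 1))
      (toLB (S.cellCurlL T v)))) (evV (gradP q)) = normalFlux T (S.uCL v) q := by
    rw [← l2Inner_cellCurlL_gradP S T v (pol_mono (by lia) hq), ← l2Inner_congr_ae .rfl hg,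
      ← l2Inner_congr_ae .rfl hg]
    exact l2Inner_l2projL
      (fun u hu => Subtype.ext (eq_zero_of_mem_polV_cell (gT_le_polV u.2) hu)) _ g
  rw [← neg_add_cancel (normalFlux T (S.uCL v) q), ← hproj, hproj]
  exact congrArg (-· + _) hproj

theorem potDivL_uCL (v : D.XCurl) : potDivL T (S.uCL v) = S.cellCurlL T v := by
  refine potDivL_eq T ?_
  rintro ⟨r, τ⟩ hr
  have hτ : l2Inner (D.mT T) (toLB (l2projL (D.mT T) (D.GcT T D.k) (toLB (S.cellCurlL T v))))
      (toLB τ) = l2Inner (D.mT T) (toLB (S.cellCurlL T v)) (toLB τ) :=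
    l2Inner_l2projL (fun u hu => Subtype.ext (eq_zero_of_mem_polV_cell (gcT_le_polV u.2) hu)) _ τ
  rw [gradTest, LinearMap.coprod_apply, map_add, LinearMap.comp_apply,
    S.l2Inner_cellCurlL_gradP T v hr.1.1, ← hτ]
  simp only [potDivRhs, LinearMap.add_apply, LinearMap.neg_apply, LinearMap.compl₁₂_apply,
    LinearMap.compl₂_apply, LinearMap.comp_apply, cellDivL_uCL, map_zero, LinearMap.zero_apply,
    neg_zero, zero_add]
  rfl

end Serendipity

/-! ## Positive semidefinite forms -/

section PosSemidef

variable {X Y : Type*} [AddCommGroup X] [Module ℝ X] [AddCommGroup Y] [Module ℝ Y]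
  {β : LinearMap.BilinForm ℝ Y}

lemma isPosSemidef_of_pos (hβ_symm : ∀ x y, β x y = β y x) (hβ_pos : ∀ y, y ≠ 0 → 0 < β y y) :
    β.IsPosSemidef :=
  ⟨⟨hβ_symm⟩, ⟨fun y => by
    rcases eq_or_ne y 0 with rfl | hy
    · rw [map_zero]
    · exact (hβ_pos y hy).le⟩⟩

lemma isPosSemidef_compl₁₂ (hβ : β.IsPosSemidef) (A : X →ₗ[ℝ] Y) :
    LinearMap.BilinForm.IsPosSemidef (β.compl₁₂ A A) :=
  ⟨⟨fun x y => hβ.isSymm.eq (A x) (A y)⟩, ⟨fun x => hβ.nonneg (A x)⟩⟩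

lemma isPosSemidef_sum {κ : Type*} (s : Finset κ) {f : κ → LinearMap.BilinForm ℝ X}
    (hf : ∀ k, (f k).IsPosSemidef) : (∑ k ∈ s, f k).IsPosSemidef :=
  Finset.sum_induction f _ (fun _ _ => .add) LinearMap.BilinForm.isPosSemidef_zero fun k _ => hf k

lemma half_sub_half_le (hβ : β.IsPosSemidef) (x y : Y) :
    1 / 2 * β y y - 1 / 2 * β x x ≤ β y (y - x) := by
  have hnonneg := hβ.nonneg (y - x)
  have hsymm : β x y = β y x := hβ.isSymm.eq x y
  simp only [map_sub, LinearMap.sub_apply] at hnonneg ⊢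
  linarith

lemma posSemidef_gram {ι : Type*} [Finite ι] (hβ : β.IsPosSemidef) (x : ι → Y) :
    (Matrix.of fun I J => β (x I) (x J)).PosSemidef := by
  have := Fintype.ofFinite ι
  refine .of_dotProduct_mulVec_nonneg (Matrix.ext fun I J => hβ.isSymm.eq (x J) (x I)) fun c => ?_
  have h : star c ⬝ᵥ ((Matrix.of fun I J => β (x I) (x J)) *ᵥ c) =
      β (∑ I, c I • x I) (∑ J, c J • x J) := by
    simp only [dotProduct, Matrix.mulVec, Matrix.of_apply, Pi.star_apply, star_trivial, map_sum,
      LinearMap.sum_apply, map_smul, LinearMap.smul_apply, smul_eq_mul, Finset.mul_sum]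
    rw [Finset.sum_comm]
    exact Finset.sum_congr rfl fun J _ => Finset.sum_congr rfl fun I _ => by ring
  exact h ▸ hβ.nonneg _

end PosSemidef

/-! ## Lie algebra-valued forms and brackets -/

section Tensor

variable {X Y Z : Type*} [AddCommGroup X] [Module ℝ X] [AddCommGroup Y] [Module ℝ Y]
  [AddCommGroup Z] [Module ℝ Z] {ι : Type*} [Fintype ι] {𝔤 : Type*} [LieRing 𝔤] [LieAlgebra ℝ 𝔤]
  (b : Module.Basis ι ℝ 𝔤) (B : LinearMap.BilinForm ℝ 𝔤) (β : LinearMap.BilinForm ℝ X)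

/-- The tensor product `β ⊗ B` of bilinear forms, on the components `ι → X` of the elements of
`X ⊗ 𝔤`. -/
def tensL : LinearMap.BilinForm ℝ (ι → X) :=
  ∑ I, ∑ J, B (b I) (b J) • β.compl₁₂ (.proj I) (.proj J)

lemma tensL_apply (x y : ι → X) :
    tensL b B β x y = ∑ I, ∑ J, B (b I) (b J) * β (x I) (y J) := by
  simp [tensL, LinearMap.sum_apply]

variable {B β}

lemma tens_eq_tensL {f : X → X → ℝ} (hf : ∀ x y, f x y = β x y) (x y : ι → X) :
    tens b B f x y = tensL b B β x y := by
  simp only [tens, tensL_apply, hf, mul_comm]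

/-- Positivity is the Schur product theorem for the Gram matrices of `B` and `β`. -/
lemma isPosSemidef_tensL (hB : B.IsPosSemidef) (hβ : β.IsPosSemidef) :
    (tensL b B β).IsPosSemidef := by
  classical
  refine ⟨⟨fun x y => ?_⟩, ⟨fun x => ?_⟩⟩
  · rw [tensL_apply, tensL_apply, Finset.sum_comm]
    refine Finset.sum_congr rfl fun I _ => Finset.sum_congr rfl fun J _ => ?_
    exact congrArg₂ (· * ·) (hB.isSymm.eq _ _) (hβ.isSymm.eq _ _)
  · have h := ((posSemidef_gram hB b).hadamard (posSemidef_gram hβ x)).dotProduct_mulVec_nonneg 1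
    simpa [tensL_apply, dotProduct, Matrix.mulVec] using h

/-- The bracket `φ(v^I, w^J) ⊗ [e_I, e_J]` induced by a bilinear map `φ`. -/
def bktL (φ : X →ₗ[ℝ] Y →ₗ[ℝ] Z) : (ι → X) →ₗ[ℝ] (ι → Y) →ₗ[ℝ] (ι → Z) :=
  LinearMap.mk₂ ℝ (fun v w K => ∑ I, ∑ J, strConst b I J K • φ (v I) (w J))
    (fun _ _ _ => by funext; simp [Finset.sum_add_distrib])
    (fun c _ _ => by funext; simp [Finset.smul_sum, smul_comm c])
    (fun _ _ _ => by funext; simp [Finset.sum_add_distrib])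
    (fun c _ _ => by funext; simp [Finset.smul_sum, smul_comm c])

lemma bktL_apply (φ : X →ₗ[ℝ] Y →ₗ[ℝ] Z) (v : ι → X) (w : ι → Y) (K : ι) :
    bktL b φ v w K = ∑ I, ∑ J, strConst b I J K • φ (v I) (w J) := rfl

lemma strConst_swap {ι : Type*} (b : Module.Basis ι ℝ 𝔤) (I J K : ι) :
    strConst b I J K = -strConst b J I K := by
  rw [strConst, strConst, ← lie_skew, map_neg, Finsupp.neg_apply]

lemma bktL_comm {φ : X →ₗ[ℝ] X →ₗ[ℝ] Z} (hφ : ∀ x y, φ x y = -φ y x) (v w : ι → X) :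
    bktL b φ v w = bktL b φ w v := by
  funext K
  rw [bktL_apply, bktL_apply, Finset.sum_comm]
  refine Finset.sum_congr rfl fun J _ => Finset.sum_congr rfl fun I _ => ?_
  rw [strConst_swap, hφ, smul_neg, neg_smul, neg_neg]

lemma sum_mul_strConst (x : 𝔤) (I J : ι) :
    ∑ K, B x (b K) * strConst b I J K = B x ⁅b I, b J⁆ := by
  conv_rhs => rw [← b.sum_repr ⁅b I, b J⁆]
  simp only [map_sum, map_smul, smul_eq_mul, strConst, mul_comm]

lemma tensL_bktL (φ : Y →ₗ[ℝ] Z →ₗ[ℝ] X) (x : ι → X) (y : ι → Y) (z : ι → Z) :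
    tensL b B β x (bktL b φ y z) =
      ∑ P, ∑ I, ∑ J, B (b P) ⁅b I, b J⁆ * β (x P) (φ (y I) (z J)) := by
  rw [tensL_apply]
  refine Finset.sum_congr rfl fun P _ => ?_
  simp only [bktL_apply, map_sum, map_smul, smul_eq_mul, Finset.mul_sum, ← sum_mul_strConst,
    Finset.sum_mul, mul_assoc]
  rw [Finset.sum_comm]
  exact Finset.sum_congr rfl fun I _ => Finset.sum_comm

lemma apply_lie_swap (hB_inv : ∀ x y z : 𝔤, B ⁅x, y⁆ z = -B y ⁅x, z⁆) (x y z : 𝔤) :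
    B x ⁅y, z⁆ = -B y ⁅x, z⁆ := by
  rw [← hB_inv, ← neg_neg (B x _), ← hB_inv, ← lie_skew y x, map_neg, LinearMap.neg_apply, neg_neg]

/-- The total antisymmetry of `(x, y, z) ↦ B x ⁅y, z⁆` combines with the symmetry of
multiplication by a component of `z`. -/
lemma tensL_bktL_self (hB_inv : ∀ x y z : 𝔤, B ⁅x, y⁆ z = -B y ⁅x, z⁆)
    {φ : X →ₗ[ℝ] Z →ₗ[ℝ] X} (hφ : ∀ x y z, β x (φ y z) = β y (φ x z)) (x : ι → X) (z : ι → Z) :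
    tensL b B β x (bktL b φ x z) = 0 := by
  have h : tensL b B β x (bktL b φ x z) = -tensL b B β x (bktL b φ x z) := by
    conv_lhs => rw [tensL_bktL, Finset.sum_comm]
    simp only [tensL_bktL, ← Finset.sum_neg_distrib]
    refine Finset.sum_congr rfl fun I _ => Finset.sum_congr rfl fun P _ =>
      Finset.sum_congr rfl fun J _ => ?_
    rw [apply_lie_swap hB_inv, hφ, neg_mul]
  linarith

end Tensor

/-! ## The discrete products -/

section Pointwise

/-- The cross product as a continuous bilinear map. -/
def crossCL : E3 →L[ℝ] E3 →L[ℝ] E3 :=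
  (LinearMap.mk₂ ℝ cross (fun _ _ _ => by simp [cross]) (fun _ _ _ => by simp [cross])
    (fun _ _ _ => by simp [cross]) (fun _ _ _ => by simp [cross])).toContinuousBilinearMap

/-- The tangential trace `v ↦ n × (v × n)` as a continuous linear map. -/
def tanTraceL (n : E3) : E3 →L[ℝ] E3 := crossCL n ∘L crossCL.flip n

variable {X : Type*} [MeasurableSpace X] [Bornology X] {κ G₁ G₂ G₃ : Type*}
  [NormedAddCommGroup G₁] [NormedSpace ℝ G₁] [NormedAddCommGroup G₂] [NormedSpace ℝ G₂]
  [NormedAddCommGroup G₃] [NormedSpace ℝ G₃]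

lemma postComp₂_crossCL_swap (f g : LocBdd X E3) :
    postComp₂ crossCL f g = -postComp₂ crossCL g f :=
  Subtype.ext <| funext fun _ => congrArg (WithLp.toLp 2) (cross_anticomm _ _).symm

/-- Pointwise application of a continuous bilinear map to families of locally bounded functions. -/
def pwComp₂ (φ : G₁ →L[ℝ] G₂ →L[ℝ] G₃) :
    (κ → LocBdd X G₁) →ₗ[ℝ] (κ → LocBdd X G₂) →ₗ[ℝ] (κ → LocBdd X G₃) :=
  LinearMap.mk₂ ℝ (fun f g k => postComp₂ φ (f k) (g k))
    (fun _ _ _ => by funext; simp) (fun _ _ _ => by funext; simp)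
    (fun _ _ _ => by funext; simp) (fun _ _ _ => by funext; simp)

end Pointwise

open Discretisation PolyMesh

variable {D : Discretisation}

/-- Piecewise locally bounded vector fields. -/
abbrev PwLB (D : Discretisation) : Type := Fin D.nT → LocBdd E3 E3

/-- The `L²`-product of piecewise locally bounded fields. -/
def l2DomL : LinearMap.BilinForm ℝ (PwLB D) :=
  ∑ T, (l2Inner (D.mT T)).compl₁₂ (.proj T) (.proj T)

lemma isPosSemidef_l2DomL : (l2DomL (D := D)).IsPosSemidef :=
  isPosSemidef_sum _ fun T => isPosSemidef_compl₁₂ (isPosSemidef_l2Inner (D.mT T)) _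

lemma l2Dom_eq_l2DomL (f g : PwLB D) :
    l2Dom (fun T => (f T).1) (fun T => (g T).1) = l2DomL f g := by
  simp only [l2DomL, LinearMap.sum_apply]
  rfl

namespace Serendipity

variable (S : Serendipity D)

/-- The defect between the tangential trace of the potential of the element `T` and the tangential
trace reconstructed on the face `F`. -/
def tanDefect (T : Fin D.nT) (F : Fin D.nF) : D.XCurl →ₗ[ℝ] LocBdd E3 E3 :=
  postComp (tanTraceL (D.normal F)) ∘ₗ toLB ∘ₗ S.potCurlL T - toLB ∘ₗ S.trFtL F

/-- The defect between the tangential component of the potential of the element `T` on the edge `E`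
and the component of the discrete field on `E`. -/
def edgeDefect (T : Fin D.nT) (E : Fin D.nE) : D.XCurl →ₗ[ℝ] LocBdd E3 ℝ :=
  postComp (innerSL ℝ (D.tangent E)) ∘ₗ toLB ∘ₗ S.potCurlL T - toLB ∘ₗ curlCompE E

/-- The defect between the normal component of the potential of the element `T` on the face `F`
and the component of the discrete field on `F`. -/
def normalDefect (T : Fin D.nT) (F : Fin D.nF) : D.XDiv →ₗ[ℝ] LocBdd E3 ℝ :=
  postComp (innerSL ℝ (D.normal F)) ∘ₗ toLB ∘ₗ potDivL T - toLB ∘ₗ divCompF F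

/-- The discrete `L²`-product on the curl space as a bilinear form. -/
def ipCurlL : LinearMap.BilinForm ℝ D.XCurl :=
  ∑ T, ((l2Inner (D.mT T)).compl₁₂ (toLB ∘ₗ S.potCurlL T) (toLB ∘ₗ S.potCurlL T)
    + (∑ F ∈ D.facesT T,
        D.hF F • (l2Inner (D.mF F)).compl₁₂ (S.tanDefect T F) (S.tanDefect T F)
      + ∑ E ∈ D.edgesT T,
        D.hE E ^ 2 • (l2Inner (D.mE E)).compl₁₂ (S.edgeDefect T E) (S.edgeDefect T E)))

lemma ipCurl_eq_ipCurlL (w v : D.XCurl) : S.ipCurl w v = S.ipCurlL w v := by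
  simp only [ipCurl, sCurl, ipCurlL, LinearMap.sum_apply, LinearMap.add_apply,
    LinearMap.smul_apply, LinearMap.compl₁₂_apply, l2Inner_apply_real,
    real_inner_comm (D.tangent _)]
  rfl

lemma isPosSemidef_ipCurlL : S.ipCurlL.IsPosSemidef :=
  isPosSemidef_sum _ fun _ => (isPosSemidef_compl₁₂ (isPosSemidef_l2Inner _) _).add <|
    (isPosSemidef_sum _ fun _ =>
      (isPosSemidef_compl₁₂ (isPosSemidef_l2Inner _) _).smul Metric.diam_nonneg).add <|
    isPosSemidef_sum _ fun _ =>
      (isPosSemidef_compl₁₂ (isPosSemidef_l2Inner _) _).smul (sq_nonneg _)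

/-- The stabilisation on the divergence space as a bilinear form. -/
def sDivGlobL : LinearMap.BilinForm ℝ D.XDiv :=
  ∑ T, ∑ F ∈ D.facesT T,
    D.hF F • (l2Inner (D.mF F)).compl₁₂ (normalDefect T F) (normalDefect T F)

lemma sDivGlob_eq_sDivGlobL (w v : D.XDiv) : sDivGlob w v = sDivGlobL w v := by
  simp only [sDivGlob, sDiv, sDivGlobL, LinearMap.sum_apply, LinearMap.smul_apply,
    LinearMap.compl₁₂_apply, l2Inner_apply_real, real_inner_comm (D.normal _)]
  rfl

lemma isPosSemidef_sDivGlobL : (sDivGlobL (D := D)).IsPosSemidef :=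
  isPosSemidef_sum _ fun _ => isPosSemidef_sum _ fun _ =>
    (isPosSemidef_compl₁₂ (isPosSemidef_l2Inner _) _).smul Metric.diam_nonneg

/-- The element potentials on the divergence space, as a piecewise field. -/
def pwPotDivL : D.XDiv →ₗ[ℝ] PwLB D := .pi fun T => toLB ∘ₗ potDivL T

/-- The discrete `L²`-product on the divergence space as a bilinear form. -/
def ipDivL : LinearMap.BilinForm ℝ D.XDiv := l2DomL.compl₁₂ pwPotDivL pwPotDivL + sDivGlobL

lemma ipDiv_eq_ipDivL (w v : D.XDiv) : ipDiv w v = ipDivL w v := by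
  rw [ipDivL, LinearMap.add_apply, LinearMap.add_apply, ← sDivGlob_eq_sDivGlobL,
    LinearMap.compl₁₂_apply, ← l2Dom_eq_l2DomL, ipDiv, Finset.sum_add_distrib]
  rfl

lemma isPosSemidef_ipDivL : (ipDivL (D := D)).IsPosSemidef :=
  (isPosSemidef_compl₁₂ isPosSemidef_l2DomL _).add isPosSemidef_sDivGlobL

/-- The element potentials on the curl space, as a piecewise field. -/
def pwPotCurlL : D.XCurl →ₗ[ℝ] PwLB D := .pi fun T => toLB ∘ₗ S.potCurlL T

/-- The element curls, as a piecewise field. -/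
def pwCurlL : D.XCurl →ₗ[ℝ] PwLB D := .pi fun T => toLB ∘ₗ S.cellCurlL T

lemma ipDivL_uCL (v w : D.XCurl) :
    ipDivL (S.uCL v) (S.uCL w) =
      l2DomL (S.pwCurlL v) (S.pwCurlL w) + sDivGlobL (S.uCL v) (S.uCL w) := by
  have h (v : D.XCurl) : pwPotDivL (S.uCL v) = S.pwCurlL v :=
    funext fun T => congrArg toLB (S.potDivL_uCL T v)
  rw [ipDivL, LinearMap.add_apply, LinearMap.add_apply, LinearMap.compl₁₂_apply, h, h]

/-- The cross product of the element potentials of two discrete fields of the curl space. -/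
def crossPot : D.XCurl →ₗ[ℝ] D.XCurl →ₗ[ℝ] PwLB D :=
  (pwComp₂ crossCL).compl₁₂ S.pwPotCurlL S.pwPotCurlL

lemma crossPot_swap (v w : D.XCurl) : S.crossPot v w = -S.crossPot w v :=
  funext fun T => postComp₂_crossCL_swap (S.pwPotCurlL v T) (S.pwPotCurlL w T)

/-- The projection on the divergence space of the cross product of two discrete fields of the curl
space. -/
def crossDiv : D.XCurl →ₗ[ℝ] D.XCurl →ₗ[ℝ] D.XDiv :=
  LinearMap.mk₂ ℝ (fun v w =>
      (fun T => l2projL (D.mT T) (D.GT T (D.k - 1)) (S.crossPot v w T),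
       fun T => l2projL (D.mT T) (D.GcT T D.k) (S.crossPot v w T),
       fun F => l2projL (D.mF F) (PolS (D.face F) D.k) (postComp (innerSL ℝ (D.normal F))
        (postComp₂ crossCL (toLB (S.trFtL F v)) (toLB (S.trFtL F w))))))
    (fun _ _ _ => by ext <;> simp) (fun _ _ _ => by ext <;> simp)
    (fun _ _ _ => by ext <;> simp) (fun _ _ _ => by ext <;> simp)

lemma crossDiv_swap (v w : D.XCurl) : S.crossDiv v w = -S.crossDiv w v := by
  simp only [crossDiv, LinearMap.mk₂_apply, S.crossPot_swap v, Pi.neg_apply,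
    postComp₂_crossCL_swap (toLB (S.trFtL _ v)), map_neg]
  rfl

end Serendipity

/-! ## Curvature energy -/

section Curvature

variable {X Y : Type*} [AddCommGroup X] [Module ℝ X] [AddCommGroup Y] [Module ℝ Y]
  (C : X →ₗ[ℝ] Y) (br : X →ₗ[ℝ] X →ₗ[ℝ] Y)

/-- The curvature `C a + ½ [a, a]` of a potential `a`: the magnetic field of the scheme, for a
discrete curl `C` and a bracket `br`. -/
def curvature (a : X) : Y := C a + (1 / 2 : ℝ) • br a a

variable {br}

/-- The symmetry of the bracket makes the covariant derivative at the midpoint an exact difference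
quotient of the curvature. -/
lemma map_sub_add_midpoint_sub (hbr : ∀ x y, br x y = br y x) (a a' : X) :
    C (a' - a) + br ((1 / 2 : ℝ) • (a + a')) (a' - a) = curvature C br a' - curvature C br a := by
  simp only [curvature, map_smul, map_sub, map_add, LinearMap.smul_apply, LinearMap.add_apply,
    hbr a a']
  module

variable {β : LinearMap.BilinForm ℝ Y}

lemma curvature_work_le (hβ : β.IsPosSemidef) (hbr : ∀ x y, br x y = br y x) {a a' v : X} {τ : ℝ}
    (hτ : 0 ≤ τ) (hv : v = -(τ • (a' - a))) :
    β (C a') (C v) + (β (C a') (br ((1 / 2 : ℝ) • (a + a')) v)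
        + β ((1 / 2 : ℝ) • br a' a') (C v + br ((1 / 2 : ℝ) • (a + a')) v)) ≤
      -(τ * (1 / 2 * β (curvature C br a') (curvature C br a')
        - 1 / 2 * β (curvature C br a) (curvature C br a))) := by
  have hmid : C v + br ((1 / 2 : ℝ) • (a + a')) v =
      -(τ • (curvature C br a' - curvature C br a)) := by
    rw [← map_sub_add_midpoint_sub C hbr, hv]
    simp only [map_neg, map_smul, smul_add, neg_add]
  calc _ = β (curvature C br a') (C v + br ((1 / 2 : ℝ) • (a + a')) v) := by
        rw [← add_assoc, ← map_add, ← LinearMap.add_apply, ← map_add, ← curvature]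
    _ = -(τ * β (curvature C br a') (curvature C br a' - curvature C br a)) := by
        rw [hmid, map_neg, map_smul, smul_eq_mul]
    _ ≤ _ := neg_le_neg (mul_le_mul_of_nonneg_left (half_sub_half_le hβ _ _) hτ)

lemma map_work_le (hβ : β.IsPosSemidef) {a a' v : X} {τ : ℝ} (hτ : 0 ≤ τ)
    (hv : v = -(τ • (a' - a))) :
    β (C a') (C v) ≤ -(τ * (1 / 2 * β (C a') (C a') - 1 / 2 * β (C a) (C a))) := by
  rw [hv, map_neg, map_smul, map_sub, map_neg, map_smul, smul_eq_mul]
  exact neg_le_neg (mul_le_mul_of_nonneg_left (half_sub_half_le hβ _ _) hτ)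

end Curvature

/-! ## Lie algebra-valued operators -/

open Serendipity

variable (S : Serendipity D) {ι : Type*}

/-- The Lie algebra-valued element potentials on the curl space. -/
def gPcurlL : (ι → D.XCurl) →ₗ[ℝ] (ι → PwLB D) := S.pwPotCurlL.compLeft ι

/-- The Lie algebra-valued element curls. -/
def gCpwL : (ι → D.XCurl) →ₗ[ℝ] (ι → PwLB D) := S.pwCurlL.compLeft ι

/-- The Lie algebra-valued discrete curl. -/
def gCL : (ι → D.XCurl) →ₗ[ℝ] (ι → D.XDiv) := S.uCL.compLeft ι

/-- The Lie algebra-valued scalar potential, as a piecewise locally bounded field. -/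
def gPgradLB (q : ι → D.XGrad) : ι → Fin D.nT → LocBdd E3 ℝ := fun I T => toLB (S.potGrad (q I) T)

/-- The product of a piecewise vector field and a piecewise scalar field. -/
def pwScale : PwLB D →ₗ[ℝ] (Fin D.nT → LocBdd E3 ℝ) →ₗ[ℝ] PwLB D :=
  pwComp₂ (ContinuousLinearMap.lsmul ℝ ℝ).flip

lemma l2DomL_pwScale_swap (f g : PwLB D) (q : Fin D.nT → LocBdd E3 ℝ) :
    l2DomL f (pwScale g q) = l2DomL g (pwScale f q) := by
  simp only [← l2Dom_eq_l2DomL, l2Dom]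
  refine Finset.sum_congr rfl fun T _ => integral_congr_ae (.of_forall fun x => ?_)
  change inner ℝ ((f T).1 x) ((q T).1 x • (g T).1 x) = inner ℝ ((g T).1 x) ((q T).1 x • (f T).1 x)
  rw [real_inner_smul_right, real_inner_smul_right, real_inner_comm]

variable [Fintype ι] {𝔤 : Type*} [LieRing 𝔤] [LieAlgebra ℝ 𝔤] (b : Module.Basis ι ℝ 𝔤)

lemma bktPt_eq_bktL (f g : ι → LocBdd E3 E3) (K : ι) :
    (fun x => bktPt b (fun I => (f I).1 x) (fun I => (g I).1 x) K) =
      (bktL b (postComp₂ crossCL) f g K).1 := by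
  funext x
  simp only [bktPt, bktL_apply, AddSubmonoidClass.coe_finsetSum, SetLike.val_smul, Finset.sum_apply]
  rfl

lemma bktV_gPcurl (v w : ι → D.XCurl) :
    bktV b (gPcurl S v) (gPcurl S w) = fun K T => (bktL b S.crossPot v w K T).1 := by
  funext K T
  refine (bktPt_eq_bktL b (fun I => toLB (S.potCurlL T (v I)))
    (fun I => toLB (S.potCurlL T (w I))) K).trans ?_
  simp only [bktL_apply, Finset.sum_apply]
  rfl

lemma bktS_eq_bktL (v : ι → PwLB D) (q : ι → Fin D.nT → LocBdd E3 ℝ) :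
    bktS b (fun I T => (v I T).1) (fun I T => (q I T).1) =
      fun K T => (bktL b pwScale v q K T).1 := by
  funext K T x
  simp only [bktS, bktL_apply, Finset.sum_apply, Pi.smul_apply,
    AddSubmonoidClass.coe_finsetSum, SetLike.val_smul]
  rfl

lemma inner_bktPt_eq_bktL (n : E3) (f g : ι → LocBdd E3 E3) (K : ι) :
    (fun x => inner ℝ (bktPt b (fun I => (f I).1 x) (fun I => (g I).1 x) K) n) =
      (postComp (innerSL ℝ n) (bktL b (postComp₂ crossCL) f g K)).1 := by
  funext x
  rw [real_inner_comm]
  exact congrArg (inner ℝ n) (congrFun (bktPt_eq_bktL b f g K) x)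

lemma bktDiv_eq_bktL (v w : ι → D.XCurl) : bktDiv S b v w = bktL b S.crossDiv v w := by
  have hT (K : ι) (T : Fin D.nT) : (fun x => bktPt b (fun I => (S.potCurl (v I) T).1 x)
      (fun I => (S.potCurl (w I) T).1 x) K) = (bktL b S.crossPot v w K T).1 :=
    congrFun (congrFun (bktV_gPcurl S b v w) K) T
  have hF (K : ι) (F : Fin D.nF) : (fun x => inner ℝ (bktPt b (fun I => (S.trFt (v I) F).1 x)
      (fun I => (S.trFt (w I) F).1 x) K) (D.normal F)) = _ :=
    inner_bktPt_eq_bktL b (D.normal F) (fun I => toLB (S.trFtL F (v I)))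
      (fun I => toLB (S.trFtL F (w I))) K
  funext K
  simp only [bktDiv, hT, hF, l2proj_eq_l2projL]
  refine Prod.ext (funext fun T => ?_) (Prod.ext (funext fun T => ?_) (funext fun F => ?_)) <;>
    simp only [bktL_apply, Prod.fst_sum, Prod.snd_sum, Prod.smul_fst, Prod.smul_snd,
      Finset.sum_apply, Pi.smul_apply, map_sum, map_smul] <;> rfl

variable {b} {B : LinearMap.BilinForm ℝ 𝔤}

lemma tens_l2Dom_eq_tensL (f g : ι → PwLB D) :
    tens b B l2Dom (fun I T => (f I T).1) (fun I T => (g I T).1) = tensL b B l2DomL f g :=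
  tens_eq_tensL b (f := fun f g : PwLB D => l2Dom (fun T => (f T).1) fun T => (g T).1)
    l2Dom_eq_l2DomL f g

lemma tens_ipCurl (v w : ι → D.XCurl) : tens b B S.ipCurl v w = tensL b B S.ipCurlL v w :=
  tens_eq_tensL b S.ipCurl_eq_ipCurlL v w

lemma tens_ipDiv (v w : ι → D.XDiv) : tens b B ipDiv v w = tensL b B ipDivL v w :=
  tens_eq_tensL b ipDiv_eq_ipDivL v w

lemma tens_sDivGlob (v w : ι → D.XDiv) : tens b B sDivGlob v w = tensL b B sDivGlobL v w :=
  tens_eq_tensL b sDivGlob_eq_sDivGlobL v w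

lemma tensL_ipDivL_gCL (v w : ι → D.XCurl) :
    tensL b B ipDivL (gCL S v) (gCL S w) =
      tensL b B l2DomL (gCpwL S v) (gCpwL S w) + tensL b B sDivGlobL (gCL S v) (gCL S w) := by
  have h (I J : ι) := S.ipDivL_uCL (v I) (w J)
  simp only [tensL_apply, ← Finset.sum_add_distrib, ← mul_add]
  exact Finset.sum_congr rfl fun I _ => Finset.sum_congr rfl fun J _ => congrArg _ (h I J)

/-! ## The constraint -/

lemma constraintFun_eq_tensL (A E : ι → D.XCurl) (q : ι → D.XGrad) :
    constraintFun S b B A E q = tensL b B S.ipCurlL E (gG S q) +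
      tensL b B l2DomL (gPcurlL S E) (bktL b pwScale (gPcurlL S A) (gPgradLB S q)) := by
  rw [constraintFun, tens_ipCurl, ← tens_l2Dom_eq_tensL, ← bktS_eq_bktL]
  rfl

lemma constraintFun_smul_sub (A E E' : ι → D.XCurl) (q : ι → D.XGrad) (c : ℝ) :
    constraintFun S b B A (c • (E' - E)) q =
      c * (constraintFun S b B A E' q - constraintFun S b B A E q) := by
  simp only [constraintFun_eq_tensL, map_smul, map_sub, LinearMap.smul_apply, LinearMap.sub_apply,
    smul_eq_mul]
  ring

/-- Ad-invariance makes the constraint insensitive to a change of the potential along the electric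
field. -/
lemma constraintFun_sub_smul (hB_inv : ∀ x y z : 𝔤, B ⁅x, y⁆ z = -B y ⁅x, z⁆)
    (A E : ι → D.XCurl) (q : ι → D.XGrad) (c : ℝ) :
    constraintFun S b B (A - c • E) E q = constraintFun S b B A E q := by
  simp only [constraintFun_eq_tensL, map_smul, map_sub, LinearMap.smul_apply, LinearMap.sub_apply,
    tensL_bktL_self b hB_inv l2DomL_pwScale_swap, smul_zero, sub_zero]

lemma multiplier_eq_constraintFun (hB : B.IsPosSemidef) (A E : ι → D.XCurl) (q : ι → D.XGrad) :
    tens b B S.ipCurl (gG S q) E +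
      tens b B l2Dom (bktS b (gPcurl S A) (gPgrad S q)) (gPcurl S E) =
    constraintFun S b B A E q := by
  have hl2 := (isPosSemidef_tensL b hB (isPosSemidef_l2DomL (D := D))).isSymm.eq
    (gPcurlL S E) (bktL b pwScale (gPcurlL S A) (gPgradLB S q))
  have hcurl := (isPosSemidef_tensL b hB S.isPosSemidef_ipCurlL).isSymm.eq E (gG S q)
  rw [constraintFun_eq_tensL, tens_ipCurl, hl2, hcurl, ← tens_l2Dom_eq_tensL, ← bktS_eq_bktL]
  rfl

namespace IsSolution

variable {S} {m : Variant} {N : ℕ} {t : ℕ → ℝ} {A E : ℕ → ι → D.XCurl} {lam : ℕ → ι → D.XGrad}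
  (hsol : IsSolution S b B m N t A E lam) (ht : ∀ n < N, t n < t (n + 1))
include hsol

lemma electric_eq {n : ℕ} (hn : n < N) :
    E (n + 1) = -((t (n + 1) - t n)⁻¹ • (A (n + 1) - A n)) := by
  rw [hsol.potential n hn, neg_neg]

include ht

lemma potential_eq {n : ℕ} (hn : n < N) : A (n + 1) = A n - (t (n + 1) - t n) • E (n + 1) := by
  rw [hsol.electric_eq hn, smul_neg, smul_inv_smul₀ (sub_pos.2 (ht n hn)).ne', sub_neg_eq_add,
    add_sub_cancel]

theorem constraintFun_eq_zero (hB_inv : ∀ x y z : 𝔤, B ⁅x, y⁆ z = -B y ⁅x, z⁆) {q : ι → D.XGrad}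
    (hC0 : constraintFun S b B (A 0) (E 0) q = 0) {n : ℕ} (hn : n ≤ N) :
    constraintFun S b B (A n) (E n) q = 0 := by
  induction n with
  | zero => exact hC0
  | succ n ih =>
    have hstep : constraintFun S b B (A n) ((t (n + 1) - t n)⁻¹ • (E (n + 1) - E n)) q = 0 :=
      hsol.constraint n hn q
    rw [constraintFun_smul_sub, ih (Nat.le_of_succ_le hn), sub_zero] at hstep
    rw [hsol.potential_eq ht hn, constraintFun_sub_smul S hB_inv]
    exact (mul_eq_zero.1 hstep).resolve_left (inv_pos.2 (sub_pos.2 (ht n hn))).ne'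

end IsSolution

/-! ## Energy dissipation -/

lemma magnetic_work_le_one (hB : B.IsPosSemidef) {A A' v : ι → D.XCurl} {τ : ℝ} (hτ : 0 ≤ τ)
    (hv : v = -(τ • (A' - A))) :
    tens b B ipDiv (gC S A') (gC S v) + nonlin S b B .one A A' v ≤
      -(τ * (magEnergy S b B .one A' - magEnergy S b B .one A)) := by
  simp only [nonlin, magEnergy, magOne, bktDiv_eq_bktL, tens_ipDiv]
  exact curvature_work_le (gCL S) (isPosSemidef_tensL b hB isPosSemidef_ipDivL)
    (bktL_comm b S.crossDiv_swap) hτ hv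

lemma magEnergy_two_eq (A : ι → D.XCurl) :
    magEnergy S b B .two A =
      1 / 2 * tensL b B l2DomL (curvature (gCpwL S) (bktL b S.crossPot) A)
        (curvature (gCpwL S) (bktL b S.crossPot) A)
      + 1 / 2 * tensL b B sDivGlobL (gCL S A) (gCL S A) := by
  rw [magEnergy, magTwo, tens_sDivGlob, bktV_gPcurl, ← tens_l2Dom_eq_tensL]
  rfl

lemma nonlin_two_eq (A A' v : ι → D.XCurl) :
    nonlin S b B .two A A' v =
      tensL b B l2DomL (gCpwL S A') (bktL b S.crossPot ((1 / 2 : ℝ) • (A + A')) v)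
      + tensL b B l2DomL ((1 / 2 : ℝ) • bktL b S.crossPot A' A')
          (gCpwL S v + bktL b S.crossPot ((1 / 2 : ℝ) • (A + A')) v) := by
  rw [nonlin, bktV_gPcurl, bktV_gPcurl, ← tens_l2Dom_eq_tensL, ← tens_l2Dom_eq_tensL]
  rfl

lemma magnetic_work_le_two (hB : B.IsPosSemidef) {A A' v : ι → D.XCurl} {τ : ℝ} (hτ : 0 ≤ τ)
    (hv : v = -(τ • (A' - A))) :
    tens b B ipDiv (gC S A') (gC S v) + nonlin S b B .two A A' v ≤
      -(τ * (magEnergy S b B .two A' - magEnergy S b B .two A)) := by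
  have hcell := curvature_work_le (gCpwL S) (isPosSemidef_tensL b hB isPosSemidef_l2DomL)
    (bktL_comm b S.crossPot_swap) hτ hv
  have hface := map_work_le (gCL S) (isPosSemidef_tensL b hB isPosSemidef_sDivGlobL) hτ hv
  have hdiv : tens b B ipDiv (gC S A') (gC S v) = _ :=
    (tens_ipDiv _ _).trans (tensL_ipDivL_gCL S A' v)
  rw [hdiv, nonlin_two_eq, magEnergy_two_eq, magEnergy_two_eq]
  linarith

theorem magnetic_work_le (hB : B.IsPosSemidef) (m : Variant) {A A' v : ι → D.XCurl} {τ : ℝ}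
    (hτ : 0 ≤ τ) (hv : v = -(τ • (A' - A))) :
    tens b B ipDiv (gC S A') (gC S v) + nonlin S b B m A A' v ≤
      -(τ * (magEnergy S b B m A' - magEnergy S b B m A)) := by
  cases m with
  | one => exact magnetic_work_le_one S hB hτ hv
  | two => exact magnetic_work_le_two S hB hτ hv

end

end YM

theorem proposition2_general {D : YM.Discretisation} (S : YM.Serendipity D)
    {ι : Type*} [Fintype ι] {𝔤 : Type*} [LieRing 𝔤] [LieAlgebra ℝ 𝔤]
    (b : Module.Basis ι ℝ 𝔤) (B : LinearMap.BilinForm ℝ 𝔤) (hB : B.IsPosSemidef)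
    (hB_inv : ∀ x y z : 𝔤, B ⁅x, y⁆ z = -B y ⁅x, z⁆)
    (m : YM.Variant) (N : ℕ) (t : ℕ → ℝ) (ht : ∀ n < N, t n < t (n + 1))
    (A E : ℕ → ι → D.XCurl) (lam : ℕ → ι → D.XGrad)
    (hsol : YM.IsSolution S b B m N t A E lam)
    (hC0 : ∀ q : ι → D.XGrad, YM.constraintFun S b B (A 0) (E 0) q = 0) :
    ∀ n < N,
      1 / 2 * YM.tens b B S.ipCurl (E (n + 1)) (E (n + 1)) + YM.magEnergy S b B m (A (n + 1))
        ≤ 1 / 2 * YM.tens b B S.ipCurl (E n) (E n) + YM.magEnergy S b B m (A n) := by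
  intro n hn
  have hτ : 0 < (t (n + 1) - t n)⁻¹ := inv_pos.2 (sub_pos.2 (ht n hn))
  have hPSD := YM.isPosSemidef_tensL b hB S.isPosSemidef_ipCurlL
  have hpower := hsol.evolution n hn (E (n + 1))
  have hmagnetic := YM.magnetic_work_le S (b := b) hB m hτ.le (hsol.electric_eq hn)
  have helectric := mul_le_mul_of_nonneg_left (YM.half_sub_half_le hPSD (E n) (E (n + 1))) hτ.le
  rw [add_assoc, YM.multiplier_eq_constraintFun S hB,
    hsol.constraintFun_eq_zero ht hB_inv (hC0 _) hn, add_zero, YM.tens_ipCurl,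
    ← hPSD.isSymm.eq, map_smul, smul_eq_mul] at hpower
  rw [YM.tens_ipCurl, YM.tens_ipCurl]
  refine le_of_mul_le_mul_left ?_ hτ
  linarith

theorem proposition2 {D : YM.Discretisation} (S : YM.Serendipity D)
    {ι : Type*} [Fintype ι] {𝔤 : Type*} [LieRing 𝔤] [LieAlgebra ℝ 𝔤]
    (b : Module.Basis ι ℝ 𝔤) (B : LinearMap.BilinForm ℝ 𝔤)
    (hB_symm : ∀ x y : 𝔤, B x y = B y x) (hB_pos : ∀ x : 𝔤, x ≠ 0 → 0 < B x x)
    (hB_inv : ∀ x y z : 𝔤, B ⁅x, y⁆ z = -B y ⁅x, z⁆)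
    (m : YM.Variant) (N : ℕ) (t : ℕ → ℝ) (ht0 : t 0 = 0) (ht : ∀ n < N, t n < t (n + 1))
    (A E : ℕ → ι → D.XCurl) (lam : ℕ → ι → D.XGrad)
    (hsol : YM.IsSolution S b B m N t A E lam)
    (hC0 : ∀ q : ι → D.XGrad, YM.constraintFun S b B (A 0) (E 0) q = 0) :
    ∀ n < N,
      1 / 2 * YM.tens b B S.ipCurl (E (n + 1)) (E (n + 1)) + YM.magEnergy S b B m (A (n + 1))
        ≤ 1 / 2 * YM.tens b B S.ipCurl (E n) (E n) + YM.magEnergy S b B m (A n) :=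
  proposition2_general S b B (YM.isPosSemidef_of_pos hB_symm hB_pos) hB_inv m N t ht A E lam hsol
    hC0
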